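/- Let $n\ge 2$. Let $P_{n+1}$ be Artin's pure braid group on $n+1$ strands, i.e. the kernel of the homomorphism from the braid group $B_{n+1}=\langle\sigma_1,\dots,\sigma_n\rangle$ (with Artin's relations) to the symmetric group, let $A_{i,j}$ ($1\le i<j\le n+1$) be Artin's generators of $P_{n+1}$, $A_{i,j}=(\sigma_{j-1}\cdots\sigma_{i+1})\sigma_i^2(\sigma_{j-1}\cdots\sigma_{i+1})^{-1}$. For a group $G$ let $\mathrm{gr}_*(G)=\bigoplus_{i\ge1}\Gamma^i(G)/\Gamma^{i+1}(G)$ be the Lie algebra over $\mathbb Z$ of its descending central series, with bracket induced by $[x,y]=xyx^{-1}y^{-1}$, and let $B_{i,j}\in\mathrm{gr}_1(P_{n+1})$ be the class of $A_{i,j}$. Let $\Theta_n\colon F[y_1,\dots,y_n]\to P_{n+1}$ be the homomorphism from the free group that sends $y_q$ to the braid obtained from the full twist $A_{1,2}=\sigma_1^2\in P_2$ by replacing its first strand by $n+1-q$ parallel strands and its second strand by $q$ parallel strands. Let $V_n$ be the free abelian group with basis $v_1,\dots,v_n$, let $L^{\mathbb Z}[V_n]$ be the free Lie algebra over $\mathbb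 Z$ on $V_n$, and let $\mathrm{Der}(L^{\mathbb Z}[V_n])$ be its Lie algebra of derivations. Then the morphism of Lie algebras $\iota\colon L^{\mathbb Z}[V_n]\to\mathrm{gr}_*(P_{n+1})$, $v_k\mapsto B_{k,n+1}$, is injective, and there is exactly one morphism of Lie algebras $\mathrm{Ad}\colon \mathrm{gr}_*(P_{n+1})\to\mathrm{Der}(L^{\mathbb Z}[V_n])$ with $\iota(\mathrm{Ad}(x)(w))=[x,\iota(w)]$ for all $x\in\mathrm{gr}_*(P_{n+1})$, $w\in L^{\mathbb Z}[V_n]$. As dictated by the infinitesimal braid relations, $\mathrm{Ad}(B_{i,n+1})(v_k)=[v_i,v_k]$ for $1\le i,k\le n$, and for $1\le i<j\le n$ the derivation $\mathrm{Ad}(B_{i,j})$ sends $v_i\mapsto[v_i,v_j]$, $v_j\mapsto[v_j,v_i]$ and $v_k\mapsto 0$ for $k\ne i,j$. Finally, the composite $$\mathrm{Ad}\circ\mathrm{gr}_*(\Theta_n)\colon \mathrm{gr}_*(F[y_1,\dots,y_n])\to\mathrm{Der}(L^{\mathbb Z}[V_n])$$ is a monomorphism of Lie algebras. -/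

import Mathlib

open scoped commutatorElement

/-! ### The Lie ring of the descending central series of a group -/

namespace LCSLie

variable {G : Type*} [Group G]

/-- The descending central series, indexed from `0`: `Gam G i` is the subgroup usually denoted
`Γ^{i+1}(G)`, so `Gam G 0 = G` and `Gam G (i + 1) = [Gam G i, G]`. -/
abbrev Gam (G : Type*) [Group G] (i : ℕ) : Subgroup G := (⊤ : Subgroup G).lowerCentralSeries i

theorem Gam_commutator_le (i j : ℕ) : ⁅Gam G i, Gam G j⁆ ≤ Gam G (i + j + 1) := by
  induction j generalizing i with
  | zero => exact le_refl _
  | succ j ih =>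
    set N : Subgroup G := Gam G (i + (j + 1) + 1) with hN
    set q := QuotientGroup.mk' N
    have key : ∀ K : Subgroup G, K ≤ N ↔ K.map q = ⊥ := by
      intro K
      rw [Subgroup.map_eq_bot_iff, QuotientGroup.ker_mk']
    rw [key]
    change Subgroup.map q ⁅Gam G i, ⁅Gam G j, (⊤ : Subgroup G)⁆⁆ = ⊥
    rw [Subgroup.commutator_comm, Subgroup.map_commutator, Subgroup.map_commutator]
    apply Subgroup.commutator_commutator_eq_bot_of_rotate
    · rw [← Subgroup.map_commutator, ← Subgroup.map_commutator, ← key,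
        Subgroup.commutator_comm ⊤]
      change ⁅Gam G (i + 1), Gam G j⁆ ≤ N
      refine (ih (i + 1)).trans (le_of_eq ?_)
      rw [hN]; congr 1; omega
    · rw [← Subgroup.map_commutator, ← Subgroup.map_commutator, ← key]
      exact Subgroup.commutator_mono (ih i) le_rfl

theorem comm_mem {i j : ℕ} {x y : G} (hx : x ∈ Gam G i) (hy : y ∈ Gam G j) :
    ⁅x, y⁆ ∈ Gam G (i + j + 1) :=
  Gam_commutator_le i j (Subgroup.commutator_mem_commutator hx hy)

theorem Gam_anti {i j : ℕ} (h : i ≤ j) : Gam G j ≤ Gam G i :=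
  Subgroup.lowerCentralSeries_antitone _ h

/-- The subquotient `Γ^{i+1}(G) / Γ^{i+2}(G)`, as an abelian group written multiplicatively. -/
abbrev Piece (G : Type*) [Group G] (i : ℕ) : Type _ :=
  Gam G i ⧸ (Gam G (i + 1)).subgroupOf (Gam G i)

/-- The class of an element of `Gam G i` in `Piece G i`. -/
abbrev cls (i : ℕ) (x : Gam G i) : Piece G i := QuotientGroup.mk x

theorem cls_eq_iff {i : ℕ} {x y : Gam G i} :
    cls i x = cls i y ↔ (x : G)⁻¹ * y ∈ Gam G (i + 1) := by
  rw [QuotientGroup.eq, Subgroup.mem_subgroupOf]; rfl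

theorem cls_eq_one_iff {i : ℕ} {x : Gam G i} : cls i x = 1 ↔ (x : G) ∈ Gam G (i + 1) := by
  rw [QuotientGroup.eq_one_iff, Subgroup.mem_subgroupOf]

instance (i : ℕ) : CommGroup (Piece G i) :=
  { (inferInstance : Group (Piece G i)) with
    mul_comm := by
      intro a b
      induction a using QuotientGroup.induction_on with | _ x =>
      induction b using QuotientGroup.induction_on with | _ y =>
      change cls i (x * y) = cls i (y * x)
      rw [cls_eq_iff]
      have h := comm_mem (inv_mem y.2) (inv_mem x.2)
      have h' := Gam_anti (show i + 1 ≤ i + i + 1 by omega) h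
      convert h' using 1
      simp [commutatorElement_def, mul_assoc] }

/-- Conjugation acts trivially on the subquotients. -/
theorem cls_conj {i : ℕ} (g : G) (x : Gam G i) (h : g * x * g⁻¹ ∈ Gam G i) :
    cls i ⟨g * x * g⁻¹, h⟩ = cls i x := by
  symm
  rw [cls_eq_iff]
  have hg : g ∈ Gam G 0 := Subgroup.mem_top g
  have h := comm_mem (inv_mem x.2) hg
  simpa [commutatorElement_def, mul_assoc] using h

theorem conj_mem {i : ℕ} (g : G) {x : G} (h : x ∈ Gam G i) : g * x * g⁻¹ ∈ Gam G i :=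
  (inferInstance : (Gam G i).Normal).conj_mem x h g

/-- Commutation with a fixed `x`, as a homomorphism between subquotients. -/
def bracketRight (i j : ℕ) (x : Gam G i) : Piece G j →* Piece G (i + j + 1) :=
  QuotientGroup.lift _
    (MonoidHom.mk' (fun y : Gam G j => cls (i + j + 1) ⟨⁅(x : G), (y : G)⁆, comm_mem x.2 y.2⟩)
      (by
        intro y z
        have h : (⟨⁅(x : G), (y * z : G)⁆, comm_mem x.2 (mul_mem y.2 z.2)⟩ : Gam G (i + j + 1)) =
            ⟨⁅(x : G), (y : G)⁆, comm_mem x.2 y.2⟩ *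
              ⟨(y : G) * ⁅(x : G), (z : G)⁆ * (y : G)⁻¹, conj_mem _ (comm_mem x.2 z.2)⟩ := by
          apply Subtype.ext
          change ⁅(x : G), (y * z : G)⁆ = ⁅(x : G), (y : G)⁆ * (y * ⁅(x : G), (z : G)⁆ * (y : G)⁻¹)
          simp only [commutatorElement_mul_right_eq_mul_conj, mul_assoc]
        refine (congrArg (cls (i + j + 1)) h).trans ?_
        have h2 := cls_conj (y : G) (⟨⁅(x : G), (z : G)⁆, comm_mem x.2 z.2⟩ : Gam G (i + j + 1))
          (conj_mem _ (comm_mem x.2 z.2))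
        exact congrArg (cls (i + j + 1) ⟨⁅(x : G), (y : G)⁆, comm_mem x.2 y.2⟩ * ·) h2))
    (by
      intro y hy
      rw [Subgroup.mem_subgroupOf] at hy
      rw [MonoidHom.mem_ker]
      change cls _ _ = 1
      rw [cls_eq_one_iff]
      have h : ⁅(x : G), (y : G)⁆ ∈ Gam G (i + (j + 1) + 1) := comm_mem x.2 hy
      exact h)

/-- The commutator pairing `Piece G i × Piece G j → Piece G (i + j + 1)` induced by
`[x, y] = x y x⁻¹ y⁻¹`; it is biadditive. -/
def bracketMul (i j : ℕ) : Piece G i →* (Piece G j →* Piece G (i + j + 1)) :=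
  QuotientGroup.lift _
    (MonoidHom.mk' (bracketRight i j)
      (by
        intro x y
        ext z
        change cls _ _ = cls _ _ * cls _ _
        have h : (⟨⁅(x * y : G), (z : G)⁆, comm_mem (mul_mem x.2 y.2) z.2⟩ : Gam G (i + j + 1)) =
            ⟨(x : G) * ⁅(y : G), (z : G)⁆ * (x : G)⁻¹, conj_mem _ (comm_mem y.2 z.2)⟩ *
              ⟨⁅(x : G), (z : G)⁆, comm_mem x.2 z.2⟩ := by
          exact Subtype.ext (commutatorElement_mul_left_eq_conj_mul (x : G) y z)
        refine (congrArg (cls (i + j + 1)) h).trans ?_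
        have h2 := cls_conj (x : G) (⟨⁅(y : G), (z : G)⁆, comm_mem y.2 z.2⟩ : Gam G (i + j + 1))
          (conj_mem _ (comm_mem y.2 z.2))
        refine (congrArg (· * cls (i + j + 1) ⟨⁅(x : G), (z : G)⁆, comm_mem x.2 z.2⟩) h2).trans ?_
        exact mul_comm _ _))
    (by
      intro x hx
      rw [Subgroup.mem_subgroupOf] at hx
      rw [MonoidHom.mem_ker]
      ext y
      change cls _ _ = 1
      rw [cls_eq_one_iff]
      have := comm_mem hx y.2
      rwa [show i + 1 + (j : ℕ) + 1 = i + j + 1 + 1 by omega] at this)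

/-- The commutator pairing, written additively. -/
def bracketAdd (i j : ℕ) :
    Additive (Piece G i) →+ Additive (Piece G j) →+ Additive (Piece G (i + j + 1)) :=
  AddMonoidHom.mk' (fun a => (bracketMul i j a.toMul).toAdditive)
    (by
      intro a b
      apply AddMonoidHom.ext
      intro c
      change Additive.ofMul (bracketMul i j (a.toMul * b.toMul) c.toMul) = _
      rw [map_mul]
      rfl)

end LCSLie

open LCSLie in
/-- `gr_*(G) = ⨁_{i ≥ 1} Γ^i(G) / Γ^{i+1}(G)`; the summand with index `i : ℕ` is
`Γ^{i+1}(G) / Γ^{i+2}(G)`. -/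
def Gr (G : Type*) [Group G] : Type _ := DirectSum ℕ fun i => Additive (Piece G i)

namespace Gr

open LCSLie

variable {G : Type*} [Group G]

noncomputable instance : AddCommGroup (Gr G) :=
  inferInstanceAs (AddCommGroup (DirectSum ℕ fun i => Additive (Piece G i)))

/-- The inclusion of the summand with index `i`. -/
noncomputable def incl (i : ℕ) : Additive (Piece G i) →+ Gr G :=
  DirectSum.of (fun i => Additive (Piece G i)) i

/-- The element of `gr_*(G)` represented by `x ∈ Γ^{i+1}(G)`, in the summand with index `i`. -/
noncomputable def mk (i : ℕ) (x : G) (hx : x ∈ Gam G i) : Gr G :=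
  incl i (Additive.ofMul (cls i ⟨x, hx⟩))

theorem addHom_ext {A : Type*} [AddZeroClass A] {f g : Gr G →+ A}
    (h : ∀ i x hx, f (mk i x hx) = g (mk i x hx)) : f = g := by
  refine DirectSum.addHom_ext (fun i y => ?_)
  induction y using Additive.rec with | _ y =>
  induction y using QuotientGroup.induction_on with | _ x =>
  exact h i x x.2

theorem mk_congr {i j : ℕ} (hij : i = j) {x y : G} (hxy : x = y) (hx : x ∈ Gam G i)
    (hy : y ∈ Gam G j) : mk i x hx = mk j y hy := by
  subst hij; subst hxy; rfl

theorem mk_mul {i : ℕ} {x y : G} (hx : x ∈ Gam G i) (hy : y ∈ Gam G i) :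
    mk i (x * y) (mul_mem hx hy) = mk i x hx + mk i y hy :=
  (incl i).map_add (Additive.ofMul (cls i ⟨x, hx⟩)) (Additive.ofMul (cls i ⟨y, hy⟩))

theorem mk_inv {i : ℕ} {x : G} (hx : x ∈ Gam G i) : mk i x⁻¹ (inv_mem hx) = - mk i x hx :=
  (incl i).map_neg (Additive.ofMul (cls i ⟨x, hx⟩))

theorem mk_eq_zero {i : ℕ} {x : G} (hx : x ∈ Gam G i) (h : x ∈ Gam G (i + 1)) :
    mk i x hx = 0 := by
  have : cls i ⟨x, hx⟩ = 1 := cls_eq_one_iff.2 h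
  rw [mk, this]
  exact (incl i).map_zero

theorem mk_conj {i : ℕ} (g : G) {x : G} (hx : x ∈ Gam G i) (h : g * x * g⁻¹ ∈ Gam G i) :
    mk i (g * x * g⁻¹) h = mk i x hx :=
  congrArg (fun c => incl i (Additive.ofMul c)) (cls_conj g ⟨x, hx⟩ h)

/-- The Lie bracket of `gr_*(G)` as a biadditive map. -/
noncomputable def bracketHom : Gr G →+ Gr G →+ Gr G :=
  DirectSum.toAddMonoid fun i => AddMonoidHom.flip (DirectSum.toAddMonoid fun j =>
    AddMonoidHom.flip ((AddMonoidHom.compHom (incl (i + j + 1))).comp (bracketAdd i j)))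

noncomputable instance : Bracket (Gr G) (Gr G) := ⟨fun x y => bracketHom x y⟩

theorem bracket_def (x y : Gr G) : ⁅x, y⁆ = bracketHom x y := rfl

/-- On homogeneous elements the bracket is induced by the commutator of the group. -/
theorem mk_lie_mk {i j : ℕ} {x y : G} (hx : x ∈ Gam G i) (hy : y ∈ Gam G j) :
    ⁅mk i x hx, mk j y hy⁆ = mk (i + j + 1) ⁅x, y⁆ (comm_mem hx hy) := by
  rw [bracket_def]
  simp only [bracketHom, mk, incl]
  erw [DirectSum.toAddMonoid_of, AddMonoidHom.flip_apply, DirectSum.toAddMonoid_of]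
  rfl

theorem induction {p : Gr G → Prop} (x : Gr G) (h0 : p 0) (hmk : ∀ i a ha, p (mk i a ha))
    (hadd : ∀ x y, p x → p y → p (x + y)) : p x := by
  refine DirectSum.induction_on x h0 ?_ hadd
  intro i y
  induction y using Additive.rec with | _ y =>
  induction y using QuotientGroup.induction_on with | _ a =>
  exact hmk i a a.2

theorem add_lie' (x y z : Gr G) : ⁅x + y, z⁆ = ⁅x, z⁆ + ⁅y, z⁆ := by
  simp only [bracket_def, map_add, AddMonoidHom.add_apply]

theorem lie_add' (x y z : Gr G) : ⁅x, y + z⁆ = ⁅x, y⁆ + ⁅x, z⁆ := by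
  simp only [bracket_def, map_add]

theorem zero_lie' (x : Gr G) : ⁅(0 : Gr G), x⁆ = 0 := by
  simp only [bracket_def, map_zero, AddMonoidHom.zero_apply]

theorem lie_zero' (x : Gr G) : ⁅x, (0 : Gr G)⁆ = 0 := by
  simp only [bracket_def, map_zero]

theorem neg_lie' (x y : Gr G) : ⁅-x, y⁆ = -⁅x, y⁆ := by
  simp only [bracket_def, map_neg, AddMonoidHom.neg_apply]

theorem lie_swap (x y : Gr G) : ⁅x, y⁆ + ⁅y, x⁆ = 0 := by
  induction x using induction with
  | h0 => rw [zero_lie', lie_zero', add_zero]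
  | hadd x x' h h' =>
    rw [add_lie', lie_add', add_add_add_comm, h, h', add_zero]
  | hmk i a ha =>
    induction y using induction with
    | h0 => rw [zero_lie', lie_zero', add_zero]
    | hadd x x' h h' =>
      rw [add_lie', lie_add', add_add_add_comm, h, h', add_zero]
    | hmk j b hb =>
      rw [mk_lie_mk, mk_lie_mk, mk_congr (show j + i + 1 = i + j + 1 by omega)
        (commutatorElement_inv a b).symm (comm_mem hb ha) (inv_mem (comm_mem ha hb)),
        mk_inv (comm_mem ha hb), add_neg_cancel]

theorem lie_self' (x : Gr G) : ⁅x, x⁆ = 0 := by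
  induction x using induction with
  | h0 => exact zero_lie' 0
  | hmk i a ha =>
    rw [mk_lie_mk]
    refine mk_eq_zero _ ?_
    rw [commutatorElement_self]
    exact one_mem _
  | hadd a b ha hb =>
    rw [add_lie', lie_add', lie_add', ha, hb, zero_add, add_zero, lie_swap]

theorem jacobi (x y z : Gr G) : ⁅⁅x, y⁆, z⁆ + ⁅⁅y, z⁆, x⁆ + ⁅⁅z, x⁆, y⁆ = 0 := by
  induction x using induction with
  | h0 => simp only [zero_lie', lie_zero', add_zero]
  | hadd x x' h h' =>
    simp only [add_lie', lie_add']
    rw [← add_zero (0 : Gr G)]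
    nth_rw 1 [← h]
    rw [← h']
    abel
  | hmk i a ha =>
    induction y using induction with
    | h0 => simp only [zero_lie', lie_zero', add_zero]
    | hadd x x' h h' =>
      simp only [add_lie', lie_add']
      rw [← add_zero (0 : Gr G)]
      nth_rw 1 [← h]
      rw [← h']
      abel
    | hmk j b hb =>
      induction z using induction with
      | h0 => simp only [zero_lie', lie_zero', add_zero]
      | hadd x x' h h' =>
        simp only [add_lie', lie_add']
        rw [← add_zero (0 : Gr G)]
        nth_rw 1 [← h]
        rw [← h']
        abel
      | hmk k c hc =>
        have e1 : ⁅⁅mk i a ha, mk j b hb⁆, mk k c hc⁆ =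
            mk (i + j + k + 2) ⁅⁅a, b⁆, b * c * b⁻¹⁆
              (Gam_anti (by omega) (comm_mem (comm_mem ha hb) (conj_mem b hc))) := by
          rw [← mk_conj b hc (conj_mem b hc), mk_lie_mk, mk_lie_mk]
          exact mk_congr (by omega) rfl _ _
        have e2 : ⁅⁅mk j b hb, mk k c hc⁆, mk i a ha⁆ =
            mk (i + j + k + 2) ⁅⁅b, c⁆, c * a * c⁻¹⁆
              (Gam_anti (by omega) (comm_mem (comm_mem hb hc) (conj_mem c ha))) := by
          rw [← mk_conj c ha (conj_mem c ha), mk_lie_mk, mk_lie_mk]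
          exact mk_congr (by omega) rfl _ _
        have e3 : ⁅⁅mk k c hc, mk i a ha⁆, mk j b hb⁆ =
            mk (i + j + k + 2) ⁅⁅c, a⁆, a * b * a⁻¹⁆
              (Gam_anti (by omega) (comm_mem (comm_mem hc ha) (conj_mem a hb))) := by
          rw [← mk_conj a hb (conj_mem a hb), mk_lie_mk, mk_lie_mk]
          exact mk_congr (by omega) rfl _ _
        rw [e1, e2, e3, ← mk_mul, ← mk_mul]
        refine mk_eq_zero _ ?_
        rw [commutatorElement_commutatorElement_conj_mul]
        exact one_mem _

noncomputable instance : LieRing (Gr G) where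
  add_lie := add_lie'
  lie_add := lie_add'
  lie_self := lie_self'
  leibniz_lie x y z := by
    have h := jacobi x y z
    have h1 : ⁅x, ⁅y, z⁆⁆ = -⁅⁅y, z⁆, x⁆ := eq_neg_of_add_eq_zero_left (lie_swap _ _)
    have h2 : ⁅y, ⁅x, z⁆⁆ = ⁅⁅z, x⁆, y⁆ := by
      rw [eq_neg_of_add_eq_zero_left (lie_swap y ⁅x, z⁆),
        eq_neg_of_add_eq_zero_left (lie_swap x z), neg_lie', neg_neg]
    rw [h1, h2, neg_eq_iff_add_eq_zero, ← h]
    abel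

end Gr

namespace LCSLie

variable {G H : Type*} [Group G] [Group H]

theorem map_mem (f : G →* H) {i : ℕ} {x : G} (hx : x ∈ Gam G i) : f x ∈ Gam H i := by
  have h : f x ∈ (Gam G i).map f := Subgroup.mem_map_of_mem f hx
  rw [Subgroup.map_lowerCentralSeries] at h
  exact Subgroup.lowerCentralSeries_mono i le_top h

/-- The map induced by a homomorphism on the subquotients. -/
def mapPiece (f : G →* H) (i : ℕ) : Piece G i →* Piece H i :=
  QuotientGroup.lift _
    (MonoidHom.mk' (fun x : Gam G i => cls i (⟨f x, map_mem f x.2⟩ : Gam H i)) (by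
      intro x y
      exact congrArg (cls i) (Subtype.ext (map_mul f (x : G) y))))
    (by
      intro x hx
      rw [Subgroup.mem_subgroupOf] at hx
      exact cls_eq_one_iff.2 (map_mem f hx))

end LCSLie

namespace Gr

open LCSLie

variable {G H : Type*} [Group G] [Group H]

/-- The additive map underlying `gr_*(f)`. -/
noncomputable def mapAdd (f : G →* H) : Gr G →+ Gr H :=
  DirectSum.toAddMonoid fun i => (incl i).comp (mapPiece f i).toAdditive

theorem mapAdd_mk (f : G →* H) {i : ℕ} {x : G} (hx : x ∈ Gam G i) :
    mapAdd f (mk i x hx) = mk i (f x) (map_mem f hx) := by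
  simp only [mapAdd, mk, incl]
  erw [DirectSum.toAddMonoid_of]
  rfl

theorem mapAdd_lie (f : G →* H) (x y : Gr G) : mapAdd f ⁅x, y⁆ = ⁅mapAdd f x, mapAdd f y⁆ := by
  induction x using induction with
  | h0 => simp only [zero_lie', map_zero]
  | hadd x x' h h' => simp only [add_lie', map_add, h, h']
  | hmk i a ha =>
    induction y using induction with
    | h0 => simp only [lie_zero', map_zero]
    | hadd x x' h h' => simp only [lie_add', map_add, h, h']
    | hmk j b hb =>
      simp only [mk_lie_mk, mapAdd_mk]
      exact mk_congr rfl (map_commutatorElement f a b) _ _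

/-- The morphism of Lie algebras `gr_*(f) : gr_*(G) → gr_*(H)` induced by a homomorphism `f`. -/
noncomputable def map (f : G →* H) : Gr G →ₗ⁅ℤ⁆ Gr H :=
  { (mapAdd f).toIntLinearMap with
    map_lie' := fun {x y} => mapAdd_lie f x y }

end Gr

/-! ### Braid groups -/

/-- The Artin relations for the braid group on `n + 1` strands, with generators
`σ_0, …, σ_{n-1}`; `σ_i` exchanges the strands in positions `i` and `i + 1`, counted from `0`. -/
inductive ArtinRel (n : ℕ) : FreeGroup (Fin n) → Prop
  | far (i j : Fin n) (h : (i : ℕ) + 2 ≤ j) :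
      ArtinRel n ⁅FreeGroup.of i, FreeGroup.of j⁆
  | braid (i j : Fin n) (h : (i : ℕ) + 1 = j) :
      ArtinRel n (FreeGroup.of i * FreeGroup.of j * FreeGroup.of i *
        (FreeGroup.of j * FreeGroup.of i * FreeGroup.of j)⁻¹)

/-- Artin's braid group `B_{n+1}` on `n + 1` strands. -/
abbrev BraidGroup (n : ℕ) : Type := PresentedGroup {r | ArtinRel n r}

namespace BraidGroup

/-- Artin's generators. -/
def sigma {n : ℕ} (i : Fin n) : BraidGroup n := PresentedGroup.of i

/-- The homomorphism from `B_{n+1}` to the symmetric group on the `n + 1` strands. -/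
def toPerm (n : ℕ) : BraidGroup n →* Equiv.Perm (Fin (n + 1)) :=
  PresentedGroup.toGroup (f := fun i => Equiv.swap i.castSucc i.succ) (by
    rintro r (⟨i, j, h⟩ | ⟨i, j, h⟩)
    · rw [map_commutatorElement, FreeGroup.lift_apply_of, FreeGroup.lift_apply_of,
        commutatorElement_eq_one_iff_commute]
      apply Equiv.Perm.Disjoint.commute
      rw [Equiv.Perm.disjoint_iff_disjoint_support, Equiv.Perm.support_swap,
        Equiv.Perm.support_swap]
      · simp [Fin.ext_iff]; omega
      · simp [Fin.ext_iff]
      · simp [Fin.ext_iff]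
    · rw [map_mul, map_inv, mul_inv_eq_one]
      simp only [map_mul, FreeGroup.lift_apply_of]
      have hj : j.castSucc = i.succ := by ext; simp [← h]
      have h1 : j.succ ≠ i.succ := by simp only [ne_eq, Fin.ext_iff, Fin.val_succ]; omega
      have h2 : i.castSucc ≠ i.succ := by simp [Fin.ext_iff]
      have h3 : i.castSucc ≠ j.succ := by
        simp only [ne_eq, Fin.ext_iff, Fin.val_succ, Fin.val_castSucc]; omega
      have e1 := Equiv.swap_mul_swap_mul_swap h2 h3
      have e2 := Equiv.swap_mul_swap_mul_swap h1 h3.symm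
      rw [Equiv.swap_comm i.succ i.castSucc, Equiv.swap_comm j.succ i.succ] at e2
      rw [hj, e1, e2, Equiv.swap_comm])

theorem toPerm_sigma {n : ℕ} (i : Fin n) : toPerm n (sigma i) = Equiv.swap i.castSucc i.succ :=
  PresentedGroup.toGroup.of _

/-- The positive braid spelled by a word in Artin's generators. -/
def word {n : ℕ} (w : List (Fin n)) : BraidGroup n := (w.map sigma).prod

theorem toPerm_word_reverse {n : ℕ} (w : List (Fin n)) :
    toPerm n (word w * word w.reverse) = 1 := by
  induction w with
  | nil => simp [word]
  | cons a w ih =>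
    simp only [word, map_mul, List.map_cons, List.prod_cons, List.reverse_cons, List.map_append,
      List.prod_append, List.map_nil, List.prod_nil, mul_one] at ih ⊢
    rw [mul_assoc, ← mul_assoc (toPerm n (List.map sigma w).prod), ih, one_mul, toPerm_sigma,
      Equiv.swap_mul_self]

/-- The pure braid group `P_{n+1}` on `n + 1` strands. -/
def pureSubgroup (n : ℕ) : Subgroup (BraidGroup n) := (toPerm n).ker

end BraidGroup

open BraidGroup

/-- The pure braid group `P_{n+1}` on `n + 1` strands, as a type. -/
abbrev PureBraid (n : ℕ) : Type := pureSubgroup n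

namespace PureBraid

/-- The word `σ_{j-1} σ_{j-2} ⋯ σ_{i+1}`. -/
def between {n : ℕ} (i j : Fin (n + 1)) : List (Fin n) :=
  ((List.finRange n).filter fun k : Fin n => (i : ℕ) < k ∧ (k : ℕ) < j).reverse

/-- Artin's generator `A_{i,j} = (σ_{j-1} ⋯ σ_{i+1}) σ_i² (σ_{j-1} ⋯ σ_{i+1})⁻¹` of `P_{n+1}`,
for strands `i < j` counted from `0`. -/
def artin {n : ℕ} (i j : Fin (n + 1)) (h : i < j) : PureBraid n :=
  ⟨word (between i j) * sigma ⟨i, by omega⟩ ^ 2 * (word (between i j))⁻¹, by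
    have hs : sigma (n := n) ⟨i, by omega⟩ ^ 2 ∈ pureSubgroup n := by
      rw [pureSubgroup, MonoidHom.mem_ker, map_pow, toPerm_sigma, pow_two, Equiv.swap_mul_self]
    exact (MonoidHom.normal_ker (toPerm n)).conj_mem _ hs _⟩

/-- The class `B_{i,j}` of `A_{i,j}` in `gr_1(P_{n+1})`. -/
noncomputable def B {n : ℕ} (i j : Fin (n + 1)) (h : i < j) : Gr (PureBraid n) :=
  Gr.mk 0 (artin i j h) (Subgroup.mem_top _)

/-- A word spelling the positive braid that moves the cable of the first `n - q` strands across the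
cable of the last `q + 1` strands, each cable being kept parallel: successively for
`r = 0, …, q`, the `r`-th strand of the second cable is moved across the first cable, by
`σ_{r+n-q-1} ⋯ σ_{r+1} σ_r`. -/
def cableWord {n : ℕ} (q : Fin n) : List (Fin n) :=
  (List.finRange ((q : ℕ) + 1)).flatMap fun r : Fin ((q : ℕ) + 1) =>
    (List.finRange (n - (q : ℕ))).reverse.map fun s : Fin (n - (q : ℕ)) => ⟨(r : ℕ) + s, by omega⟩

/-- The cabling braid: the full twist `A_{1,2} = σ²` on two strands, with the first strand replaced
by `n - q` parallel strands and the second one by `q + 1` parallel strands. The cables cross, and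
cross back by the same word read backwards. -/
def cable {n : ℕ} (q : Fin n) : PureBraid n :=
  ⟨word (cableWord q) * word (cableWord q).reverse, toPerm_word_reverse _⟩

/-- `Θ_n : F[y_1, …, y_n] → P_{n+1}`; the generator `y_{q+1}` is `FreeGroup.of q`, for
`q = 0, …, n - 1`. -/
def Theta (n : ℕ) : FreeGroup (Fin n) →* PureBraid n := FreeGroup.lift cable

/-- The morphism `L^ℤ[V_n] → gr_*(P_{n+1})` from the free Lie algebra with basis elements
`v_1, …, v_n` of `V_n` that sends `v_k` to `B_{k,n+1}`. -/
noncomputable def lastStrand (n : ℕ) : FreeLieAlgebra ℤ (Fin n) →ₗ⁅ℤ⁆ Gr (PureBraid n) :=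
  FreeLieAlgebra.lift ℤ fun k => B k.castSucc (Fin.last n) (Fin.castSucc_lt_last k)

/-- `Ad` is the adjoint action of `gr_*(P_{n+1})` on `L^ℤ[V_n]`, the latter being viewed inside
`gr_*(P_{n+1})` through `lastStrand`. -/
def IsAd (n : ℕ) (Ad : Gr (PureBraid n) →ₗ⁅ℤ⁆
    LieDerivation ℤ (FreeLieAlgebra ℤ (Fin n)) (FreeLieAlgebra ℤ (Fin n))) : Prop :=
  ∀ x w, lastStrand n (Ad x w) = ⁅x, lastStrand n w⁆

end PureBraid

/-! ### Lyndon words -/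

section Lyndon

variable {X : Type*} [LinearOrder X]

/-! Free Lie rings are controlled by Lyndon words. The standard bracketings span over `ℤ`, and in
the free associative algebra over any commutative ring each of them has its own Lyndon word as
smallest word, with coefficient 1. So the free Lie ring `L` embeds in the free associative ring, and
the kernel of its map to the free associative algebra over `ZMod 2` is `2L`. Through the Magnus
expansion, `L` is also `gr_*` of the free group.

Injectivity of ι. In Artin's action on a free group a pure braid conjugates each generator. Killing
the last generator leaves an action on the free group of rank `n`, trivial on its abelianization,
and the element that conjugates the last generator becomes a crossed homomorphism `u` for this
action. Such a `u` respects the descending central series. The braids `A_{k,n+1}` act trivially and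
`u` sends them to `x_k` modulo commutators, so `u` induces a left inverse on `gr_*`
(`Gr.map_injective_of_crossed`).

Existence of Ad. Conjugation by braids on `gr_*` of the pure braid group factors through the
symmetric group, so the class of a conjugate of `σ_k²` depends only on the two strands that it
links. These conjugates generate the pure braid group, and the braid relations yield the
infinitesimal ones. Hence the image of ι is an ideal, and bracketing with it can be pulled back
along the injection ι.

Injectivity of the composite is proved modulo 2. The class of a cabling braid is the sum of the
`B_{s,t}` over strands `s`, `t` in different cables; modulo 2 it sends `v_k` to `[v_1 + ⋯ + v_n,
v_k]` if `k` lies in the first cable and to 0 otherwise. On the partial sums `w_k = v_1 + ⋯ + v_k`,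
a first cable of `p` strands acts by `w_k ↦ [w_n, w_{min(k,p)}]`. Adding right multiplication by
`w_p` gives an operator `ω_p`. In characteristic 2 the `ω_p` commute with right multiplication by
`w_n`, and `ω_n` is left multiplication by `w_n`. The orbit map `ψ(r) = ω_r(1)` is injective, by a
triangularity argument. If a Lie element `w` acts by zero, evaluating `ω_w` at `w_n` in two ways
shows that `ψ(w)` commutes with `w_n`. So `ψ(w)`, and then `w` modulo 2, is a polynomial in one
letter, which gives `w = c y + 2b` for one generator `y`. Since `n ≥ 2`, `c` is even; since `L` is
torsion free, `w / 2` acts by zero again. Thus `w` is divisible by every power of 2 and vanishes. -/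

theorem List.lt_append_of_ne_nil (a : List X) {b : List X} (hb : b ≠ []) : a < a ++ b := by
  induction a with
  | nil =>
    cases b with
    | nil => exact absurd rfl hb
    | cons x b => exact List.Lex.nil
  | cons x a ih => exact List.Lex.cons ih

theorem List.le_append (a b : List X) : a ≤ a ++ b := by
  rcases eq_or_ne b [] with rfl | hb
  · simp
  · exact (List.lt_append_of_ne_nil a hb).le

theorem List.append_lt_append_left_iff (a : List X) {b c : List X} : a ++ b < a ++ c ↔ b < c := by
  induction a with
  | nil => rfl
  | cons x a ih => rw [← ih]; exact List.cons_lt_cons_self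

theorem List.append_lt_append_of_lt {a b : List X} (h : a < b) (hl : b.length ≤ a.length)
    (c d : List X) : a ++ c < b ++ d := by
  induction a generalizing b with
  | nil =>
    simp only [List.length_nil, Nat.le_zero, List.length_eq_zero_iff] at hl
    subst hl
    exact absurd h (lt_irrefl _)
  | cons x a ih =>
    cases b with
    | nil => exact absurd h (List.not_lt_nil _)
    | cons y b =>
      rcases List.cons_lt_cons_iff.1 h with h1 | ⟨rfl, h1⟩
      · exact List.Lex.rel h1
      · exact List.Lex.cons (ih h1 (by simpa using hl))

theorem List.lt_append_of_lt_of_not_prefix {a b : List X} (h : a < b) (hp : ¬ a <+: b)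
    (c d : List X) : a ++ c < b ++ d := by
  induction a generalizing b with
  | nil => exact absurd (List.nil_prefix) hp
  | cons x a ih =>
    cases b with
    | nil => exact absurd h (List.not_lt_nil _)
    | cons y b =>
      rcases List.cons_lt_cons_iff.1 h with h1 | ⟨rfl, h1⟩
      · exact List.Lex.rel h1
      · exact List.Lex.cons (ih h1 (by simpa using hp))

/-- A Lyndon word: a nonempty word smaller than all its proper nonempty suffixes. -/
def IsLyndon (w : List X) : Prop :=
  w ≠ [] ∧ ∀ a b, a ≠ [] → b ≠ [] → w = a ++ b → w < b

/-- `u ++ v` is the standard factorization of a Lyndon word: `v` is its smallest proper suffix. -/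
structure IsStdPair (u v : List X) : Prop where
  left : IsLyndon u
  right : IsLyndon v
  lt : u < v
  le : ∀ a b, a ≠ [] → b ≠ [] → u = a ++ b → v ≤ b

theorem IsLyndon.singleton (x : X) : IsLyndon [x] := by
  refine ⟨by simp, fun a b ha hb h => ?_⟩
  have := congrArg List.length h
  have h1 := List.length_pos_of_ne_nil ha
  have h2 := List.length_pos_of_ne_nil hb
  simp at this; omega

/-- The main point is `u ++ v < v`. If `v = u ++ t`, it reduces to `v < t`; otherwise the first
difference between `u` and `v` decides. A suffix beginning inside `u` is settled by the Lyndon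
property of `u`, the suffix being no longer than `u`. -/
theorem IsLyndon.append {u v : List X} (hu : IsLyndon u) (hv : IsLyndon v) (h : u < v) :
    IsLyndon (u ++ v) := by
  have huv : u ++ v < v := by
    by_cases hp : u <+: v
    · obtain ⟨t, rfl⟩ := hp
      have ht : t ≠ [] := by rintro rfl; simp at h
      exact (List.append_lt_append_left_iff u).2 (hv.2 u t hu.1 ht rfl)
    · simpa using List.lt_append_of_lt_of_not_prefix h hp v []
  refine ⟨by simp [hu.1], fun a b ha hb hab => ?_⟩
  rcases List.append_eq_append_iff.1 hab with ⟨s, rfl, rfl⟩ | ⟨s, rfl, rfl⟩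
  · rcases eq_or_ne s [] with rfl | hs
    · simpa using huv
    · exact huv.trans (hv.2 s b hs hb rfl)
  · rcases eq_or_ne s [] with rfl | hs
    · simpa using huv
    · refine List.append_lt_append_of_lt (hu.2 a s ha hs rfl) ?_ v v
      simp

theorem IsStdPair.isLyndon {u v : List X} (h : IsStdPair u v) : IsLyndon (u ++ v) :=
  h.left.append h.right h.lt

theorem IsStdPair.le_suffix {u v : List X} (h : IsStdPair u v) {a b : List X} (ha : a ≠ [])
    (hb : b ≠ []) (hab : u ++ v = a ++ b) : v ≤ b := by
  rcases List.append_eq_append_iff.1 hab with ⟨s, rfl, rfl⟩ | ⟨s, rfl, rfl⟩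
  · rcases eq_or_ne s [] with rfl | hs
    · simp
    · exact (h.right.2 s b hs hb rfl).le
  · rcases eq_or_ne s [] with rfl | hs
    · simp
    · exact (h.le a s ha hs rfl).trans (List.le_append _ _)

theorem IsStdPair.unique {u v u' v' : List X} (h : IsStdPair u v) (h' : IsStdPair u' v')
    (e : u ++ v = u' ++ v') : u = u' ∧ v = v' := by
  have : v = v' := le_antisymm (h.le_suffix h'.left.1 h'.right.1 e)
    (h'.le_suffix h.left.1 h.right.1 e.symm)
  subst this
  exact ⟨List.append_cancel_right e, rfl⟩

/-- Cut off the smallest proper suffix `v`. Every required inequality follows from its minimality.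
When one of the compared words is a prefix of the other, cancelling that prefix exposes another
proper suffix of the whole word, to which minimality applies again. -/
theorem IsLyndon.exists_isStdPair {w : List X} (hw : IsLyndon w) (h1 : w.length ≠ 1) :
    ∃ u v, IsStdPair u v ∧ u ++ v = w := by
  set S : Set (List X) := {b | ∃ a, a ≠ [] ∧ b ≠ [] ∧ w = a ++ b} with hS
  have hfin : S.Finite := by
    refine (List.finite_toSet w.tails).subset ?_
    rintro b ⟨a, -, -, rfl⟩
    simp
  have hne : S.Nonempty := by
    rcases w with _ | ⟨x, _ | ⟨y, t⟩⟩
    · exact absurd rfl hw.1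
    · exact absurd rfl h1
    · exact ⟨y :: t, [x], by simp, by simp, rfl⟩
  obtain ⟨v, ⟨u, hu, hv, rfl⟩, hmin⟩ := Set.exists_min_image S id hfin hne
  have hmin' : ∀ a b, a ≠ [] → b ≠ [] → u ++ v = a ++ b → v ≤ b := fun a b ha hb h =>
    hmin b ⟨a, ha, hb, h⟩
  have huv : u ++ v < v := hw.2 u v hu hv rfl
  refine ⟨u, v, ⟨⟨hu, fun a b ha hb hab => ?_⟩, ⟨hv, fun a b ha hb hab => ?_⟩,
    (List.lt_append_of_ne_nil u hv).trans huv, fun a b ha hb hab => ?_⟩, rfl⟩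
  · subst hab
    have h2 : a ++ b ++ v < b ++ v := hw.2 a (b ++ v) ha (by simp [hb]) (by simp)
    by_contra hlt
    rcases (not_lt.1 hlt).lt_or_eq with h3 | h3
    · by_cases hp : b <+: a ++ b
      · obtain ⟨t, ht⟩ := hp
        have htl : t ≠ [] := by
          rintro rfl
          have e1 := congrArg List.length ht
          have e2 := List.length_pos_of_ne_nil ha
          simp only [List.length_append, List.length_nil] at e1; omega
        rw [← ht, List.append_assoc, List.append_lt_append_left_iff] at h2
        have := hmin' b (t ++ v) hb (by simp [hv]) (by rw [← ht]; simp)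
        exact absurd h2 (not_lt.2 this)
      · exact absurd (List.lt_append_of_lt_of_not_prefix h3 hp v v) (not_lt.2 h2.le)
    · have e1 := congrArg List.length h3
      have e2 := List.length_pos_of_ne_nil ha
      simp only [List.length_append] at e1; omega
  · subst hab
    have := hmin' (u ++ a) b (by simp [ha]) hb (by simp)
    refine lt_of_le_of_ne this ?_
    intro h
    have e1 := congrArg List.length h
    have e2 := List.length_pos_of_ne_nil ha
    simp only [List.length_append] at e1; omega
  · subst hab
    by_contra hlt
    have h3 := not_le.1 hlt
    have h4 := hmin' a (b ++ v) ha (by simp [hb]) (by simp)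
    by_cases hp : b <+: v
    · obtain ⟨t, rfl⟩ := hp
      have ht : t ≠ [] := by rintro rfl; simp at h3
      have h5 : t < b ++ t ∨ t = b ++ t ∨ b ++ t < t := lt_trichotomy _ _
      have h6 := hmin' (a ++ b ++ b) t (by simp [hb]) ht (by simp)
      rw [← not_lt, List.append_lt_append_left_iff, not_lt] at h4
      have h7 : t = b ++ t := le_antisymm h4 h6
      have e1 := congrArg List.length h7
      have e2 := List.length_pos_of_ne_nil hb
      simp only [List.length_append] at e1; omega
    · exact absurd (List.lt_append_of_lt_of_not_prefix h3 hp v []) (not_lt.2 (by simpa using h4))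

/-! ### Standard bracketings of Lyndon words -/

variable {g : Type*} [LieRing g]

/-- `IsBracketing f w a`: the element `a` of a Lie ring is the standard bracketing of the Lyndon
word `w`, with each letter `x` replaced by `f x`. -/
inductive IsBracketing (f : X → g) : List X → g → Prop
  | of (x : X) : IsBracketing f [x] (f x)
  | lie {u v : List X} {a b : g} (h : IsStdPair u v) (ha : IsBracketing f u a)
      (hb : IsBracketing f v b) : IsBracketing f (u ++ v) ⁅a, b⁆

theorem IsBracketing.isLyndon {f : X → g} {w : List X} {a : g} (h : IsBracketing f w a) :
    IsLyndon w := by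
  cases h with
  | of x => exact IsLyndon.singleton x
  | lie h _ _ => exact h.isLyndon

theorem IsStdPair.length_ne_one {u v : List X} (h : IsStdPair u v) : (u ++ v).length ≠ 1 := by
  have := List.length_pos_of_ne_nil h.left.1
  have := List.length_pos_of_ne_nil h.right.1
  simp only [List.length_append]; omega

theorem IsBracketing.unique {f : X → g} {w w' : List X} {a b : g} (h : IsBracketing f w a)
    (h' : IsBracketing f w' b) (e : w = w') : a = b := by
  induction h generalizing w' b with
  | of x =>
    cases h' with
    | of y => rw [List.singleton_inj.1 e]
    | lie h _ _ => exact absurd (congrArg List.length e).symm h.length_ne_one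
  | lie hs _ _ iha ihb =>
    cases h' with
    | of y => exact absurd (congrArg List.length e) hs.length_ne_one
    | lie hs' ha' hb' =>
      obtain ⟨e1, e2⟩ := hs.unique hs' e
      rw [iha ha' e1, ihb hb' e2]

theorem IsLyndon.exists_isBracketing (f : X → g) {w : List X} (hw : IsLyndon w) :
    ∃ a, IsBracketing f w a := by
  induction hn : w.length using Nat.strong_induction_on generalizing w with
  | _ n ih =>
    by_cases h1 : w.length = 1
    · obtain ⟨x, rfl⟩ := List.length_eq_one_iff.1 h1
      exact ⟨_, .of x⟩
    · obtain ⟨u, v, h, rfl⟩ := hw.exists_isStdPair h1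
      have h2 := List.length_pos_of_ne_nil h.left.1
      have h3 := List.length_pos_of_ne_nil h.right.1
      rw [List.length_append] at hn
      obtain ⟨a, ha⟩ := ih u.length (by omega) h.left rfl
      obtain ⟨b, hb⟩ := ih v.length (by omega) h.right rfl
      exact ⟨_, .lie h ha hb⟩

theorem IsBracketing.map {g' : Type*} [LieRing g'] (φ : g →ₗ⁅ℤ⁆ g') {f : X → g} {w : List X}
    {a : g} (h : IsBracketing f w a) : IsBracketing (fun x => φ (f x)) w (φ a) := by
  induction h with
  | of x => exact .of (f := fun x => φ (f x)) x
  | lie h _ _ iha ihb => rw [LieHom.map_lie]; exact .lie h iha ihb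

/-- The span of the standard bracketings of the Lyndon words of length `N` below `M`. -/
def lyndonSpan (f : X → g) (N : ℕ) (M : List X) : Submodule ℤ g :=
  Submodule.span ℤ {c | ∃ w, IsBracketing f w c ∧ w.length = N ∧ w < M}

theorem lyndonSpan_mono (f : X → g) {N : ℕ} {M M' : List X} (h : M ≤ M') :
    lyndonSpan f N M ≤ lyndonSpan f N M' :=
  Submodule.span_mono fun _ ⟨w, h1, h2, h3⟩ => ⟨w, h1, h2, h3.trans_le h⟩

theorem lie_mem_of_mem_span {S : Set g} {K : Submodule ℤ g} {a b : g}
    (hb : b ∈ Submodule.span ℤ S) (h : ∀ c ∈ S, ⁅a, c⁆ ∈ K) : ⁅a, b⁆ ∈ K := by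
  induction hb using Submodule.span_induction with
  | mem x hx => exact h x hx
  | zero => rw [lie_zero]; exact K.zero_mem
  | add x y _ _ hx hy => rw [lie_add]; exact K.add_mem hx hy
  | smul r x _ hx => rw [lie_zsmul]; exact K.smul_mem r hx

/-- Rewriting by induction on the total length, then on the larger word `v`; words of bounded length
are finitely many, hence well-ordered. If `(u, v)` is not standard, then `u = u' ++ u''` with `u'' <
v`, and Jacobi expands `[[a', a''], b]`. The inner brackets are shorter and yield words below `v`,
so the outer ones bracket two words that are both below `v`. -/
theorem IsBracketing.lie_mem_lyndonSpan [Finite X] {f : X → g} {u v : List X} {a b : g}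
    (ha : IsBracketing f u a) (hb : IsBracketing f v b) :
    ⁅a, b⁆ ∈ lyndonSpan f (u.length + v.length) (max u v) := by
  induction hN : u.length + v.length using Nat.strong_induction_on generalizing u v a b with
  | _ N ihN =>
  have hfin : Finite {l : List X // l.length ≤ N} := List.finite_length_le X N
  have hwf : WellFounded ((· < ·) : {l : List X // l.length ≤ N} → _ → Prop) := wellFounded_lt
  have key : ∀ M : {l : List X // l.length ≤ N}, ∀ u v a b, IsBracketing f u a →
      IsBracketing f v b → u.length + v.length = N → u < v → v = M →
      ⁅a, b⁆ ∈ lyndonSpan f N M := by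
    intro M
    induction M using hwf.induction with
    | _ M ihM =>
    intro u v a b ha hb hN huv hvM
    have ihM' : ∀ u v a b, IsBracketing f u a → IsBracketing f v b →
        u.length + v.length = N → u < M.1 → v < M.1 → ⁅a, b⁆ ∈ lyndonSpan f N M := by
      intro u v a b ha hb hN hu hv
      rcases lt_trichotomy u v with h | h | h
      · exact lyndonSpan_mono f hv.le (ihM ⟨v, by omega⟩ hv u v a b ha hb hN h rfl)
      · rw [ha.unique hb h, lie_self]; exact Submodule.zero_mem _
      · rw [← lie_skew]
        exact Submodule.neg_mem _ (lyndonSpan_mono f hu.le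
          (ihM ⟨u, by omega⟩ hu v u b a hb ha (by omega) h rfl))
    have base : IsStdPair u v → ⁅a, b⁆ ∈ lyndonSpan f N M := fun h =>
      Submodule.subset_span ⟨u ++ v, .lie h ha hb, by simpa using hN, by
        rw [← hvM]; exact h.isLyndon.2 u v h.left.1 h.right.1 rfl⟩
    cases ha with
    | of x =>
      refine base ⟨.singleton x, hb.isLyndon, huv, fun a b ha hb h => ?_⟩
      have := congrArg List.length h
      have h1 := List.length_pos_of_ne_nil ha
      have h2 := List.length_pos_of_ne_nil hb
      simp at this; omega
    | @lie u' u'' a' a'' h ha' ha'' =>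
      by_cases hle : v ≤ u''
      · exact base ⟨h.isLyndon, hb.isLyndon, huv, fun c d hc hd hcd =>
          hle.trans (h.le_suffix hc hd hcd)⟩
      · have hlt := not_le.1 hle
        have l1 := List.length_pos_of_ne_nil h.left.1
        have l2 := List.length_pos_of_ne_nil h.right.1
        rw [List.length_append] at hN
        have e : ⁅⁅a', a''⁆, b⁆ = ⁅a', ⁅a'', b⁆⁆ - ⁅a'', ⁅a', b⁆⁆ := lie_lie _ _ _
        rw [e]
        have hu' : u' < v := h.lt.trans hlt
        refine Submodule.sub_mem _ ?_ ?_
        · have h3 := ihN (u''.length + v.length) (by omega) ha'' hb rfl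
          refine lie_mem_of_mem_span h3 ?_
          rintro c ⟨w, hw, hwl, hwM⟩
          rw [max_eq_right hlt.le] at hwM
          exact ihM' u' w a' c ha' hw (by omega) (hvM ▸ hu') (hvM ▸ hwM)
        · have h3 := ihN (u'.length + v.length) (by omega) ha' hb rfl
          refine lie_mem_of_mem_span h3 ?_
          rintro c ⟨w, hw, hwl, hwM⟩
          rw [max_eq_right hu'.le] at hwM
          exact ihM' u'' w a'' c ha'' hw (by omega) (hvM ▸ hlt) (hvM ▸ hwM)
  rcases lt_trichotomy u v with h | h | h
  · rw [max_eq_right h.le]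
    exact key ⟨v, by omega⟩ u v a b ha hb hN h rfl
  · rw [ha.unique hb h, lie_self]; exact Submodule.zero_mem _
  · rw [← lie_skew, max_eq_left h.le]
    exact Submodule.neg_mem _ (key ⟨u, by omega⟩ v u b a hb ha (by omega) h rfl)

end Lyndon

/-- The Lie homomorphisms out of a free Lie algebra satisfy an induction principle. -/
theorem FreeLieAlgebra.induction {R X : Type*} [CommRing R] {p : FreeLieAlgebra R X → Prop}
    (of : ∀ x, p (of R x)) (zero : p 0) (add : ∀ a b, p a → p b → p (a + b))
    (smul : ∀ (r : R) a, p a → p (r • a)) (lie : ∀ a b, p a → p b → p ⁅a, b⁆)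
    (a : FreeLieAlgebra R X) : p a := by
  let S : LieSubalgebra R (FreeLieAlgebra R X) :=
    { carrier := {a | p a}
      add_mem' := fun {a b} ha hb => add a b ha hb
      zero_mem' := zero
      smul_mem' := fun r a ha => smul r a ha
      lie_mem' := fun {a b} ha hb => lie a b ha hb }
  let φ : FreeLieAlgebra R X →ₗ⁅R⁆ S := FreeLieAlgebra.lift R fun x => ⟨.of R x, of x⟩
  have h : S.incl.comp φ = LieHom.id := by
    refine FreeLieAlgebra.hom_ext fun x => ?_
    rw [LieHom.comp_apply, FreeLieAlgebra.lift_of_apply]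
    rfl
  have := LieHom.congr_fun h a
  rw [LieHom.id_apply, LieHom.comp_apply] at this
  rw [← this]
  exact (φ a).2

theorem FreeLieAlgebra.int_hom_ext {X g : Type*} [LieRing g] {F F' : FreeLieAlgebra ℤ X →ₗ⁅ℤ⁆ g}
    (h : ∀ x, F (of ℤ x) = F' (of ℤ x)) : F = F' := by
  refine LieHom.ext fun a => ?_
  induction a using FreeLieAlgebra.induction with
  | of x => exact h x
  | zero => rw [map_zero, map_zero]
  | add a b ha hb => rw [map_add, map_add, ha, hb]
  | smul r a ha => exact (map_zsmul F r a).trans ((congrArg _ ha).trans (map_zsmul F' r a).symm)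
  | lie a b ha hb => rw [LieHom.map_lie, LieHom.map_lie, ha, hb]

theorem span_isBracketing_eq_top (X : Type*) [LinearOrder X] [Finite X] :
    Submodule.span ℤ {c | ∃ w, IsBracketing (FreeLieAlgebra.of ℤ (X := X)) w c} = ⊤ := by
  rw [Submodule.eq_top_iff']
  intro a
  induction a using FreeLieAlgebra.induction with
  | of x => exact Submodule.subset_span ⟨_, .of x⟩
  | zero => exact Submodule.zero_mem _
  | add a b ha hb => exact Submodule.add_mem _ ha hb
  | smul r a ha => exact Submodule.smul_mem _ r ha
  | lie a b ha hb =>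
    refine lie_mem_of_mem_span hb ?_
    rintro d ⟨v, hv⟩
    rw [← lie_skew]
    refine Submodule.neg_mem _ (lie_mem_of_mem_span ha ?_)
    rintro c ⟨u, hu⟩
    refine Submodule.span_mono ?_ (hv.lie_mem_lyndonSpan hu)
    rintro e ⟨w, hw, -, -⟩
    exact ⟨w, hw⟩

/-! ### Words in the free associative algebra -/

namespace FreeAlgebra

variable {R : Type*} [CommRing R] {X : Type*}

/-- The product of the letters of a word. -/
def wd (R : Type*) [CommRing R] {X : Type*} (l : List X) : FreeAlgebra R X := (l.map (ι R)).prod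

theorem wd_nil : wd R ([] : List X) = 1 := rfl

theorem wd_cons (x : X) (l : List X) : wd R (x :: l) = ι R x * wd R l := by simp [wd]

theorem wd_append (l l' : List X) : wd R (l ++ l') = wd R l * wd R l' := by simp [wd]

theorem wd_singleton (x : X) : wd R [x] = ι R x := by simp [wd]

theorem basisFreeMonoid_eq_wd (l : List X) :
    basisFreeMonoid R X (FreeMonoid.ofList l) = wd R l := by
  have h : equivMonoidAlgebraFreeMonoid (wd R l) =
      MonoidAlgebra.single (FreeMonoid.ofList l) (1 : R) := by
    induction l with
    | nil => rw [wd_nil, map_one]; rfl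
    | cons x l ih =>
      rw [wd_cons, map_mul, ih, FreeMonoid.ofList_cons]
      simp [equivMonoidAlgebraFreeMonoid, MonoidAlgebra.single_mul_single]
  apply equivMonoidAlgebraFreeMonoid.injective
  rw [h]
  simp [basisFreeMonoid]

/-- The coefficient of a word. -/
noncomputable def wcoeff (l : List X) : FreeAlgebra R X →ₗ[R] R :=
  (basisFreeMonoid R X).coord (FreeMonoid.ofList l)

theorem wcoeff_wd [DecidableEq X] (l l' : List X) :
    wcoeff l (wd R l') = if l' = l then 1 else 0 := by
  rw [wcoeff, ← basisFreeMonoid_eq_wd, Module.Basis.coord_apply, Module.Basis.repr_self]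
  by_cases h : l' = l
  · rw [h, if_pos rfl, Finsupp.single_eq_same]
  · rw [if_neg h, Finsupp.single_eq_of_ne fun h' => h (FreeMonoid.ofList.injective h').symm]

theorem span_wd : Submodule.span R (Set.range (wd R (X := X))) = ⊤ := by
  rw [← (basisFreeMonoid R X).span_eq]
  congr 1
  ext a
  constructor
  · rintro ⟨l, rfl⟩; exact ⟨FreeMonoid.ofList l, basisFreeMonoid_eq_wd l⟩
  · rintro ⟨l, rfl⟩; exact ⟨l.toList, (basisFreeMonoid_eq_wd _).symm⟩

theorem eq_zero_of_wcoeff {a : FreeAlgebra R X} (h : ∀ l : List X, wcoeff l a = 0) : a = 0 :=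
  (basisFreeMonoid R X).ext_elem (by
    intro l
    rw [map_zero, Finsupp.zero_apply]
    exact h l.toList)

theorem linearMap_ext_wd {M : Type*} [AddCommGroup M] [Module R M]
    {f g : FreeAlgebra R X →ₗ[R] M} (h : ∀ l, f (wd R l) = g (wd R l)) : f = g :=
  LinearMap.ext_on_range span_wd h

theorem wcoeff_concat_mul (x : X) (l : List X) (a : FreeAlgebra R X) :
    wcoeff (l ++ [x]) (a * ι R x) = wcoeff l a := by
  classical
  have : wcoeff (l ++ [x]) ∘ₗ LinearMap.mulRight R (ι R x) = wcoeff l := by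
    refine linearMap_ext_wd fun l' => ?_
    rw [LinearMap.comp_apply, LinearMap.mulRight_apply, ← wd_singleton, ← wd_append, wcoeff_wd,
      wcoeff_wd]
    simp
  exact LinearMap.congr_fun this a

theorem wcoeff_cons_mul (x : X) (l : List X) (a : FreeAlgebra R X) :
    wcoeff (x :: l) (ι R x * a) = wcoeff l a := by
  classical
  have : wcoeff (x :: l) ∘ₗ LinearMap.mulLeft R (ι R x) = wcoeff l := by
    refine linearMap_ext_wd fun l' => ?_
    rw [LinearMap.comp_apply, LinearMap.mulLeft_apply, ← wd_cons, wcoeff_wd, wcoeff_wd]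
    simp
  exact LinearMap.congr_fun this a

theorem wcoeff_cons_mul_of_ne {x y : X} (hxy : x ≠ y) (l : List X) (a : FreeAlgebra R X) :
    wcoeff (y :: l) (ι R x * a) = 0 := by
  classical
  have : wcoeff (y :: l) ∘ₗ LinearMap.mulLeft R (ι R x) = 0 := by
    refine linearMap_ext_wd fun l' => ?_
    rw [LinearMap.comp_apply, LinearMap.mulLeft_apply, ← wd_cons, wcoeff_wd, LinearMap.zero_apply,
      if_neg]
    simp [hxy]
  exact LinearMap.congr_fun this a

end FreeAlgebra

/-! ### The free Lie ring in the free associative algebra -/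

section

open FreeAlgebra

attribute [local instance] LieRing.ofAssociativeRing

variable (R : Type*) [CommRing R] {X : Type*}

/-- The canonical map from the free Lie ring to the free associative `R`-algebra. -/
noncomputable def FreeLieAlgebra.toFree (X : Type*) :
    FreeLieAlgebra ℤ X →ₗ⁅ℤ⁆ FreeAlgebra R X :=
  FreeLieAlgebra.lift ℤ (FreeAlgebra.ι R)

theorem FreeLieAlgebra.toFree_of (x : X) :
    FreeLieAlgebra.toFree R X (FreeLieAlgebra.of ℤ x) = FreeAlgebra.ι R x :=
  FreeLieAlgebra.lift_of_apply ..

theorem FreeLieAlgebra.toFree_lie (a b : FreeLieAlgebra ℤ X) :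
    toFree R X ⁅a, b⁆ = toFree R X a * toFree R X b - toFree R X b * toFree R X a :=
  LieHom.map_lie _ a b

variable {R}

theorem mul_mem_span_wd {S S' U : Set (List X)} {a b : FreeAlgebra R X}
    (ha : a ∈ Submodule.span R (wd R '' S)) (hb : b ∈ Submodule.span R (wd R '' S'))
    (h : ∀ u ∈ S, ∀ v ∈ S', u ++ v ∈ U) : a * b ∈ Submodule.span R (wd R '' U) := by
  have h1 := Submodule.mul_mem_mul ha hb
  rw [Submodule.span_mul_span] at h1
  refine Submodule.span_mono ?_ h1
  rintro _ ⟨_, ⟨u, hu, rfl⟩, _, ⟨v, hv, rfl⟩, rfl⟩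
  exact ⟨u ++ v, h u hu v hv, wd_append u v⟩

variable [LinearOrder X]

/-- The leading word of the standard bracketing of a Lyndon word is that word. -/
theorem IsBracketing.sub_wd_mem {w : List X} {a : FreeAlgebra R X}
    (h : IsBracketing (FreeAlgebra.ι R) w a) :
    a - wd R w ∈ Submodule.span R (wd R '' {l | l.length = w.length ∧ w < l}) := by
  induction h with
  | of x => rw [wd_singleton, sub_self]; exact Submodule.zero_mem _
  | @lie u v a b h ha hb iha ihb =>
    have hu : wd R u ∈ Submodule.span R (wd R '' {u}) := Submodule.subset_span ⟨u, rfl, rfl⟩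
    have aux : ∀ (w : List X) (a : FreeAlgebra R X),
        a - wd R w ∈ Submodule.span R (wd R '' {l | l.length = w.length ∧ w < l}) →
        a ∈ Submodule.span R (wd R '' {l | l.length = w.length ∧ w ≤ l}) := by
      intro w a h
      rw [← sub_add_cancel a (wd R w)]
      refine Submodule.add_mem _ (Submodule.span_mono (Set.image_mono ?_) h)
        (Submodule.subset_span ⟨w, ⟨rfl, le_rfl⟩, rfl⟩)
      exact fun l hl => ⟨hl.1, hl.2.le⟩
    have hlt : u ++ v < v := h.isLyndon.2 u v h.left.1 h.right.1 rfl
    -- All words of `b * a` start with some `v' ≥ v`, and `v` already exceeds `u ++ v`; so this term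
    -- does not touch the leading word.
    have e : ⁅a, b⁆ - wd R (u ++ v) =
        (a - wd R u) * b + wd R u * (b - wd R v) - b * a := by
      rw [LieRing.of_associative_ring_bracket, wd_append]; noncomm_ring
    rw [e]
    refine Submodule.sub_mem _ (Submodule.add_mem _ ?_ ?_) ?_
    · refine mul_mem_span_wd iha (aux v b ihb) ?_
      rintro u' ⟨hl, hu'⟩ v' ⟨hl', hv'⟩
      exact ⟨by simp [hl, hl'], List.append_lt_append_of_lt hu' hl.le v v'⟩
    · refine mul_mem_span_wd hu ihb ?_
      rintro _ rfl v' ⟨hl', hv'⟩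
      exact ⟨by simp [hl'], (List.append_lt_append_left_iff _).2 hv'⟩
    · refine mul_mem_span_wd (aux v b ihb) (aux u a iha) ?_
      rintro v' ⟨hl', hv'⟩ u' ⟨hl, hu'⟩
      exact ⟨by simp [hl, hl', add_comm], hlt.trans_le (hv'.trans (List.le_append _ _))⟩

theorem wcoeff_eq_zero_of_mem_span {S : Set (List X)} {a : FreeAlgebra R X}
    (ha : a ∈ Submodule.span R (wd R '' S)) {l : List X} (hl : l ∉ S) : wcoeff l a = 0 := by
  have : Submodule.span R (wd R '' S) ≤ LinearMap.ker (wcoeff (R := R) l) := by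
    rw [Submodule.span_le]
    rintro _ ⟨l', hl', rfl⟩
    rw [SetLike.mem_coe, LinearMap.mem_ker, wcoeff_wd, if_neg]
    rintro rfl
    exact hl hl'
  exact this ha

theorem IsBracketing.wcoeff_self {w : List X} {a : FreeAlgebra R X}
    (h : IsBracketing (FreeAlgebra.ι R) w a) : wcoeff w a = 1 := by
  have := wcoeff_eq_zero_of_mem_span h.sub_wd_mem (l := w) (fun h => lt_irrefl _ h.2)
  rwa [map_sub, wcoeff_wd, if_pos rfl, sub_eq_zero] at this

theorem IsBracketing.wcoeff_of_lt {w l : List X} {a : FreeAlgebra R X}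
    (h : IsBracketing (FreeAlgebra.ι R) w a) (hl : l < w) : wcoeff l a = 0 := by
  have := wcoeff_eq_zero_of_mem_span h.sub_wd_mem (l := l) (fun h => lt_asymm hl h.2)
  rwa [map_sub, wcoeff_wd, if_neg hl.ne', sub_zero] at this

theorem FreeLieAlgebra.exists_basis (X : Type*) [LinearOrder X] [Finite X] :
    ∃ P : {w : List X // IsLyndon w} → FreeLieAlgebra ℤ X,
      (∀ w, IsBracketing (FreeLieAlgebra.of ℤ) w.1 (P w)) ∧
      Submodule.span ℤ (Set.range P) = ⊤ := by
  choose P hP using fun w : {w : List X // IsLyndon w} =>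
    w.2.exists_isBracketing (FreeLieAlgebra.of ℤ)
  refine ⟨P, hP, ?_⟩
  rw [eq_top_iff, ← span_isBracketing_eq_top X]
  refine Submodule.span_mono ?_
  rintro c ⟨w, hw⟩
  exact ⟨⟨w, hw.isLyndon⟩, (hP _).unique hw rfl⟩

/-- If the image of a Lie element in the free associative `R`-algebra vanishes, then the Lie
element is a combination of elements with coefficients that vanish in `R`. -/
theorem FreeLieAlgebra.exists_coeff_of_toFree_eq_zero [Finite X] {a : FreeLieAlgebra ℤ X}
    (ha : toFree R X a = 0) :
    ∃ (c : {w : List X // IsLyndon w} →₀ ℤ) (P : {w : List X // IsLyndon w} → FreeLieAlgebra ℤ X),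
      a = c.sum (fun w r => r • P w) ∧ ∀ w, (c w : R) = 0 := by
  classical
  obtain ⟨P, hP, hspan⟩ := FreeLieAlgebra.exists_basis X
  obtain ⟨c, hc⟩ := (Finsupp.mem_span_range_iff_exists_finsupp).1
    (hspan ▸ Submodule.mem_top : a ∈ Submodule.span ℤ (Set.range P))
  refine ⟨c, P, hc.symm, ?_⟩
  by_contra! hne
  obtain ⟨w₀, hw₀⟩ := hne
  have hQ : ∀ w, IsBracketing (FreeAlgebra.ι R) w.1 (toFree R X (P w)) := by
    intro w
    have := (hP w).map (toFree R X)
    simpa only [toFree_of] using this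
  -- Take the smallest Lyndon word whose coefficient survives in `R`. By triangularity no other term
  -- contributes to this word, so its coefficient in the image is `c w`.
  set S := c.support.filter fun w => (c w : R) ≠ 0 with hS
  have hSne : S.Nonempty := ⟨w₀, by
    simp only [hS, Finset.mem_filter, Finsupp.mem_support_iff]
    exact ⟨fun h => hw₀ (by rw [h, Int.cast_zero]), hw₀⟩⟩
  obtain ⟨w, hwS, hmin⟩ := S.exists_min_image id hSne
  have h0 : wcoeff w.1 (toFree R X a) = (c w : R) := by
    rw [← hc, Finsupp.sum, map_sum, map_sum, Finset.sum_eq_single w]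
    · rw [map_zsmul, map_zsmul, (hQ w).wcoeff_self, zsmul_one]
    · intro w' hw' hne
      rw [map_zsmul, map_zsmul]
      by_cases hz : (c w' : R) = 0
      · rw [zsmul_eq_mul, hz, zero_mul]
      · have hle : w ≤ w' := hmin w' (by simp [hS, hz]; exact Finsupp.mem_support_iff.1 hw')
        have hlt : w.1 < w'.1 := lt_of_le_of_ne hle fun h => hne (Subtype.ext h.symm)
        rw [(hQ w').wcoeff_of_lt hlt, smul_zero]
    · intro hw
      rw [Finsupp.notMem_support_iff.1 hw, zero_smul, map_zero, map_zero]
  rw [ha, map_zero] at h0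
  exact (Finset.mem_filter.1 hwS).2 h0.symm

theorem FreeLieAlgebra.toFree_int_injective [Finite X] :
    Function.Injective (toFree ℤ X) := by
  rw [injective_iff_map_eq_zero]
  intro a ha
  obtain ⟨c, P, rfl, hc⟩ := exists_coeff_of_toFree_eq_zero ha
  have : c = 0 := Finsupp.ext fun w => by simpa using hc w
  rw [this, Finsupp.sum_zero_index]

theorem FreeLieAlgebra.exists_eq_two_smul [Finite X] {a : FreeLieAlgebra ℤ X}
    (ha : toFree (ZMod 2) X a = 0) : ∃ b, a = (2 : ℤ) • b := by
  obtain ⟨c, P, rfl, hc⟩ := exists_coeff_of_toFree_eq_zero ha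
  refine ⟨c.sum fun w r => (r / 2) • P w, ?_⟩
  rw [Finsupp.smul_sum]
  refine Finsupp.sum_congr fun w _ => ?_
  have h2 : (2 : ℤ) ∣ c w := (ZMod.intCast_zmod_eq_zero_iff_dvd (c w) 2).1 (hc w)
  rw [smul_smul, Int.mul_ediv_cancel' h2]

/-- The free Lie ring is torsion free, and no nonzero element is infinitely divisible by `2`. -/
theorem FreeLieAlgebra.eq_zero_of_two_smul [Finite X] {a : FreeLieAlgebra ℤ X}
    (ha : (2 : ℤ) • a = 0) : a = 0 := by
  apply toFree_int_injective
  rw [map_zero]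
  refine FreeAlgebra.eq_zero_of_wcoeff fun l => ?_
  have h := congrArg (fun b => wcoeff l (toFree ℤ X b)) ha
  simp only [map_zsmul, map_zero, smul_eq_mul, mul_eq_zero, OfNat.ofNat_ne_zero, false_or] at h
  exact h

theorem FreeLieAlgebra.eq_zero_of_forall_two_pow [Finite X] {a : FreeLieAlgebra ℤ X}
    (ha : ∀ k : ℕ, ∃ b, a = (2 ^ k : ℤ) • b) : a = 0 := by
  apply toFree_int_injective
  rw [map_zero]
  refine FreeAlgebra.eq_zero_of_wcoeff fun l => ?_
  by_contra hne
  -- An integer `z` divisible by `2 ^ |z|` is zero because `|z| < 2 ^ |z|`; hence this choice of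
  -- exponent.
  obtain ⟨b, hb⟩ := ha (wcoeff l (toFree ℤ X a)).natAbs
  have h : (2 ^ (wcoeff l (toFree ℤ X a)).natAbs : ℤ) ∣ wcoeff l (toFree ℤ X a) :=
    ⟨wcoeff l (toFree ℤ X b), by
      conv_lhs => rw [hb]
      rw [map_zsmul, map_zsmul, smul_eq_mul]⟩
  have h1 := Nat.le_of_dvd (Int.natAbs_pos.2 hne) (Int.natAbs_dvd_natAbs.2 h)
  rw [Int.natAbs_pow] at h1
  exact absurd (Nat.lt_two_pow_self (n := (wcoeff l (toFree ℤ X a)).natAbs)) (not_lt.2 h1)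

end

/-! ### Homomorphisms out of the Lie ring of the descending central series -/

namespace Gr

open LCSLie

variable {G : Type*} [Group G] {A : Type*} [AddCommGroup A]

/-- An additive map out of `gr_*(G)` given on each step of the descending central series. -/
noncomputable def liftAdd (f : ℕ → G → A)
    (hmul : ∀ i, ∀ x ∈ Gam G i, ∀ y ∈ Gam G i, f i (x * y) = f i x + f i y)
    (hker : ∀ i, ∀ x ∈ Gam G (i + 1), f i x = 0) : Gr G →+ A :=
  DirectSum.toAddMonoid fun i => MonoidHom.toAdditiveLeft <| QuotientGroup.lift _
    (MonoidHom.mk' (fun x : Gam G i => Multiplicative.ofAdd (f i x)) fun x y =>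
      congrArg Multiplicative.ofAdd (hmul i x x.2 y y.2))
    fun x hx => congrArg Multiplicative.ofAdd (hker i x (Subgroup.mem_subgroupOf.1 hx))

theorem liftAdd_mk {f : ℕ → G → A}
    {hmul : ∀ i, ∀ x ∈ Gam G i, ∀ y ∈ Gam G i, f i (x * y) = f i x + f i y}
    {hker : ∀ i, ∀ x ∈ Gam G (i + 1), f i x = 0} {i : ℕ} {x : G} (hx : x ∈ Gam G i) :
    liftAdd f hmul hker (mk i x hx) = f i x := by
  simp only [liftAdd, mk, incl]
  erw [DirectSum.toAddMonoid_of]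
  rfl

theorem mem_Gam_zero (x : G) : x ∈ Gam G 0 := Subgroup.mem_top x

theorem mk_one (i : ℕ) : mk i (1 : G) (one_mem (Gam G i)) = 0 := mk_eq_zero (one_mem (Gam G i)) (one_mem (Gam G (i + 1)))

theorem mk_mem_of_commutator {S : AddSubgroup (Gr G)} {i : ℕ}
    (h : ∀ p (hp : p ∈ Gam G i) q, mk (i + 0 + 1) ⁅p, q⁆ (comm_mem hp (mem_Gam_zero q)) ∈ S)
    {x : G} (hx : x ∈ Gam G (i + 1)) : mk (i + 1) x hx ∈ S := by
  suffices ∀ x, ∀ hx : x ∈ Subgroup.closure {x | ∃ p ∈ Gam G i, ∃ q ∈ (⊤ : Subgroup G), ⁅p, q⁆ = x},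
      mk (i + 1) x hx ∈ S from this x hx
  intro x hx
  induction hx using Subgroup.closure_induction with
  | mem x hx => obtain ⟨p, hp, q, -, rfl⟩ := hx; exact h p hp q
  | one => rw [mk_one]; exact S.zero_mem
  | mul x y hx hy h1 h2 => exact (mk_mul (i := i + 1) hx hy).symm ▸ S.add_mem h1 h2
  | inv x hx h1 => exact (mk_inv (i := i + 1) hx).symm ▸ S.neg_mem h1

/-- The Lie ring `gr_*(G)` is generated by its component of degree one. -/
theorem mem_of_forall_mk_zero (S : LieSubalgebra ℤ (Gr G))
    (h : ∀ x, mk 0 x (mem_Gam_zero x) ∈ S) (a : Gr G) : a ∈ S := by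
  induction a using Gr.induction with
  | h0 => exact S.zero_mem
  | hadd x y hx hy => exact S.add_mem hx hy
  | hmk i x hx =>
    induction i generalizing x with
    | zero => exact h x
    | succ i ih =>
      refine mk_mem_of_commutator (S := S.toSubmodule.toAddSubgroup) (fun p hp q => ?_) hx
      rw [← mk_lie_mk hp (mem_Gam_zero q)]
      exact S.lie_mem (ih p hp) (h q)

theorem mem_of_closure_eq_top {s : Set G} (hs : Subgroup.closure s = ⊤) (S : LieSubalgebra ℤ (Gr G))
    (h : ∀ x ∈ s, mk 0 x (mem_Gam_zero x) ∈ S) (a : Gr G) : a ∈ S := by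
  refine mem_of_forall_mk_zero S (fun x => ?_) a
  have hx : x ∈ Subgroup.closure s := hs ▸ Subgroup.mem_top x
  induction hx using Subgroup.closure_induction with
  | mem x hx => exact h x hx
  | one => rw [mk_one]; exact S.zero_mem
  | mul x y _ _ h1 h2 => rw [mk_mul (mem_Gam_zero x) (mem_Gam_zero y)]; exact S.add_mem h1 h2
  | inv x _ h1 => rw [mk_inv (mem_Gam_zero x)]; exact S.neg_mem h1

variable {H K : Type*} [Group H] [Group K]

theorem map_mk (f : G →* H) {i : ℕ} {x : G} (hx : x ∈ Gam G i) :
    map f (mk i x hx) = mk i (f x) (map_mem f hx) := mapAdd_mk f hx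

theorem map_map (f : G →* H) (g : H →* K) (a : Gr G) : map g (map f a) = map (g.comp f) a := by
  have : (mapAdd g).comp (mapAdd f) = mapAdd (g.comp f) :=
    addHom_ext fun i x hx => by
      rw [AddMonoidHom.comp_apply, mapAdd_mk, mapAdd_mk, mapAdd_mk]; rfl
  exact DFunLike.congr_fun this a

end Gr

/-! ### The leading coefficient of a representation by power series -/

namespace PowerSeries

variable {A : Type*} [Ring A]

/-- The power series divisible by `X ^ k`. -/
def vanishing (A : Type*) [Ring A] (k : ℕ) : AddSubgroup (PowerSeries A) where
  carrier := {f | ∀ j < k, coeff j f = 0}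
  add_mem' hf hg j hj := by rw [map_add, hf j hj, hg j hj, add_zero]
  zero_mem' j _ := map_zero _
  neg_mem' hf j hj := by rw [map_neg, hf j hj, neg_zero]

theorem mul_mem_vanishing {k l : ℕ} {f g : PowerSeries A} (hf : f ∈ vanishing A k)
    (hg : g ∈ vanishing A l) : f * g ∈ vanishing A (k + l) := by
  intro j hj
  rw [coeff_mul]
  refine Finset.sum_eq_zero fun p hp => ?_
  rw [Finset.HasAntidiagonal.mem_antidiagonal] at hp
  by_cases h : p.1 < k
  · rw [hf _ h, zero_mul]
  · rw [hg p.2 (by omega), mul_zero]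

theorem coeff_mul_of_vanishing {k l : ℕ} {f g : PowerSeries A} (hf : f ∈ vanishing A k)
    (hg : g ∈ vanishing A l) : coeff (k + l) (f * g) = coeff k f * coeff l g := by
  rw [coeff_mul, Finset.sum_eq_single (k, l)]
  · intro p hp hne
    rw [Finset.HasAntidiagonal.mem_antidiagonal] at hp
    rcases lt_trichotomy p.1 k with h | h | h
    · rw [hf _ h, zero_mul]
    · exact absurd (Prod.ext h (by omega)) hne
    · rw [hg p.2 (by omega), mul_zero]
  · intro h
    simp at h

theorem mem_vanishing_zero (f : PowerSeries A) : f ∈ vanishing A 0 := fun j hj => by omega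

end PowerSeries

section

open PowerSeries LCSLie

attribute [local instance] LieRing.ofAssociativeRing

variable {G : Type*} [Group G] {A : Type*} [Ring A] (ρ : G →* PowerSeries A)

variable {ρ} in
-- The constants cancel in `xy - yx`, so a group commutator minus 1 is the ring commutator of `ρ x -
-- 1` and `ρ y - 1` up to a unit with constant term 1. This turns group commutators into Lie
-- brackets of leading coefficients.
theorem sub_one_commutator (x y : G) :
    ρ ⁅x, y⁆ - 1 = ((ρ x - 1) * (ρ y - 1) - (ρ y - 1) * (ρ x - 1)) * ρ (y * x)⁻¹ := by
  have h : (ρ x - 1) * (ρ y - 1) - (ρ y - 1) * (ρ x - 1) = ρ (x * y) - ρ (y * x) := by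
    rw [map_mul, map_mul]; noncomm_ring
  rw [h, sub_mul, ← map_mul, ← map_mul, mul_inv_cancel, map_one]
  congr 2
  simp [commutatorElement_def, mul_assoc]

variable {ρ} (hρ : ∀ g, coeff 0 (ρ g) = 1)

include hρ

theorem sub_one_mem_vanishing_one (x : G) : ρ x - 1 ∈ vanishing A 1 := by
  intro j hj
  obtain rfl : j = 0 := by omega
  rw [map_sub, hρ, coeff_zero_one, sub_self]

theorem sub_one_mem_vanishing {i : ℕ} {x : G} (hx : x ∈ Gam G i) :
    ρ x - 1 ∈ vanishing A (i + 1) := by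
  induction i generalizing x with
  | zero => exact sub_one_mem_vanishing_one hρ x
  | succ i ih =>
    change x ∈ Subgroup.closure {x | ∃ p ∈ Gam G i, ∃ q ∈ (⊤ : Subgroup G), ⁅p, q⁆ = x} at hx
    have hmul : ∀ {f g : PowerSeries A}, f ∈ vanishing A (i + 1 + 1) →
        f * g ∈ vanishing A (i + 1 + 1) := fun {f g} hf =>
      mul_mem_vanishing (l := 0) hf (mem_vanishing_zero g)
    induction hx using Subgroup.closure_induction with
    | mem x hx =>
      obtain ⟨p, hp, q, -, rfl⟩ := hx
      rw [sub_one_commutator]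
      have h1 := mul_mem_vanishing (ih hp) (sub_one_mem_vanishing_one hρ q)
      have h2 := mul_mem_vanishing (sub_one_mem_vanishing_one hρ q) (ih hp)
      rw [add_comm 1] at h2
      exact hmul (AddSubgroup.sub_mem _ h1 h2)
    | one => rw [map_one, sub_self]; exact AddSubgroup.zero_mem _
    | mul x y _ _ h1 h2 =>
      have : ρ (x * y) - 1 = (ρ x - 1) * ρ y + (ρ y - 1) := by rw [map_mul]; noncomm_ring
      rw [this]
      exact AddSubgroup.add_mem _ (hmul h1) h2
    | inv x _ h1 =>
      have : ρ x⁻¹ - 1 = -((ρ x - 1) * ρ x⁻¹) := by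
        rw [sub_mul, ← map_mul, mul_inv_cancel, map_one]; noncomm_ring
      rw [this]
      exact AddSubgroup.neg_mem _ (hmul h1)

/-- The additive map `gr_*(G) → A` that takes leading coefficients. -/
noncomputable def leadAdd : Gr G →+ A :=
  -- The index is shifted because `Gam G i` is `Γ^{i+1}`, whose elements are 1 modulo `X ^ (i + 1)`.
  Gr.liftAdd (fun i x => coeff (i + 1) (ρ x))
    (by
      intro i x hx y hy
      have e : ρ (x * y) = (ρ x - 1) * (ρ y - 1) + (ρ x + ρ y - 1) := by
        rw [map_mul]; noncomm_ring
      have h := mul_mem_vanishing (sub_one_mem_vanishing hρ hx) (sub_one_mem_vanishing hρ hy)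
        (i + 1) (by omega)
      rw [e, map_add, h, zero_add, map_sub, map_add, coeff_one, if_neg (by omega), sub_zero])
    (by
      intro i x hx
      have h := sub_one_mem_vanishing hρ hx (i + 1) (by omega)
      rwa [map_sub, coeff_one, if_neg (by omega), sub_zero] at h)

theorem leadAdd_mk {i : ℕ} {x : G} (hx : x ∈ Gam G i) :
    leadAdd hρ (Gr.mk i x hx) = coeff (i + 1) (ρ x) := Gr.liftAdd_mk hx

theorem leadAdd_mk' {i : ℕ} {x : G} (hx : x ∈ Gam G i) :
    leadAdd hρ (Gr.mk i x hx) = coeff (i + 1) (ρ x - 1) := by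
  rw [leadAdd_mk, map_sub, coeff_one, if_neg (by omega), sub_zero]

theorem leadAdd_lie (a b : Gr G) : leadAdd hρ ⁅a, b⁆ = ⁅leadAdd hρ a, leadAdd hρ b⁆ := by
  induction a using Gr.induction with
  | h0 => rw [zero_lie, map_zero, zero_lie]
  | hadd x y hx hy => rw [add_lie, map_add, map_add, add_lie, hx, hy]
  | hmk i x hx =>
    induction b using Gr.induction with
    | h0 => rw [lie_zero, map_zero, lie_zero]
    | hadd x y hx hy => rw [lie_add, map_add, map_add, lie_add, hx, hy]
    | hmk j y hy =>
      rw [Gr.mk_lie_mk, leadAdd_mk', leadAdd_mk', leadAdd_mk', sub_one_commutator]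
      have hx' := sub_one_mem_vanishing hρ hx
      have hy' := sub_one_mem_vanishing hρ hy
      have h1 := mul_mem_vanishing hx' hy'
      have h2 := mul_mem_vanishing hy' hx'
      have c1 := coeff_mul_of_vanishing hx' hy'
      have c2 := coeff_mul_of_vanishing hy' hx'
      rw [add_comm (j + 1)] at h2 c2
      have h3 := coeff_mul_of_vanishing (AddSubgroup.sub_mem _ h1 h2)
        (mem_vanishing_zero (ρ (y * x)⁻¹))
      rw [hρ, mul_one, map_sub, c1, c2] at h3
      rw [LieRing.of_associative_ring_bracket, ← h3]
      rw [show i + j + 1 + 1 = i + 1 + (j + 1) + 0 by omega]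

/-- The morphism of Lie rings `gr_*(G) → A` that takes leading coefficients. -/
noncomputable def lead : Gr G →ₗ⁅ℤ⁆ A :=
  { (leadAdd hρ).toIntLinearMap with map_lie' := fun {a b} => leadAdd_lie hρ a b }

theorem lead_mk {i : ℕ} {x : G} (hx : x ∈ Gam G i) :
    lead hρ (Gr.mk i x hx) = coeff (i + 1) (ρ x) := leadAdd_mk hρ hx

end

/-! ### The Magnus expansion -/

section Magnus

open PowerSeries

variable (X : Type*)

/-- The unit `1 + t x` of the ring of power series over the free associative algebra. -/
noncomputable def magnusUnit (x : X) : (PowerSeries (FreeAlgebra ℤ X))ˣ where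
  val := 1 + PowerSeries.X * C (FreeAlgebra.ι ℤ x)
  inv := invOfUnit (1 + PowerSeries.X * C (FreeAlgebra.ι ℤ x)) 1
  val_inv := mul_invOfUnit _ _ (by simp)
  inv_val := invOfUnit_mul _ _ (by simp)

/-- The Magnus expansion. -/
noncomputable def magnus : FreeGroup X →* PowerSeries (FreeAlgebra ℤ X) :=
  (Units.coeHom _).comp (FreeGroup.lift (magnusUnit X))

theorem magnus_of (x : X) :
    magnus X (FreeGroup.of x) = 1 + PowerSeries.X * C (FreeAlgebra.ι ℤ x) := by
  rw [magnus, MonoidHom.comp_apply, FreeGroup.lift_apply_of]; rfl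

theorem coeff_zero_magnus (g : FreeGroup X) : coeff 0 (magnus X g) = 1 := by
  rw [coeff_zero_eq_constantCoeff_apply]
  have : ((constantCoeff (R := FreeAlgebra ℤ X)).toMonoidHom.comp (magnus X)) = 1 := by
    ext x
    simp [magnus_of]
  exact DFunLike.congr_fun this g

/-- The canonical morphism from the free Lie ring to `gr_*` of the free group. -/
noncomputable def freeLieToGr : FreeLieAlgebra ℤ X →ₗ⁅ℤ⁆ Gr (FreeGroup X) :=
  FreeLieAlgebra.lift ℤ fun x => Gr.mk 0 (FreeGroup.of x) (Gr.mem_Gam_zero _)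

theorem freeLieToGr_of (x : X) : freeLieToGr X (FreeLieAlgebra.of ℤ x) =
    Gr.mk 0 (FreeGroup.of x) (Gr.mem_Gam_zero _) := FreeLieAlgebra.lift_of_apply ..

-- Composed with the leading coefficient of the Magnus expansion, this map is the embedding of the
-- free Lie ring in the free associative ring.
attribute [local instance] LieRing.ofAssociativeRing in
theorem freeLieToGr_injective [LinearOrder X] [Finite X] :
    Function.Injective (freeLieToGr X) := by
  have h : (lead (coeff_zero_magnus X)).comp (freeLieToGr X) = FreeLieAlgebra.toFree ℤ X := by
    refine FreeLieAlgebra.int_hom_ext fun x => ?_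
    rw [LieHom.comp_apply, freeLieToGr_of, lead_mk, magnus_of, FreeLieAlgebra.toFree_of, map_add,
      coeff_one, if_neg (by omega), zero_add, coeff_succ_X_mul, coeff_zero_C]
  have h2 := FreeLieAlgebra.toFree_int_injective (X := X)
  rw [← h] at h2
  exact Function.Injective.of_comp (f := lead (coeff_zero_magnus X)) h2

theorem freeLieToGr_surjective : Function.Surjective (freeLieToGr X) := by
  intro a
  refine Gr.mem_of_closure_eq_top (FreeGroup.closure_range_of X) (freeLieToGr X).range ?_ a
  rintro _ ⟨x, rfl⟩
  exact ⟨FreeLieAlgebra.of ℤ x, freeLieToGr_of X x⟩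

end Magnus

/-! ### Crossed homomorphisms and the descending central series -/

section Crossed

open LCSLie Gr

variable {P N : Type*} [Group P] [Group N]

theorem mk_eq_mk_iff_mul_inv_mem {m : ℕ} {x y : N} :
    (x : N ⧸ Gam N m) = y ↔ x * y⁻¹ ∈ Gam N m := by
  rw [QuotientGroup.eq_iff_div_mem, div_eq_mul_inv]

theorem mk_commute {i j m : ℕ} (h : m ≤ i + j + 1) {x y : N} (hx : x ∈ Gam N i)
    (hy : y ∈ Gam N j) : Commute (x : N ⧸ Gam N m) y := by
  have h1 : (QuotientGroup.mk' (Gam N m)) ⁅x, y⁆ = 1 :=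
    (QuotientGroup.eq_one_iff _).2 (Gam_anti h (comm_mem hx hy))
  rwa [map_commutatorElement, commutatorElement_eq_one_iff_commute] at h1

theorem Gam_succ_induction {i : ℕ} {p : N → Prop}
    (comm : ∀ x ∈ Gam N i, ∀ y, p ⁅x, y⁆) (one : p 1)
    (mul : ∀ x ∈ Gam N (i + 1), ∀ y ∈ Gam N (i + 1), p x → p y → p (x * y))
    (inv : ∀ x ∈ Gam N (i + 1), p x → p x⁻¹) {x : N} (hx : x ∈ Gam N (i + 1)) : p x := by
  change x ∈ Subgroup.closure {x | ∃ p ∈ Gam N i, ∃ q ∈ (⊤ : Subgroup N), ⁅p, q⁆ = x} at hx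
  induction hx using Subgroup.closure_induction with
  | mem x hx => obtain ⟨a, ha, b, -, rfl⟩ := hx; exact comm a ha b
  | one => exact one
  | mul x y hx hy h1 h2 => exact mul x hx y hy h1 h2
  | inv x hx h1 => exact inv x hx h1

theorem aut_mem (f : MulAut N) {i : ℕ} {x : N} (hx : x ∈ Gam N i) : f x ∈ Gam N i :=
  map_mem f.toMonoidHom hx

/-- The automorphism `f` moves the elements of `Γ^{j+1}` only by elements of `Γ^{j+k+2}`. -/
def ActsTrivially (k : ℕ) (f : MulAut N) : Prop :=
  ∀ j, ∀ x ∈ Gam N j, (f x : N ⧸ Gam N (j + k + 1)) = x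

/-- For a commutator, write `f a = c * a` and `f b = d * b`. In the quotient, `c` is central and `d`
commutes with `a` and with `⁅a, b⁆`, so `⁅c * a, d * b⁆` and `⁅a, b⁆` agree. -/
theorem actsTrivially_zero {f : MulAut N} (hf : ∀ x, (f x : N ⧸ Gam N 1) = x) :
    ActsTrivially 0 f := by
  intro j
  induction j with
  | zero => exact fun x _ => hf x
  | succ j ih =>
    intro x hx
    refine Gam_succ_induction (p := fun x => (f x : N ⧸ Gam N (j + 1 + 0 + 1)) = x)
      (fun a ha b => ?_) ?_ (fun x _ y _ h1 h2 => ?_) (fun x _ h1 => ?_) hx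
    · obtain ⟨c, hc, hca⟩ : ∃ c ∈ Gam N (j + 1), f a = c * a :=
        ⟨_, mk_eq_mk_iff_mul_inv_mem.1 (ih a ha), by group⟩
      obtain ⟨d, hd, hdb⟩ : ∃ d ∈ Gam N 1, f b = d * b :=
        ⟨_, mk_eq_mk_iff_mul_inv_mem.1 (hf b), by group⟩
      have hcen : ∀ (y : N), Commute (c : N ⧸ Gam N (j + 1 + 0 + 1)) y := fun y =>
        mk_commute (by omega) hc (mem_Gam_zero y)
      have hda : Commute (d : N ⧸ Gam N (j + 1 + 0 + 1)) a := mk_commute (by omega) hd ha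
      have hdab : Commute (d : N ⧸ Gam N (j + 1 + 0 + 1)) (⁅a, b⁆ : N) :=
        mk_commute (by omega) hd (comm_mem ha (mem_Gam_zero b))
      have e1 : ⁅c * a, d * b⁆ = c * (a * d * b * a⁻¹) * c⁻¹ * b⁻¹ * d⁻¹ := by
        simp [commutatorElement_def, mul_assoc]
      have e2 : a * d * b * a⁻¹ * b⁻¹ * d⁻¹ = (a * d) * a⁻¹ * ⁅a, b⁆ * d⁻¹ := by
        simp [commutatorElement_def, mul_assoc]
      have e3 : ((c * (a * d * b * a⁻¹) * c⁻¹ * b⁻¹ * d⁻¹ : N) : N ⧸ Gam N (j + 1 + 0 + 1)) =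
          (a * d * b * a⁻¹ * b⁻¹ * d⁻¹ : N) := by
        simp only [QuotientGroup.mk_mul, QuotientGroup.mk_inv]
        have := (hcen (a * d * b * a⁻¹)).eq
        simp only [QuotientGroup.mk_mul, QuotientGroup.mk_inv] at this
        rw [this, mul_inv_cancel_right]
      rw [map_commutatorElement, hca, hdb, e1, e3, e2]
      simp only [QuotientGroup.mk_mul, QuotientGroup.mk_inv]
      rw [← hda.eq, mul_inv_cancel_right, hdab.eq, mul_inv_cancel_right]
    · rw [map_one]
    · rw [map_mul, QuotientGroup.mk_mul, h1, h2, QuotientGroup.mk_mul]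
    · rw [map_inv, QuotientGroup.mk_inv, h1, QuotientGroup.mk_inv]

theorem ActsTrivially.mul {k : ℕ} {f g : MulAut N} (hf : ActsTrivially k f)
    (hg : ActsTrivially k g) : ActsTrivially k (f * g) := fun j x hx => by
  rw [MulAut.mul_apply, hf j _ (aut_mem g hx), hg j x hx]

theorem ActsTrivially.inv {k : ℕ} {f : MulAut N} (hf : ActsTrivially k f) :
    ActsTrivially k f⁻¹ := fun j x hx => by
  rw [← hf j _ (aut_mem f⁻¹ hx), MulAut.apply_inv_self]

/-- At the point `g (f y)` the commutator takes the value `f (g y)`. With `f y = a * y` and `g y = b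
* y`, the two points are `g a * b * y` and `f b * a * y`. In the finer quotient `f` fixes `b`, `g`
fixes `a`, and `a` and `b` commute. -/
theorem ActsTrivially.commutator {k : ℕ} {f g : MulAut N} (hf : ActsTrivially k f)
    (hg : ActsTrivially 0 g) : ActsTrivially (k + 1) ⁅f, g⁆ := fun j x hx => by
  obtain ⟨y, hy, rfl⟩ : ∃ y ∈ Gam N j, x = g (f y) :=
    ⟨f⁻¹ (g⁻¹ x), aut_mem _ (aut_mem _ hx), by simp⟩
  have e : ⁅f, g⁆ (g (f y)) = f (g y) := by
    rw [commutatorElement_def]; simp [MulAut.mul_apply]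
  rw [e]
  obtain ⟨a, ha, hay⟩ : ∃ a ∈ Gam N (j + k + 1), f y = a * y :=
    ⟨_, mk_eq_mk_iff_mul_inv_mem.1 (hf j y hy), by group⟩
  obtain ⟨b, hb, hby⟩ : ∃ b ∈ Gam N (j + 1), g y = b * y :=
    ⟨_, mk_eq_mk_iff_mul_inv_mem.1 (hg j y hy), by group⟩
  have h1 : (f b : N ⧸ Gam N (j + (k + 1) + 1)) = b := by
    have := hf (j + 1) b hb
    rwa [show j + 1 + k + 1 = j + (k + 1) + 1 by omega] at this
  have h2 : (g a : N ⧸ Gam N (j + (k + 1) + 1)) = a := hg (j + k + 1) a ha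
  have h3 : Commute (a : N ⧸ Gam N (j + (k + 1) + 1)) b := mk_commute (by omega) ha hb
  have e1 : f (g y) = f b * a * y := by rw [hby, map_mul, hay, mul_assoc]
  have e2 : g (f y) = g a * b * y := by rw [hay, map_mul, hby, mul_assoc]
  rw [e1, e2]
  simp only [QuotientGroup.mk_mul]
  rw [h1, h2, h3.eq]

variable {φ : P →* MulAut N} (hφ : ∀ p x, (φ p x : N ⧸ Gam N 1) = x)

include hφ

theorem actsTrivially_of_mem {k : ℕ} {p : P} (hp : p ∈ Gam P k) : ActsTrivially k (φ p) := by
  induction k generalizing p with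
  | zero => exact actsTrivially_zero (hφ p)
  | succ k ih =>
    refine Gam_succ_induction (p := fun p => ActsTrivially (k + 1) (φ p)) (fun a ha b => ?_) ?_
      (fun x _ y _ h1 h2 => ?_) (fun x _ h1 => ?_) hp
    · rw [map_commutatorElement]
      exact (ih ha).commutator (actsTrivially_zero (hφ b))
    · intro j x _; rw [map_one, MulAut.one_apply]
    · rw [map_mul]; exact h1.mul h2
    · rw [map_inv]; exact h1.inv

variable {u : P → N} (hu : ∀ p q, u (p * q) = u p * φ p (u q))

include hu

omit hφ in
theorem crossed_one : u 1 = 1 := by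
  have := hu 1 1
  rwa [mul_one, map_one, MulAut.one_apply, left_eq_mul] at this

/-- Expand `u (p * q) = u ⁅p, q⁆ * φ ⁅p, q⁆ (u (q * p))`. Modulo the next term of the series all the
actions that occur are trivial and `u p` is central, so both orders give the same product and `u ⁅p,
q⁆` must vanish. -/
theorem crossed_mem {k : ℕ} {p : P} (hp : p ∈ Gam P k) : u p ∈ Gam N k := by
  induction k generalizing p with
  | zero => exact mem_Gam_zero _
  | succ k ih =>
    refine Gam_succ_induction (p := fun p => u p ∈ Gam N (k + 1)) (fun p hp q => ?_) ?_
      (fun x _ y _ h1 h2 => ?_) (fun x _ h1 => ?_) hp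
    · have hc : ⁅p, q⁆ ∈ Gam P (k + 1) := comm_mem (j := 0) hp (mem_Gam_zero q)
      have e : u (p * q) = u ⁅p, q⁆ * φ ⁅p, q⁆ (u (q * p)) := by
        rw [← hu]; congr 1; simp [commutatorElement_def, mul_assoc]
      have h0 : (φ ⁅p, q⁆ (u (q * p)) : N ⧸ Gam N (k + 1)) = u (q * p) := by
        have := actsTrivially_of_mem hφ hc 0 _ (mem_Gam_zero (u (q * p)))
        rw [mk_eq_mk_iff_mul_inv_mem] at this ⊢
        exact Gam_anti (by omega) this
      have h1 : (φ p (u q) : N ⧸ Gam N (k + 1)) = u q := by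
        have := actsTrivially_of_mem hφ hp 0 _ (mem_Gam_zero (u q))
        rwa [zero_add] at this
      have h2 : (φ q (u p) : N ⧸ Gam N (k + 1)) = u p := actsTrivially_zero (hφ q) k _ (ih hp)
      have h3 : Commute (u p : N ⧸ Gam N (k + 1)) (u q) :=
        mk_commute (by omega) (ih hp) (mem_Gam_zero (u q))
      have e' := congrArg (fun x : N => (x : N ⧸ Gam N (k + 1))) e
      simp only [QuotientGroup.mk_mul] at e'
      rw [h0, hu, hu, QuotientGroup.mk_mul, QuotientGroup.mk_mul, h1, h2, h3.eq,
        right_eq_mul] at e'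
      exact (QuotientGroup.eq_one_iff _).1 e'
    · rw [crossed_one hu]; exact one_mem _
    · rw [hu]; exact mul_mem h1 (aut_mem _ h2)
    · have := hu x⁻¹ x
      rw [inv_mul_cancel, crossed_one hu] at this
      rw [eq_inv_of_mul_eq_one_left this.symm]
      exact inv_mem (aut_mem _ h1)

open Classical in
/-- The additive map induced by a crossed homomorphism on the descending central series. -/
noncomputable def crossedGr : Gr P →+ Gr N :=
  -- The value 0 is never used on the `i`-th step, since `u` maps it into `Gam N i`; it only makes
  -- the function total.
  Gr.liftAdd (fun i p => if h : u p ∈ Gam N i then Gr.mk i (u p) h else 0)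
    (by
      intro i x hx y hy
      have hx' := crossed_mem hφ hu hx
      have hy' := crossed_mem hφ hu hy
      rw [dif_pos (crossed_mem hφ hu (mul_mem hx hy)), dif_pos hx', dif_pos hy']
      have h1 : φ x (u y) ∈ Gam N i := aut_mem _ hy'
      rw [mk_congr rfl (hu x y) _ (mul_mem hx' h1), mk_mul hx' h1]
      congr 1
      rw [← sub_eq_zero, sub_eq_add_neg, ← mk_inv hy', ← mk_mul h1 (inv_mem hy')]
      refine mk_eq_zero _ ?_
      rw [← mk_eq_mk_iff_mul_inv_mem]
      exact actsTrivially_zero (hφ x) i _ hy')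
    (by
      intro i x hx
      have h := crossed_mem hφ hu hx
      rw [dif_pos (Gam_anti (Nat.le_succ i) h)]
      exact mk_eq_zero _ h)

theorem crossedGr_mk {i : ℕ} {p : P} (hp : p ∈ Gam P i) :
    crossedGr hφ hu (Gr.mk i p hp) = Gr.mk i (u p) (crossed_mem hφ hu hp) := by
  rw [crossedGr, Gr.liftAdd_mk, dif_pos]

end Crossed

/-- A homomorphism from a free group that is split, up to the descending central series, by a
crossed homomorphism induces an injection on `gr_*`. -/
theorem Gr.map_injective_of_crossed {P X : Type*} [Group P] [Finite X] [LinearOrder X]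
    {φ : P →* MulAut (FreeGroup X)}
    (hφ : ∀ p x, (φ p x : FreeGroup X ⧸ LCSLie.Gam (FreeGroup X) 1) = x) {u : P → FreeGroup X}
    (hu : ∀ p q, u (p * q) = u p * φ p (u q)) (α : FreeGroup X →* P)
    (hα : ∀ x, φ (α (FreeGroup.of x)) = 1)
    (huα : ∀ x, (u (α (FreeGroup.of x)) : FreeGroup X ⧸ LCSLie.Gam (FreeGroup X) 1) =
      FreeGroup.of x) :
    Function.Injective (Gr.map α) := by
  have hα' : ∀ g, φ (α g) = 1 := by
    have : φ.comp α = 1 := by ext1 x; exact hα x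
    exact fun g => DFunLike.congr_fun this g
  -- As `φ` is trivial along `α`, the crossed homomorphism `u ∘ α` is a genuine endomorphism. It is
  -- the identity on the abelianization, hence on `gr_*`, which is generated in degree one.
  let e : FreeGroup X →* FreeGroup X := MonoidHom.mk' (fun g => u (α g)) fun g h => by
    rw [map_mul, hu, hα', MulAut.one_apply]
  have h1 : ∀ a, crossedGr hφ hu (Gr.map α a) = Gr.map e a := by
    intro a
    induction a using Gr.induction with
    | h0 => simp
    | hadd x y hx hy => rw [map_add, map_add, map_add, hx, hy]
    | hmk i x hx => rw [Gr.map_mk, Gr.map_mk, crossedGr_mk]; rfl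
  have h2 : (Gr.map e).comp (freeLieToGr X) = freeLieToGr X := by
    refine FreeLieAlgebra.int_hom_ext fun x => ?_
    rw [LieHom.comp_apply, freeLieToGr_of, Gr.map_mk, ← sub_eq_zero, sub_eq_add_neg, ← Gr.mk_inv,
      ← Gr.mk_mul]
    exact Gr.mk_eq_zero _ (mk_eq_mk_iff_mul_inv_mem.1 (huα x))
  rw [injective_iff_map_eq_zero]
  intro a ha
  obtain ⟨w, rfl⟩ := freeLieToGr_surjective X a
  rw [← h2, LieHom.comp_apply, ← h1, ha, map_zero]

/-! ### The Artin action, with the conjugating elements -/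

section ArtinAction

set_option linter.unusedSimpArgs false
set_option linter.unusedSectionVars false

variable {I : Type*} [DecidableEq I]

/-- The automorphism `x_a ↦ x_b`, `x_b ↦ x_b⁻¹ x_a x_b` of a free group. -/
def artinAut (a b : I) (hab : a ≠ b) : MulAut (FreeGroup I) :=
  MonoidHom.toMulEquiv
    (FreeGroup.lift fun i => if i = a then FreeGroup.of b else if i = b then
      (FreeGroup.of b)⁻¹ * FreeGroup.of a * FreeGroup.of b else FreeGroup.of i)
    (FreeGroup.lift fun i => if i = b then FreeGroup.of a else if i = a then
      FreeGroup.of a * FreeGroup.of b * (FreeGroup.of a)⁻¹ else FreeGroup.of i)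
    (by
      ext i
      by_cases ha : i = a
      · subst ha; simp
      · by_cases hb : i = b
        · subst hb; simp [ha, hab, mul_assoc]
        · simp [ha, hb])
    (by
      ext i
      by_cases hb : i = b
      · subst hb; simp
      · by_cases ha : i = a
        · subst ha; simp [hb, hab.symm, mul_assoc]
        · simp [ha, hb])

theorem artinAut_of (a b : I) (hab : a ≠ b) (i : I) : artinAut a b hab (FreeGroup.of i) =
    if i = a then FreeGroup.of b else if i = b then
      (FreeGroup.of b)⁻¹ * FreeGroup.of a * FreeGroup.of b else FreeGroup.of i :=
  FreeGroup.lift_apply_of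

theorem artinAut_left (a b : I) (hab : a ≠ b) :
    artinAut a b hab (FreeGroup.of a) = FreeGroup.of b := by
  rw [artinAut_of, if_pos rfl]

theorem artinAut_right (a b : I) (hab : a ≠ b) : artinAut a b hab (FreeGroup.of b) =
    (FreeGroup.of b)⁻¹ * FreeGroup.of a * FreeGroup.of b := by
  rw [artinAut_of, if_neg hab.symm, if_pos rfl]

theorem artinAut_of_ne {a b : I} (hab : a ≠ b) {i : I} (ha : i ≠ a) (hb : i ≠ b) :
    artinAut a b hab (FreeGroup.of i) = FreeGroup.of i := by
  rw [artinAut_of, if_neg ha, if_neg hb]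

/-- Automorphisms of a free group and permutations act on families of elements. -/
def familyAction (I : Type*) :
    MulAut (FreeGroup I) × Equiv.Perm I →* MulAut (I → FreeGroup I) where
  toFun f :=
    { toFun := fun U j => f.1 (U (f.2⁻¹ j))
      invFun := fun U j => f.1⁻¹ (U (f.2 j))
      left_inv := fun U => by ext j; simp
      right_inv := fun U => by ext j; simp
      map_mul' := fun U V => by ext j; simp }
  map_one' := by ext; simp
  map_mul' f g := by ext; simp

/-- Pairs of an automorphism permuting the conjugacy classes of the generators, and a family of
conjugating elements. -/
abbrev FramedAut (I : Type*) : Type _ :=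
  (I → FreeGroup I) ⋊[familyAction I] (MulAut (FreeGroup I) × Equiv.Perm I)

namespace FramedAut

theorem perm_apply_inv_self (f : Equiv.Perm I) (i : I) : f (f⁻¹ i) = i := by simp

theorem perm_inv_apply_self (f : Equiv.Perm I) (i : I) : f⁻¹ (f i) = i := by simp

theorem mul_left_apply (f g : FramedAut I) (j : I) :
    (f * g).left j = f.left j * f.right.1 (g.left (f.right.2⁻¹ j)) := rfl

theorem inv_left_apply (f : FramedAut I) (j : I) :
    f⁻¹.left j = f.right.1⁻¹ ((f.left (f.right.2 j))⁻¹) := rfl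

/-- The automorphism sends each generator to the prescribed conjugate. -/
def Compatible (f : FramedAut I) : Prop := ∀ i, f.right.1 (FreeGroup.of i) =
  (f.left (f.right.2 i))⁻¹ * FreeGroup.of (f.right.2 i) * f.left (f.right.2 i)

theorem Compatible.mul {f g : FramedAut I} (hf : Compatible f) (hg : Compatible g) :
    Compatible (f * g) := fun i => by
  rw [SemidirectProduct.mul_right, Prod.fst_mul, Prod.snd_mul, MulAut.mul_apply, hg i, map_mul,
    map_mul, hf, mul_left_apply, map_inv, Equiv.Perm.mul_apply, perm_inv_apply_self]
  simp only [mul_assoc, mul_inv_rev]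

theorem Compatible.inv {f : FramedAut I} (hf : Compatible f) : Compatible f⁻¹ := fun i => by
  have h := hf (f.right.2⁻¹ i)
  rw [perm_apply_inv_self] at h
  rw [SemidirectProduct.inv_right, Prod.fst_inv, Prod.snd_inv, inv_left_apply,
    perm_apply_inv_self]
  apply f.right.1.injective
  rw [map_mul, map_mul, map_inv, MulAut.apply_inv_self, MulAut.apply_inv_self, h]
  group

theorem Compatible.one : Compatible (1 : FramedAut I) := fun i => by simp

/-- The image of an Artin generator. -/
def gen (a b : I) (hab : a ≠ b) : FramedAut I :=
  ⟨Pi.mulSingle a (FreeGroup.of b), artinAut a b hab, Equiv.swap a b⟩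

theorem compatible_gen (a b : I) (hab : a ≠ b) : Compatible (gen a b hab) := fun i => by
  simp only [gen]
  by_cases ha : i = a
  · subst ha; simp [artinAut_left, hab.symm]
  · by_cases hb : i = b
    · subst hb; simp [artinAut_right]
    · simp [artinAut_of_ne hab ha hb, Equiv.swap_apply_of_ne_of_ne ha hb, ha]

theorem ext_iff' {f g : FramedAut I} : f = g ↔ (∀ j, f.left j = g.left j) ∧
    (∀ i, f.right.1 (FreeGroup.of i) = g.right.1 (FreeGroup.of i)) ∧ f.right.2 = g.right.2 := by
  constructor
  · rintro rfl; exact ⟨fun _ => rfl, fun _ => rfl, rfl⟩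
  · rintro ⟨h1, h2, h3⟩
    refine SemidirectProduct.ext (funext h1) (Prod.ext ?_ h3)
    have : f.right.1.toMonoidHom = g.right.1.toMonoidHom := FreeGroup.ext_hom _ _ h2
    exact MulEquiv.toMonoidHom_injective this

theorem commute_gen {a b c d : I} (hab : a ≠ b) (hcd : c ≠ d) (hac : a ≠ c) (had : a ≠ d)
    (hbc : b ≠ c) (hbd : b ≠ d) : gen a b hab * gen c d hcd = gen c d hcd * gen a b hab := by
  rw [ext_iff']
  refine ⟨fun j => ?_, fun i => ?_, ?_⟩
  · simp only [mul_left_apply, gen, Equiv.swap_inv]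
    by_cases ha : j = a
    · subst ha
      simp [hac, had, hac.symm, hbc, hbc.symm, Equiv.swap_apply_of_ne_of_ne, artinAut_of_ne, hbd]
    · by_cases hc : j = c
      · subst hc
        simp [hac, had, hac.symm, hbc, hbc.symm, Equiv.swap_apply_of_ne_of_ne, artinAut_of_ne, hbd,
          had.symm, hbd.symm]
      · have h1 : Equiv.swap a b j ≠ c := by
          rw [Ne, Equiv.swap_apply_eq_iff, Equiv.swap_apply_of_ne_of_ne hac.symm hbc.symm]; exact hc
        have h2 : Equiv.swap c d j ≠ a := by
          rw [Ne, Equiv.swap_apply_eq_iff, Equiv.swap_apply_of_ne_of_ne hac had]; exact ha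
        simp [ha, hc, h1, h2]
  · simp only [SemidirectProduct.mul_right, Prod.fst_mul, MulAut.mul_apply, gen]
    by_cases ha : i = a
    · subst ha
      simp [artinAut_left, artinAut_of_ne, hac, had, hbc, hbd]
    · by_cases hb : i = b
      · subst hb
        simp [artinAut_right, artinAut_of_ne, hac, had, hbc, hbd]
      · by_cases hc : i = c
        · subst hc
          simp [artinAut_left, artinAut_of_ne, hac.symm, had.symm, hbc.symm, hbd.symm]
        · by_cases hd : i = d
          · subst hd
            simp [artinAut_right, artinAut_of_ne, hac.symm, had.symm, hbc.symm, hbd.symm]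
          · simp [artinAut_of_ne, ha, hb, hc, hd]
  · simp only [SemidirectProduct.mul_right, Prod.snd_mul, gen]
    apply Equiv.Perm.Disjoint.commute
    intro x
    by_cases ha : x = a
    · exact Or.inr (by rw [ha, Equiv.swap_apply_of_ne_of_ne hac had])
    · by_cases hb : x = b
      · exact Or.inr (by rw [hb, Equiv.swap_apply_of_ne_of_ne hbc hbd])
      · exact Or.inl (Equiv.swap_apply_of_ne_of_ne ha hb)

theorem braid_gen {a b c : I} (hab : a ≠ b) (hbc : b ≠ c) (hac : a ≠ c) :
    gen a b hab * gen b c hbc * gen a b hab = gen b c hbc * gen a b hab * gen b c hbc := by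
  rw [ext_iff']
  have s1 : Equiv.swap a b c = c := Equiv.swap_apply_of_ne_of_ne hac.symm hbc.symm
  have s2 : Equiv.swap b c a = a := Equiv.swap_apply_of_ne_of_ne hab hac
  have f1 := artinAut_of_ne hab hac.symm hbc.symm
  have f2 := artinAut_of_ne hbc hab hac
  refine ⟨fun j => ?_, fun i => ?_, ?_⟩
  · simp only [mul_left_apply, gen, Equiv.swap_inv, SemidirectProduct.mul_right, Prod.fst_mul,
      Prod.snd_mul, mul_inv_rev, Equiv.Perm.mul_apply, MulAut.mul_apply]
    by_cases ha : j = a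
    · subst ha
      simp [s1, s2, hab, hac, hbc, hab.symm, hac.symm, hbc.symm, f1, f2, artinAut_left,
        artinAut_right, mul_assoc]
    · by_cases hb : j = b
      · subst hb
        simp [s1, s2, hab, hac, hbc, hab.symm, hac.symm, hbc.symm, f1, f2, artinAut_left,
          artinAut_right, mul_assoc]
      · by_cases hc : j = c
        · subst hc
          simp [s1, s2, hab, hac, hbc, hab.symm, hac.symm, hbc.symm, f1, f2, artinAut_left,
            artinAut_right, mul_assoc]
        · simp [ha, hb, hc, Equiv.swap_apply_of_ne_of_ne]
  · simp only [SemidirectProduct.mul_right, Prod.fst_mul, MulAut.mul_apply, gen]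
    by_cases ha : i = a
    · subst ha; simp [f1, f2, artinAut_left, artinAut_right, mul_assoc]
    · by_cases hb : i = b
      · subst hb; simp [f1, f2, artinAut_left, artinAut_right, mul_assoc]
      · by_cases hc : i = c
        · subst hc; simp [f1, f2, artinAut_left, artinAut_right, mul_assoc]
        · simp [artinAut_of_ne, ha, hb, hc]
  · simp only [SemidirectProduct.mul_right, Prod.snd_mul, gen]
    have e1 := Equiv.swap_mul_swap_mul_swap hab hac
    have e2 := Equiv.swap_mul_swap_mul_swap hbc.symm hac.symm
    rw [Equiv.swap_comm b a, Equiv.swap_comm c b] at e2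
    rw [e1, e2, Equiv.swap_comm]

end FramedAut

end ArtinAction

/-- The action of the braid group on the free group, with the conjugating elements. -/
def artinRep (n : ℕ) : BraidGroup n →* FramedAut (Fin (n + 1)) :=
  PresentedGroup.toGroup
    (f := fun i => FramedAut.gen i.castSucc i.succ (by simp [Fin.ext_iff])) (by
    rintro r (⟨i, j, h⟩ | ⟨i, j, h⟩)
    · rw [map_commutatorElement, FreeGroup.lift_apply_of, FreeGroup.lift_apply_of,
        commutatorElement_eq_one_iff_mul_comm]
      apply FramedAut.commute_gen <;> simp [Fin.ext_iff] <;> omega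
    · rw [map_mul, map_inv, mul_inv_eq_one]
      simp only [map_mul, FreeGroup.lift_apply_of]
      have hj : j.castSucc = i.succ := by ext; simp [← h]
      have h3 : i.castSucc ≠ j.succ := by
        simp only [ne_eq, Fin.ext_iff, Fin.val_succ, Fin.val_castSucc]; omega
      have h1 : i.succ ≠ j.succ := by simp only [ne_eq, Fin.ext_iff, Fin.val_succ]; omega
      simp only [hj]
      exact FramedAut.braid_gen _ h1 h3)

theorem artinRep_sigma {n : ℕ} (i : Fin n) : artinRep n (sigma i) =
    FramedAut.gen i.castSucc i.succ (by simp [Fin.ext_iff]) := PresentedGroup.toGroup.of _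

theorem fin_castSucc_ne_succ {n : ℕ} (i : Fin n) : i.castSucc ≠ i.succ := by simp [Fin.ext_iff]

/-! ### The action of pure braids on the free group with the last generator killed -/

namespace BraidGroup

variable {n : ℕ}

theorem induction_on_sigma {p : BraidGroup n → Prop} (one : p 1) (gen : ∀ i, p (sigma i))
    (mul : ∀ g h, p g → p h → p (g * h)) (inv : ∀ g, p g → p g⁻¹) (g : BraidGroup n) : p g := by
  have hg : g ∈ Subgroup.closure (Set.range (PresentedGroup.of (rels := {r | ArtinRel n r}))) := by
    rw [PresentedGroup.closure_range_of]; exact Subgroup.mem_top g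
  induction hg using Subgroup.closure_induction with
  | mem x hx => obtain ⟨i, rfl⟩ := hx; exact gen i
  | one => exact one
  | mul x y _ _ h1 h2 => exact mul x y h1 h2
  | inv x _ h1 => exact inv x h1

/-- The automorphism of the free group defined by a braid. -/
def act (g : BraidGroup n) : MulAut (FreeGroup (Fin (n + 1))) := (artinRep n g).right.1

/-- The conjugating elements of a braid, indexed by the end points of the strands. -/
def framing (g : BraidGroup n) (j : Fin (n + 1)) : FreeGroup (Fin (n + 1)) := (artinRep n g).left j

theorem artinRep_right_snd (g : BraidGroup n) : (artinRep n g).right.2 = toPerm n g := by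
  have : ((MonoidHom.snd _ _).comp SemidirectProduct.rightHom).comp (artinRep n) = toPerm n := by
    refine PresentedGroup.ext fun i => ?_
    change (artinRep n (sigma i)).right.2 = toPerm n (sigma i)
    rw [artinRep_sigma, toPerm_sigma]; rfl
  exact DFunLike.congr_fun this g

theorem act_mul (g h : BraidGroup n) : act (g * h) = act g * act h := by
  rw [act, map_mul]; rfl

theorem act_one : act (1 : BraidGroup n) = 1 := by rw [act, map_one]; rfl

theorem framing_mul (g h : BraidGroup n) (j : Fin (n + 1)) :
    framing (g * h) j = framing g j * act g (framing h ((toPerm n g)⁻¹ j)) := by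
  rw [framing, map_mul, FramedAut.mul_left_apply, artinRep_right_snd]; rfl

theorem act_of (g : BraidGroup n) (i : Fin (n + 1)) : act g (FreeGroup.of i) =
    (framing g (toPerm n g i))⁻¹ * FreeGroup.of (toPerm n g i) * framing g (toPerm n g i) := by
  have : (artinRep n g).Compatible := by
    induction g using induction_on_sigma with
    | one => rw [map_one]; exact FramedAut.Compatible.one
    | gen i => rw [artinRep_sigma]; exact FramedAut.compatible_gen _ _ _
    | mul g h hg hh => rw [map_mul]; exact hg.mul hh
    | inv g hg => rw [map_inv]; exact hg.inv
  rw [← artinRep_right_snd]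
  exact this i

theorem act_sigma (i : Fin n) :
    act (sigma i) = artinAut i.castSucc i.succ (fin_castSucc_ne_succ i) := by
  rw [act, artinRep_sigma]; rfl

theorem framing_sigma (i : Fin n) :
    framing (sigma i) = Pi.mulSingle i.castSucc (FreeGroup.of i.succ) := by
  funext j
  rw [framing, artinRep_sigma]; rfl

end BraidGroup

open LCSLie

/-- Killing the last generator of a free group. -/
def killLast (n : ℕ) : FreeGroup (Fin (n + 1)) →* FreeGroup (Fin n) :=
  FreeGroup.lift (Fin.lastCases 1 FreeGroup.of)

theorem killLast_of_last (n : ℕ) : killLast n (FreeGroup.of (Fin.last n)) = 1 := by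
  rw [killLast, FreeGroup.lift_apply_of, Fin.lastCases_last]

theorem killLast_of_castSucc {n : ℕ} (i : Fin n) :
    killLast n (FreeGroup.of i.castSucc) = FreeGroup.of i := by
  rw [killLast, FreeGroup.lift_apply_of, Fin.lastCases_castSucc]

theorem conj_inv_eq {N : Type*} [Group N] (a b : N) :
    ((a⁻¹ * b * a : N) : N ⧸ Gam N 1) = b := by
  have h : Commute (a : N ⧸ Gam N 1) b :=
    mk_commute (i := 0) (j := 0) (by omega) (Gr.mem_Gam_zero a) (Gr.mem_Gam_zero b)
  rw [mul_assoc, QuotientGroup.mk_mul, QuotientGroup.mk_mul, ← h.eq, QuotientGroup.mk_inv,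
    inv_mul_cancel_left]

namespace PureBraid

variable {n : ℕ}

theorem toPerm_coe (p : PureBraid n) : toPerm n p = 1 := p.2

/-- The endomorphism of the free group of rank `n` defined by a pure braid on `n + 1` strands. -/
def barEnd (p : PureBraid n) : FreeGroup (Fin n) →* FreeGroup (Fin n) :=
  FreeGroup.lift fun i => killLast n (act (p : BraidGroup n) (FreeGroup.of i.castSucc))

/-- A pure braid sends the last generator to a conjugate of itself, so its automorphism descends to
the quotient in which this generator is trivial. -/
theorem killLast_act (p : PureBraid n) (y : FreeGroup (Fin (n + 1))) :
    killLast n (act (p : BraidGroup n) y) = barEnd p (killLast n y) := by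
  have : (killLast n).comp (act (p : BraidGroup n)).toMonoidHom = (barEnd p).comp (killLast n) := by
    ext i
    induction i using Fin.lastCases with
    | cast i =>
      rw [MonoidHom.comp_apply, MonoidHom.comp_apply, killLast_of_castSucc, barEnd,
        FreeGroup.lift_apply_of]
      rfl
    | last =>
      rw [MonoidHom.comp_apply, MonoidHom.comp_apply, killLast_of_last, map_one]
      change killLast n (act (p : BraidGroup n) (FreeGroup.of (Fin.last n))) = 1
      rw [act_of, toPerm_coe, Equiv.Perm.one_apply, map_mul, map_mul, killLast_of_last, mul_one,
        map_inv, inv_mul_cancel]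
  exact DFunLike.congr_fun this y

theorem barEnd_of (p : PureBraid n) (i : Fin n) :
    barEnd p (FreeGroup.of i) = killLast n (act (p : BraidGroup n) (FreeGroup.of i.castSucc)) :=
  FreeGroup.lift_apply_of

theorem barEnd_mul (p q : PureBraid n) : barEnd (p * q) = (barEnd p).comp (barEnd q) := by
  ext i
  rw [MonoidHom.comp_apply, barEnd_of, barEnd_of, ← killLast_act, Subgroup.coe_mul, act_mul,
    MulAut.mul_apply]

theorem barEnd_one : barEnd (1 : PureBraid n) = MonoidHom.id _ := by
  ext i
  rw [barEnd_of, Subgroup.coe_one, act_one, MulAut.one_apply, killLast_of_castSucc,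
    MonoidHom.id_apply]

/-- The action of the pure braid group on `n + 1` strands on the free group of rank `n`. -/
def barAct (n : ℕ) : PureBraid n →* MulAut (FreeGroup (Fin n)) where
  toFun p := MonoidHom.toMulEquiv (barEnd p) (barEnd p⁻¹)
    (by rw [← barEnd_mul, inv_mul_cancel, barEnd_one])
    (by rw [← barEnd_mul, mul_inv_cancel, barEnd_one])
  map_one' := by
    ext x
    exact DFunLike.congr_fun barEnd_one x
  map_mul' p q := by
    ext x
    exact DFunLike.congr_fun (barEnd_mul p q) x

theorem barAct_apply (p : PureBraid n) (x : FreeGroup (Fin n)) : barAct n p x = barEnd p x := rfl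

theorem barAct_trivial (p : PureBraid n) (x : FreeGroup (Fin n)) :
    (barAct n p x : FreeGroup (Fin n) ⧸ Gam (FreeGroup (Fin n)) 1) = x := by
  have : (QuotientGroup.mk' (Gam (FreeGroup (Fin n)) 1)).comp (barEnd p) =
      QuotientGroup.mk' (Gam (FreeGroup (Fin n)) 1) := by
    ext i
    rw [MonoidHom.comp_apply, barEnd_of, act_of, toPerm_coe, Equiv.Perm.one_apply,
      map_mul (killLast n), map_mul (killLast n), map_inv (killLast n), killLast_of_castSucc]
    exact conj_inv_eq _ _
  exact DFunLike.congr_fun this x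

/-- The conjugating element of the last strand. -/
def barFraming (p : PureBraid n) : FreeGroup (Fin n) :=
  killLast n (framing (p : BraidGroup n) (Fin.last n))

/-- Conjugating elements multiply as a cocycle up to a permutation of the strands; a pure braid
fixes the last position, which leaves a true crossed homomorphism. -/
theorem barFraming_mul (p q : PureBraid n) :
    barFraming (p * q) = barFraming p * barAct n p (barFraming q) := by
  rw [barFraming, Subgroup.coe_mul, framing_mul, toPerm_coe, inv_one, Equiv.Perm.one_apply,
    map_mul, killLast_act]
  rfl

end PureBraid

/-! ### Squares that link the last strand, and descending products of Artin generators. -/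

namespace BraidGroup

variable {n : ℕ}

theorem sigma_sq_mem (k : Fin n) : sigma k ^ 2 ∈ pureSubgroup n := by
  rw [pureSubgroup, MonoidHom.mem_ker, map_pow, toPerm_sigma, pow_two, Equiv.swap_mul_self]

theorem pure_conj_mem (g : BraidGroup n) {p : BraidGroup n} (hp : p ∈ pureSubgroup n) :
    g * p * g⁻¹ ∈ pureSubgroup n := (MonoidHom.normal_ker (toPerm n)).conj_mem _ hp _

/-- The pure braid `g σ_k² g⁻¹`. -/
def conjSq (g : BraidGroup n) (k : Fin n) : PureBraid n :=
  ⟨g * sigma k ^ 2 * g⁻¹, pure_conj_mem g (sigma_sq_mem k)⟩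

open PureBraid

section

variable {g : BraidGroup n} {k : Fin n} (hg : toPerm n g k.succ = Fin.last n)

include hg

theorem killLast_act_succ : killLast n (act g (FreeGroup.of k.succ)) = 1 := by
  rw [act_of, hg, map_mul, map_mul, killLast_of_last, mul_one, map_inv, inv_mul_cancel]

/-- The generators moved by `σ_k²` are only conjugated, by words in `x_k` and `x_{k+1}`. Here `g`
sends `x_{k+1}` to a conjugate of the last generator, which is killed, so nothing of these
conjugations remains. -/
theorem killLast_act_sigma_sq (z : FreeGroup (Fin (n + 1))) :
    killLast n (act g (act (sigma k ^ 2) z)) = killLast n (act g z) := by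
  have : ((killLast n).comp (act g).toMonoidHom).comp (act (sigma k ^ 2)).toMonoidHom =
      (killLast n).comp (act g).toMonoidHom := by
    ext i
    change killLast n (act g (act (sigma k ^ 2) _)) = killLast n (act g _)
    have hne := fin_castSucc_ne_succ k
    have h0 := killLast_act_succ hg
    rw [pow_two, act_mul, act_sigma, MulAut.mul_apply]
    by_cases h1 : i = k.castSucc
    · subst h1
      simp [artinAut_left, artinAut_right, h0]
    · by_cases h2 : i = k.succ
      · subst h2
        simp [artinAut_left, artinAut_right, h0]
      · rw [artinAut_of_ne hne h1 h2, artinAut_of_ne hne h1 h2]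
  exact DFunLike.congr_fun this z

theorem barAct_conjSq : barAct n (conjSq g k) = 1 := by
  have : ∀ y, barEnd (conjSq g k) (killLast n y) = killLast n y := by
    intro y
    rw [← killLast_act]
    change killLast n (act (g * sigma k ^ 2 * g⁻¹) y) = _
    rw [act_mul, act_mul, MulAut.mul_apply, MulAut.mul_apply, killLast_act_sigma_sq hg,
      ← MulAut.mul_apply, ← act_mul, mul_inv_cancel, act_one, MulAut.one_apply]
  have h2 : barEnd (conjSq g k) = MonoidHom.id _ := by
    ext i
    rw [← killLast_of_castSucc, this]; rfl
  ext1 x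
  exact DFunLike.congr_fun h2 x

/-- Apply the cocycle rule to both sides of `g σ_k² = (g σ_k² g⁻¹) g`. The conjugating element of
`σ_k²` at position `k + 1` is a conjugate of `x_k`, and `g` carries it to a conjugate of `x_i`; the
factors coming from `g` conjugate it once more and disappear in the abelianization. -/
theorem barFraming_conjSq {i : Fin n} (hi : toPerm n g k.castSucc = i.castSucc) :
    (barFraming (conjSq g k) : FreeGroup (Fin n) ⧸ Gam (FreeGroup (Fin n)) 1) =
      FreeGroup.of i := by
  have hne := fin_castSucc_ne_succ k
  have h0 := killLast_act_succ hg
  have hinv : (toPerm n g)⁻¹ (Fin.last n) = k.succ := by rw [← hg]; simp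
  have hp : toPerm n (g * sigma k ^ 2 * g⁻¹) = 1 := pure_conj_mem g (sigma_sq_mem k)
  have e : g * sigma k ^ 2 = (g * sigma k ^ 2 * g⁻¹) * g := by group
  have e1 := congrArg (fun h => killLast n (framing h (Fin.last n))) e
  rw [framing_mul g, framing_mul (g * sigma k ^ 2 * g⁻¹), hp, hinv, inv_one, Equiv.Perm.one_apply,
    map_mul, map_mul] at e1
  have e2 : killLast n (act (g * sigma k ^ 2 * g⁻¹) (framing g (Fin.last n))) =
      killLast n (framing g (Fin.last n)) := by
    have h := killLast_act (conjSq g k) (framing g (Fin.last n))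
    rw [← barAct_apply, barAct_conjSq hg, MulAut.one_apply] at h
    exact h
  rw [e2] at e1
  have e3 : framing (sigma k ^ 2) k.succ =
      (FreeGroup.of k.succ)⁻¹ * FreeGroup.of k.castSucc * FreeGroup.of k.succ := by
    rw [pow_two, framing_mul, toPerm_sigma, Equiv.swap_inv, Equiv.swap_apply_right,
      framing_sigma, Pi.mulSingle_eq_same, Pi.mulSingle_eq_of_ne hne.symm, one_mul, act_sigma,
      artinAut_right]
  have e4 : killLast n (act g (framing (sigma k ^ 2) k.succ)) =
      (killLast n (framing g i.castSucc))⁻¹ * FreeGroup.of i *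
        killLast n (framing g i.castSucc) := by
    rw [e3, map_mul, map_mul, map_mul, map_mul, map_inv, map_inv, h0, inv_one, one_mul, mul_one,
      act_of, hi, map_mul, map_mul, map_inv, killLast_of_castSucc]
  rw [e4] at e1
  have e5 : barFraming (conjSq g k) =
      killLast n (framing (g * sigma k ^ 2 * g⁻¹) (Fin.last n)) := rfl
  rw [e5, eq_mul_inv_of_mul_eq e1.symm]
  set c := killLast n (framing g (Fin.last n))
  have := conj_inv_eq c⁻¹ ((killLast n (framing g i.castSucc))⁻¹ * FreeGroup.of i *
        killLast n (framing g i.castSucc))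
  rw [inv_inv, conj_inv_eq] at this
  exact this

end

/-- The braid generator with an index in `ℕ`, trivial if the index is out of range. -/
def sig (n k : ℕ) : BraidGroup n := if h : k < n then sigma ⟨k, h⟩ else 1

theorem sig_of_lt {k : ℕ} (h : k < n) : sig n k = sigma ⟨k, h⟩ := dif_pos h

/-- The braid `σ_{a+l-1} ⋯ σ_{a+1} σ_a`. -/
def desc (n a : ℕ) : ℕ → BraidGroup n
  | 0 => 1
  | l + 1 => sig n (a + l) * desc n a l

theorem filter_range_eq_range' (i j m : ℕ) :
    (List.range m).filter (fun k => decide (i < k ∧ k < j)) =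
      List.range' (i + 1) (min j m - (i + 1)) := by
  induction m with
  | zero => simp
  | succ m ih =>
    rw [List.range_succ, List.filter_append, ih]
    by_cases h : i < m ∧ m < j
    · rw [show min j (m + 1) - (i + 1) = (min j m - (i + 1)) + 1 by omega, List.range'_concat]
      simp only [List.filter_cons, h, decide_true, and_self, if_true, List.filter_nil]
      congr 2
      omega
    · rw [show min j (m + 1) - (i + 1) = min j m - (i + 1) by omega]
      simp [h]

theorem word_eq (w : List (Fin n)) : word w = ((w.map Fin.val).map (sig n)).prod := by
  rw [word, List.map_map]
  congr 2
  funext i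
  exact (sig_of_lt i.2).symm

theorem prod_range'_reverse (a l : ℕ) :
    (((List.range' a l).reverse).map (sig n)).prod = desc n a l := by
  induction l with
  | zero => rfl
  | succ l ih => 
    rw [List.range'_concat, List.reverse_append, List.map_append, List.prod_append, ih]
    simp [desc]

theorem word_between (i j : Fin (n + 1)) : word (between i j) = desc n (i + 1) (j - (i + 1)) := by
  rw [word_eq, between, List.map_reverse]
  have h : List.map Fin.val ((List.finRange n).filter fun k : Fin n => (i : ℕ) < k ∧ (k : ℕ) < j) =
      List.range' (i + 1) (j - (i + 1)) := by
    have := List.filter_map (f := Fin.val (n := n)) (p := fun k => decide ((i : ℕ) < k ∧ k < (j : ℕ)))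
      (l := List.finRange n)
    rw [List.map_coe_finRange_eq_range, filter_range_eq_range', min_eq_left (by omega)] at this
    rw [this]; rfl
  rw [h, prod_range'_reverse]

theorem toPerm_sig_val {k : ℕ} (hk : k < n) (i : Fin (n + 1)) :
    (toPerm n (sig n k) i : ℕ) = Equiv.swap k (k + 1) (i : ℕ) := by
  rw [sig_of_lt hk, toPerm_sigma, Equiv.swap_apply_def, Equiv.swap_apply_def]
  simp only [Fin.ext_iff, Fin.val_castSucc, Fin.val_succ]
  split_ifs <;> simp

theorem toPerm_desc_start {a l : ℕ} (h : a + l ≤ n) (i : Fin (n + 1)) (hi : (i : ℕ) = a) :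
    (toPerm n (desc n a l) i : ℕ) = a + l := by
  induction l with
  | zero => simpa [desc] using hi
  | succ l ih =>
    rw [desc, map_mul, Equiv.Perm.mul_apply, toPerm_sig_val (by omega), ih (by omega),
      Equiv.swap_apply_left]
    rfl

theorem toPerm_desc_lt {a l : ℕ} (h : a + l ≤ n) (i : Fin (n + 1)) (hi : (i : ℕ) < a) :
    (toPerm n (desc n a l) i : ℕ) = i := by
  induction l with
  | zero => simp [desc]
  | succ l ih =>
    rw [desc, map_mul, Equiv.Perm.mul_apply, toPerm_sig_val (by omega), ih (by omega),
      Equiv.swap_apply_of_ne_of_ne (by omega) (by omega)]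

theorem toPerm_desc_gt {a l : ℕ} (h : a + l ≤ n) (i : Fin (n + 1)) (hi : a + l < (i : ℕ)) :
    (toPerm n (desc n a l) i : ℕ) = i := by
  induction l with
  | zero => simp [desc]
  | succ l ih =>
    rw [desc, map_mul, Equiv.Perm.mul_apply, toPerm_sig_val (by omega), ih (by omega) (by omega),
      Equiv.swap_apply_of_ne_of_ne (by omega) (by omega)]

theorem artin_eq_conjSq (i j : Fin (n + 1)) (h : i < j) :
    artin i j h = conjSq (desc n (i + 1) (j - (i + 1))) ⟨i, by omega⟩ := by
  apply Subtype.ext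
  change word (between i j) * sigma ⟨i, _⟩ ^ 2 * (word (between i j))⁻¹ = _
  rw [word_between]
  rfl

end BraidGroup

/-! ### Injectivity of the map ι. -/

namespace PureBraid

/-- The homomorphism from the free group that sends the generators to the braids `A_{k,n+1}`. -/
def lastStrandGroup (n : ℕ) : FreeGroup (Fin n) →* PureBraid n :=
  FreeGroup.lift fun k => artin k.castSucc (Fin.last n) (Fin.castSucc_lt_last k)

theorem lastStrand_of {n : ℕ} (k : Fin n) : lastStrand n (FreeLieAlgebra.of ℤ k) =
    B k.castSucc (Fin.last n) (Fin.castSucc_lt_last k) := FreeLieAlgebra.lift_of_apply ..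

theorem lastStrandGroup_of {n : ℕ} (k : Fin n) : lastStrandGroup n (FreeGroup.of k) =
    artin k.castSucc (Fin.last n) (Fin.castSucc_lt_last k) := by
  rw [lastStrandGroup, FreeGroup.lift_apply_of]

theorem B_eq {n : ℕ} (i j : Fin (n + 1)) (h : i < j) :
    B i j h = Gr.mk 0 (artin i j h) (Gr.mem_Gam_zero _) := rfl

/-- The map factors through `gr_*` of the free group. Each `A_{k,n+1}` is a conjugated square
linking strand `k` to the last strand, so the last conjugating element provides the splitting
crossed homomorphism. -/
theorem lastStrand_injective (n : ℕ) : Function.Injective (lastStrand n) := by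
  have h : lastStrand n = (Gr.map (lastStrandGroup n)).comp (freeLieToGr (Fin n)) := by
    refine FreeLieAlgebra.int_hom_ext fun k => ?_
    rw [lastStrand_of, LieHom.comp_apply, freeLieToGr_of, Gr.map_mk, B_eq]
    exact Gr.mk_congr (G := PureBraid n) (i := 0) (j := 0) rfl (lastStrandGroup_of k).symm
      (Gr.mem_Gam_zero _) _
  rw [h]
  have hk : ∀ k : Fin n, toPerm n (desc n (k + 1) (n - (k + 1))) k.succ = Fin.last n := by
    intro k
    ext
    rw [toPerm_desc_start (by omega) _ (by simp), Fin.val_last]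
    omega
  have hk' : ∀ k : Fin n, toPerm n (desc n (k + 1) (n - (k + 1))) k.castSucc = k.castSucc := by
    intro k
    ext
    rw [toPerm_desc_lt (by omega) _ (by simp)]
  have hα : ∀ k : Fin n, lastStrandGroup n (FreeGroup.of k) =
      conjSq (desc n (k + 1) (n - (k + 1))) k := by
    intro k
    rw [lastStrandGroup_of, artin_eq_conjSq]
    rfl
  refine (Gr.map_injective_of_crossed (barAct_trivial (n := n)) barFraming_mul
    (lastStrandGroup n) (fun k => ?_) (fun k => ?_)).comp (freeLieToGr_injective (Fin n))
  · rw [hα, barAct_conjSq (hk k)]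
  · rw [hα, barFraming_conjSq (hk k) (hk' k)]

end PureBraid

/-! ### The conjugation action of the braid group on `gr_*` of the pure braid group -/

/-- Operators satisfying the relations of the symmetric group permute the iterates of a family of
elements that behave like the squares of Artin's generators. -/
structure CoxeterAction (M : Type*) (n : ℕ) where
  C : ℕ → M → M
  b : ℕ → M
  sq : ∀ k < n, ∀ x, C k (C k x) = x
  braid : ∀ k, k + 1 < n → ∀ x, C k (C (k + 1) (C k x)) = C (k + 1) (C k (C (k + 1) x))
  far : ∀ k l, k + 2 ≤ l → l < n → ∀ x, C k (C l x) = C l (C k x)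
  fix : ∀ k < n, C k (b k) = b k
  fix_far : ∀ k l, k < n → l < n → (k + 2 ≤ l ∨ l + 2 ≤ k) → C l (b k) = b k
  next : ∀ k, k + 1 < n → C k (C (k + 1) (b k)) = b (k + 1)

namespace CoxeterAction

variable {M : Type*} {n : ℕ} (S : CoxeterAction M n)

/-- The iterates `C_{i+l} ⋯ C_{i+1} b_i`. -/
def iter (i : ℕ) : ℕ → M
  | 0 => S.b i
  | l + 1 => S.C (i + l + 1) (iter i l)

theorem iter_left_far {i k : ℕ} (h : k + 1 < i) (l : ℕ) (hl : i + l < n) :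
    S.C k (S.iter i l) = S.iter i l := by
  induction l with
  | zero => exact S.fix_far i k (by omega) (by omega) (by omega)
  | succ l ih => rw [iter, S.far k _ (by omega) (by omega), ih (by omega)]

theorem iter_right_far {i k : ℕ} (hk : k < n) (l : ℕ) (hl : i + l + 1 < k) :
    S.C k (S.iter i l) = S.iter i l := by
  induction l with
  | zero => exact S.fix_far i k (by omega) (by omega) (by omega)
  | succ l ih => rw [iter, ← S.far _ k (by omega) (by omega), ih (by omega)]

/-- `C_k` passes through the far operators until it meets `C_{k+1} C_k`. There the braid relation
turns it into a `C_{k+1}` acting first, which fixes the shorter iterate. -/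
theorem iter_mid {i k l : ℕ} (hik : i < k) (hk : k < i + l) (hl : i + l < n) :
    S.C k (S.iter i l) = S.iter i l := by
  induction l with
  | zero => omega
  | succ l ih =>
    by_cases h : k < i + l
    · rw [iter, S.far k _ (by omega) (by omega), ih h (by omega)]
    · obtain rfl : k = i + l := by omega
      match l, hik, hl with
      | 0, h, _ => omega
      | m + 1, h, hl =>
        rw [iter, iter, ← add_assoc, S.braid (i + m + 1) (by omega),
          S.iter_right_far (k := i + m + 1 + 1) (by omega) m (by omega)]

theorem iter_start {i : ℕ} (l : ℕ) (hl : i + l + 1 < n) :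
    S.C i (S.iter i (l + 1)) = S.iter (i + 1) l := by
  induction l with
  | zero => exact S.next i (by omega)
  | succ l ih =>
    rw [iter, S.far i _ (by omega) (by omega), ih (by omega), iter]
    congr 1
    omega

theorem iter_before {i : ℕ} (l : ℕ) (hl : i + l + 1 < n) :
    S.C i (S.iter (i + 1) l) = S.iter i (l + 1) := by
  rw [← S.iter_start l hl, S.sq i (by omega)]

/-- The element attached to an unordered pair of indices. -/
def pair (i j : ℕ) : M := if i < j then S.iter i (j - (i + 1)) else S.iter j (i - (j + 1))

theorem pair_comm {i j : ℕ} (h : i ≠ j) : S.pair i j = S.pair j i := by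
  rw [pair, pair]
  rcases lt_or_gt_of_ne h with h | h
  · rw [if_pos h, if_neg (by omega)]
  · rw [if_neg (by omega), if_pos h]

theorem pair_succ (i l : ℕ) : S.pair i (i + l + 1) = S.iter i l := by
  rw [pair, if_pos (by omega)]
  congr 1
  omega

/-- The operators act on the iterates as adjacent transpositions act on pairs of indices. The cases
are the positions of `k` and `k + 1` relative to the two indices. -/
theorem C_pair {i j k : ℕ} (hij : i ≠ j) (hi : i ≤ n) (hj : j ≤ n) (hk : k < n) :
    S.C k (S.pair i j) = S.pair (Equiv.swap k (k + 1) i) (Equiv.swap k (k + 1) j) := by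
  wlog h : i < j generalizing i j
  · rw [S.pair_comm hij, this hij.symm hj hi (by omega), S.pair_comm]
    exact fun h => hij.symm ((Equiv.swap k (k + 1)).injective h)
  obtain ⟨l, rfl⟩ : ∃ l, j = i + l + 1 := ⟨j - (i + 1), by omega⟩
  rw [pair_succ]
  have sk := Equiv.swap_apply_left k (k + 1)
  have sk' := Equiv.swap_apply_right k (k + 1)
  have sne : ∀ {a}, a ≠ k → a ≠ k + 1 → Equiv.swap k (k + 1) a = a :=
    fun h h' => Equiv.swap_apply_of_ne_of_ne h h'
  rcases lt_trichotomy (k + 1) i with h1 | h1 | h1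
  · rw [sne (by omega) (by omega), sne (by omega) (by omega), pair_succ]
    exact S.iter_left_far h1 l (by omega)
  · subst h1
    rw [sk', sne (by omega) (by omega), show k + 1 + l + 1 = k + (l + 1) + 1 by omega, pair_succ]
    exact S.iter_before l (by omega)
  rcases lt_trichotomy k (i + l + 1) with h2 | h2 | h2
  · rcases (show i ≤ k by omega).lt_or_eq with h3 | h3
    · rw [sne (a := i) (by omega) (by omega)]
      rcases (show k ≤ i + l by omega).lt_or_eq with h4 | h4
      · rw [sne (by omega) (by omega), pair_succ]
        exact S.iter_mid h3 h4 (by omega)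
      · subst h4
        rw [sk']
        obtain ⟨m, rfl⟩ : ∃ m, l = m + 1 := ⟨l - 1, by omega⟩
        rw [iter, ← add_assoc, S.sq _ (by omega), pair_succ]
    · subst h3
      rw [sk]
      rcases Nat.eq_zero_or_pos l with h4 | h4
      · subst h4
        rw [add_zero, sk', S.pair_comm (by omega)]
        have := S.pair_succ i 0
        rw [add_zero] at this
        rw [this]
        exact S.fix i (by omega)
      · obtain ⟨m, rfl⟩ : ∃ m, l = m + 1 := ⟨l - 1, by omega⟩
        rw [sne (by omega) (by omega), S.iter_start m (by omega), ← pair_succ]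
        congr 1
        omega
  · subst h2
    rw [sne (by omega) (by omega), sk, show i + l + 1 + 1 = i + (l + 1) + 1 by omega, pair_succ]
    rfl
  · rw [sne (by omega) (by omega), sne (by omega) (by omega), pair_succ]
    exact S.iter_right_far hk l h2

end CoxeterAction

namespace BraidGroup

variable {n : ℕ}

theorem sigma_commute {i j : Fin n} (h : (i : ℕ) + 2 ≤ j) :
    Commute (sigma i : BraidGroup n) (sigma j) := by
  have : (PresentedGroup.mk {r | ArtinRel n r}) ⁅FreeGroup.of i, FreeGroup.of j⁆ = 1 :=
    PresentedGroup.one_of_mem (.far i j h)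
  rw [map_commutatorElement, commutatorElement_eq_one_iff_commute] at this
  exact this

theorem sigma_braid {i j : Fin n} (h : (i : ℕ) + 1 = j) :
    (sigma i : BraidGroup n) * sigma j * sigma i = sigma j * sigma i * sigma j := by
  have : (PresentedGroup.mk {r | ArtinRel n r}) (FreeGroup.of i * FreeGroup.of j * FreeGroup.of i *
        (FreeGroup.of j * FreeGroup.of i * FreeGroup.of j)⁻¹) = 1 :=
    PresentedGroup.one_of_mem (.braid i j h)
  rw [map_mul, map_inv, mul_inv_eq_one] at this
  exact this

theorem sig_commute {k l : ℕ} (h : k + 2 ≤ l) (hl : l < n) : Commute (sig n k) (sig n l) := by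
  rw [sig_of_lt hl, sig_of_lt (by omega)]
  exact sigma_commute h

theorem sig_braid {k : ℕ} (h : k + 1 < n) :
    sig n k * sig n (k + 1) * sig n k = sig n (k + 1) * sig n k * sig n (k + 1) := by
  rw [sig_of_lt h, sig_of_lt (by omega)]
  exact sigma_braid rfl

instance (n : ℕ) : (pureSubgroup n).Normal := MonoidHom.normal_ker (toPerm n)

/-- Conjugation by a braid, as an endomorphism of the pure braid group. -/
def conjHom (g : BraidGroup n) : PureBraid n →* PureBraid n :=
  (MulAut.conjNormal (H := pureSubgroup n) g).toMonoidHom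

theorem coe_conjHom (g : BraidGroup n) (p : PureBraid n) :
    (conjHom g p : BraidGroup n) = g * p * g⁻¹ := rfl

/-- The action of the braid group on `gr_*` of the pure braid group by conjugation. -/
noncomputable def conjGr (g : BraidGroup n) : Gr (PureBraid n) →ₗ⁅ℤ⁆ Gr (PureBraid n) :=
  Gr.map (conjHom g)

theorem conjGr_mul (g h : BraidGroup n) (a : Gr (PureBraid n)) :
    conjGr (g * h) a = conjGr g (conjGr h a) := by
  rw [conjGr, conjGr, conjGr, Gr.map_map]
  congr 2
  ext p
  simp [coe_conjHom, mul_assoc]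

/-- Inner automorphisms act trivially on `gr_*`, so conjugation by braids only depends on the
underlying permutation. -/
theorem conjGr_of_mem {g : BraidGroup n} (hg : g ∈ pureSubgroup n) (a : Gr (PureBraid n)) :
    conjGr g a = a := by
  induction a using Gr.induction with
  | h0 => rw [map_zero]
  | hadd x y hx hy => rw [map_add, hx, hy]
  | hmk i x hx =>
    rw [conjGr, Gr.map_mk]
    exact Gr.mk_conj (⟨g, hg⟩ : PureBraid n) hx (LCSLie.conj_mem _ hx)

theorem conjGr_one (a : Gr (PureBraid n)) : conjGr (1 : BraidGroup n) a = a :=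
  conjGr_of_mem (one_mem _) a

/-- The class of the pure braid `g σ_k² g⁻¹` in `gr_1`. -/
noncomputable def sqClass (g : BraidGroup n) (k : Fin n) : Gr (PureBraid n) :=
  Gr.mk 0 (conjSq g k) (Gr.mem_Gam_zero _)

theorem conjGr_sqClass (g h : BraidGroup n) (k : Fin n) :
    conjGr g (sqClass h k) = sqClass (g * h) k := by
  rw [sqClass, conjGr, Gr.map_mk, sqClass]
  refine Gr.mk_congr rfl ?_ _ _
  apply Subtype.ext
  rw [coe_conjHom, conjSq, conjSq]
  group

theorem sqClass_congr {g h : BraidGroup n} {k l : Fin n}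
    (e : g * sigma k ^ 2 * g⁻¹ = h * sigma l ^ 2 * h⁻¹) : sqClass g k = sqClass h l :=
  Gr.mk_congr rfl (Subtype.ext e) _ _

/-- The class of `σ_k²`, or zero if `k` is out of range. -/
noncomputable def sqClassNat (n k : ℕ) : Gr (PureBraid n) :=
  if h : k < n then sqClass 1 ⟨k, h⟩ else 0

theorem sqClassNat_of_lt {k : ℕ} (h : k < n) : sqClassNat n k = sqClass 1 ⟨k, h⟩ := dif_pos h

/-- The action of the braid group on the classes of the squares of the generators. -/
noncomputable def gradedAction (n : ℕ) : CoxeterAction (Gr (PureBraid n)) n where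
  C k := conjGr (sig n k)
  b := sqClassNat n
  sq k hk x := by
    rw [← conjGr_mul]
    refine conjGr_of_mem ?_ x
    rw [sig_of_lt hk, ← pow_two]
    exact sigma_sq_mem _
  braid k hk x := by
    rw [← conjGr_mul, ← conjGr_mul, ← conjGr_mul, ← conjGr_mul, sig_braid hk]
  far k l h hl x := by rw [← conjGr_mul, ← conjGr_mul, (sig_commute h hl).eq]
  fix k hk := by
    rw [sqClassNat_of_lt hk, conjGr_sqClass, sig_of_lt hk]
    exact sqClass_congr (by group)
  fix_far k l hk hl h := by
    rw [sqClassNat_of_lt hk, conjGr_sqClass]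
    refine sqClass_congr ?_
    have hc : Commute (sig n l) (sigma ⟨k, hk⟩) := by
      rw [← sig_of_lt hk]
      rcases h with h | h
      · exact (sig_commute h hl).symm
      · exact sig_commute h hk
    rw [mul_one, (hc.pow_right 2).eq]
    group
  next k hk := by
    rw [sqClassNat_of_lt hk, sqClassNat_of_lt (show k < n by omega), conjGr_sqClass,
      conjGr_sqClass]
    refine sqClass_congr ?_
    have h := sig_braid hk
    rw [← sig_of_lt hk, ← sig_of_lt (show k < n by omega)]
    -- The braid relation used twice moves the square from `σ_k` to `σ_{k+1}` across `σ_k σ_{k+1}`.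
    have e : sig n k * sig n (k + 1) * sig n k ^ 2 =
        sig n (k + 1) ^ 2 * (sig n k * sig n (k + 1)) := by
      rw [pow_two, ← mul_assoc, h, mul_assoc (sig n (k + 1) * sig n k), ]
      have h2 : sig n (k + 1) * sig n k * (sig n (k + 1) * sig n k) =
        sig n (k + 1) * (sig n k * sig n (k + 1) * sig n k) := by group
      rw [h2, h, pow_two]
      group
    rw [mul_one, e]
    group

end BraidGroup

namespace PureBraid

variable {n : ℕ}

/-- The class `B_{i,j}` for an unordered pair of distinct strands. -/
noncomputable def Bs (i j : Fin (n + 1)) : Gr (PureBraid n) := (gradedAction n).pair i j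

theorem Bs_comm {i j : Fin (n + 1)} (h : i ≠ j) : Bs i j = Bs j i :=
  (gradedAction n).pair_comm fun e => h (Fin.ext e)

theorem iter_gradedAction (i l : ℕ) (h : i + l < n) : (gradedAction n).iter i l =
    sqClass (desc n (i + 1) l) ⟨i, by omega⟩ := by
  induction l with
  | zero => exact sqClassNat_of_lt _
  | succ l ih =>
    rw [CoxeterAction.iter, ih (by omega)]
    change conjGr (sig n _) _ = _
    rw [conjGr_sqClass, desc, add_right_comm]

theorem B_eq_Bs (i j : Fin (n + 1)) (h : i < j) : B i j h = Bs i j := by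
  have h' : (i : ℕ) < j := h
  rw [Bs, CoxeterAction.pair, if_pos h', iter_gradedAction _ _ (by omega), B_eq, sqClass]
  exact Gr.mk_congr (G := PureBraid n) rfl (artin_eq_conjSq i j h) _ _

theorem conjGr_Bs (g : BraidGroup n) {i j : Fin (n + 1)} (hij : i ≠ j) :
    conjGr g (Bs i j) = Bs (toPerm n g i) (toPerm n g j) := by
  induction g using induction_on_sigma generalizing i j with
  | one => rw [conjGr_one, map_one, Equiv.Perm.one_apply, Equiv.Perm.one_apply]
  | gen k =>
    have h := (gradedAction n).C_pair (i := i) (j := j) (k := k) (fun e => hij (Fin.ext e))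
      (by omega) (by omega) k.2
    rw [← toPerm_sig_val k.2, ← toPerm_sig_val k.2] at h
    change conjGr (sig n k) _ = _ at h
    rw [sig_of_lt k.2] at h
    exact h
  | mul g h hg hh =>
    rw [conjGr_mul, hh hij, hg fun e => hij ((toPerm n h).injective e), map_mul,
      Equiv.Perm.mul_apply, Equiv.Perm.mul_apply]
  | inv g hg =>
    have h : toPerm n g⁻¹ i ≠ toPerm n g⁻¹ j := fun e => hij ((toPerm n g⁻¹).injective e)
    have e : ∀ i, toPerm n g (toPerm n g⁻¹ i) = i := fun i => by
      rw [← Equiv.Perm.mul_apply, ← map_mul, mul_inv_cancel, map_one, Equiv.Perm.one_apply]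
    have h2 := congrArg (conjGr g⁻¹) (hg h)
    rw [← conjGr_mul, inv_mul_cancel, conjGr_one, e, e] at h2
    exact h2.symm

/-- The class of `g σ_k² g⁻¹` is determined by the two strands that it links. -/
theorem sqClass_eq_Bs (g : BraidGroup n) (k : Fin n) :
    sqClass g k = Bs (toPerm n g k.castSucc) (toPerm n g k.succ) := by
  rw [← conjGr_Bs g (fin_castSucc_ne_succ k)]
  have : Bs k.castSucc k.succ = sqClass 1 k := by
    rw [Bs, Fin.val_castSucc, Fin.val_succ]
    exact ((gradedAction n).pair_succ k 0).trans (iter_gradedAction _ _ (by simp))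
  rw [this, conjGr_sqClass, mul_one]

end PureBraid

/-! ### Generation of the pure braid group by conjugates of squares -/

namespace BraidGroup

variable {n : ℕ}

/-- The normal subgroup generated by the squares of the generators. -/
def squares (n : ℕ) : Subgroup (BraidGroup n) :=
  Subgroup.normalClosure (Set.range fun k : Fin n => sigma k ^ 2)

instance (n : ℕ) : (squares n).Normal := Subgroup.normalClosure_normal

theorem squares_le : squares n ≤ pureSubgroup n :=
  Subgroup.normalClosure_le_normal (by rintro _ ⟨k, rfl⟩; exact sigma_sq_mem k)

/-- The image of an element of the braid group in the quotient by the squares. -/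
def quotMk (n : ℕ) : BraidGroup n →* BraidGroup n ⧸ squares n := QuotientGroup.mk' (squares n)

theorem quot_sig_sq (k : ℕ) : quotMk n (sig n k) * quotMk n (sig n k) = 1 := by
  by_cases hk : k < n
  · rw [← map_mul, ← pow_two, sig_of_lt hk]
    exact (QuotientGroup.eq_one_iff _).2 (Subgroup.subset_normalClosure ⟨_, rfl⟩)
  · rw [sig, dif_neg hk, map_one, mul_one]

theorem desc_mul_before (a l : ℕ) : desc n (a + 1) l * sig n a = desc n a (l + 1) := by
  induction l with
  | zero => simp [desc]
  | succ l ih =>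
    rw [desc, mul_assoc, ih]
    conv_rhs => rw [desc]
    rw [show a + 1 + l = a + (l + 1) by omega]

theorem desc_mul_far (a l k : ℕ) (hk : k + 1 < a) (hl : a + l ≤ n) :
    desc n a l * sig n k = sig n k * desc n a l := by
  induction l with
  | zero => simp [desc]
  | succ l ih =>
    rw [desc, mul_assoc, ih (by omega), ← mul_assoc, ← mul_assoc,
      (sig_commute (show k + 2 ≤ a + l by omega) (by omega)).eq]

theorem desc_mul_above (a l k : ℕ) (hl : a + l < k) (hk : k < n) :
    desc n a l * sig n k = sig n k * desc n a l := by
  induction l with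
  | zero => simp [desc]
  | succ l ih =>
    rw [desc, mul_assoc, ih (by omega), ← mul_assoc, ← mul_assoc,
      (sig_commute (show a + l + 2 ≤ k by omega) (by omega)).eq]

theorem desc_mul_mid (a l k : ℕ) (hak : a ≤ k) (hk : k + 1 < a + l) (hl : a + l ≤ n) :
    desc n a l * sig n (k + 1) = sig n k * desc n a l := by
  induction l with
  | zero => omega
  | succ l ih =>
    rcases (show k + 1 ≤ a + l by omega).lt_or_eq with h | h
    · rw [desc, mul_assoc, ih h (by omega), ← mul_assoc, ← mul_assoc,
        (sig_commute (show k + 2 ≤ a + l by omega) (by omega)).eq]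
    · obtain ⟨m, rfl⟩ : ∃ m, l = m + 1 := ⟨l - 1, by omega⟩
      obtain rfl : k = a + m := by omega
      rw [desc, desc, ← add_assoc, mul_assoc, mul_assoc, desc_mul_above a m _ (by omega) (by omega),
        ← mul_assoc, ← mul_assoc, ← sig_braid (by omega)]
      simp only [mul_assoc]

/-- The subgroup of the quotient generated by the first `m` generators. -/
def quotSub (n m : ℕ) : Subgroup (BraidGroup n ⧸ squares n) :=
  Subgroup.closure {x | ∃ k < m, quotMk n (sig n k) = x}

theorem sig_mem_quotSub {k m : ℕ} (h : k < m) : quotMk n (sig n k) ∈ quotSub n m :=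
  Subgroup.subset_closure ⟨k, h, rfl⟩

/-- The descending products `σ_m ⋯ σ_a` serve as representatives of the cosets of the symmetric
group on one strand fewer. Right multiplication by `σ_k` lengthens the product if `k + 1 = a` and
shortens it if `k = a`; otherwise it moves to the left as `σ_k` or `σ_{k-1}`. Generators are their
own inverses here. -/
theorem quotSub_normal_form {m : ℕ} (hm : m < n) {g : BraidGroup n ⧸ squares n}
    (hg : g ∈ quotSub n (m + 1)) :
    ∃ h ∈ quotSub n m, ∃ a l, a + l = m + 1 ∧ g = h * quotMk n (desc n a l) := by
  have step : ∀ g : BraidGroup n ⧸ squares n, ∀ k < m + 1,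
      (∃ h ∈ quotSub n m, ∃ a l, a + l = m + 1 ∧ g = h * quotMk n (desc n a l)) →
      ∃ h ∈ quotSub n m, ∃ a l, a + l = m + 1 ∧ g * quotMk n (sig n k) = h * quotMk n (desc n a l) := by
    rintro _ k hk ⟨h, hh, a, l, hal, rfl⟩
    rcases lt_trichotomy (k + 1) a with h1 | h1 | h1
    · refine ⟨h * quotMk n (sig n k), mul_mem hh (sig_mem_quotSub (by omega)), a, l, hal, ?_⟩
      rw [mul_assoc, ← map_mul, desc_mul_far a l k h1 (by omega), map_mul, mul_assoc]
    · subst h1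
      refine ⟨h, hh, k, l + 1, by omega, ?_⟩
      rw [mul_assoc, ← map_mul, desc_mul_before]
    · rcases (show a ≤ k by omega).lt_or_eq with h2 | h2
      · obtain ⟨k, rfl⟩ : ∃ k', k = k' + 1 := ⟨k - 1, by omega⟩
        refine ⟨h * quotMk n (sig n k), mul_mem hh (sig_mem_quotSub (by omega)), a, l, hal, ?_⟩
        rw [mul_assoc, ← map_mul, desc_mul_mid a l k (by omega) (by omega) (by omega), map_mul,
          mul_assoc]
      · subst h2
        obtain ⟨l, rfl⟩ : ∃ l', l = l' + 1 := ⟨l - 1, by omega⟩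
        refine ⟨h, hh, a + 1, l, by omega, ?_⟩
        rw [← desc_mul_before, map_mul, mul_assoc, mul_assoc, quot_sig_sq, mul_one]
  refine Subgroup.closure_induction_right (p := fun g _ => ∃ h ∈ quotSub n m, ∃ a l,
    a + l = m + 1 ∧ g = h * quotMk n (desc n a l)) ⟨1, one_mem _, m + 1, 0, rfl, ?_⟩ ?_ ?_ hg
  · rw [desc, map_one, mul_one]
  · rintro g _ _ ⟨k, hk, rfl⟩ ih
    exact step g k hk ih
  · rintro g _ _ ⟨k, hk, rfl⟩ ih
    rw [inv_eq_of_mul_eq_one_left (quot_sig_sq k)]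
    exact step g k hk ih

/-- The homomorphism to the symmetric group, on the quotient by the squares. -/
def quotPerm (n : ℕ) : BraidGroup n ⧸ squares n →* Equiv.Perm (Fin (n + 1)) :=
  QuotientGroup.lift (squares n) (toPerm n) squares_le

theorem quotPerm_mk (g : BraidGroup n) : quotPerm n (quotMk n g) = toPerm n g := rfl

theorem quotPerm_fix {m : ℕ} (hm : m ≤ n) {g : BraidGroup n ⧸ squares n} (hg : g ∈ quotSub n m)
    (i : Fin (n + 1)) (hi : m < (i : ℕ)) : quotPerm n g i = i := by
  have : quotSub n m ≤ (MulAction.stabilizer (Equiv.Perm (Fin (n + 1))) i).comap (quotPerm n) := by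
    rw [quotSub, Subgroup.closure_le]
    rintro _ ⟨k, hk, rfl⟩
    rw [SetLike.mem_coe, Subgroup.mem_comap, MulAction.mem_stabilizer_iff, quotPerm_mk,
      Equiv.Perm.smul_def]
    ext
    rw [toPerm_sig_val (by omega), Equiv.swap_apply_of_ne_of_ne (by omega) (by omega)]
  exact this hg

/-- In the normal form the descending product sends `a` to `m + 1` and the other factor fixes `m +
1`. A trivial permutation therefore forces `a = m + 1`, that is, an empty product, and the induction
descends. -/
theorem eq_one_of_quotPerm {m : ℕ} (hm : m ≤ n) {g : BraidGroup n ⧸ squares n}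
    (hg : g ∈ quotSub n m) (h1 : quotPerm n g = 1) : g = 1 := by
  induction m generalizing g with
  | zero =>
    have : {x : BraidGroup n ⧸ squares n | ∃ k < 0, quotMk n (sig n k) = x} = ∅ := by ext; simp
    rwa [quotSub, this, Subgroup.closure_empty, Subgroup.mem_bot] at hg
  | succ m ih =>
    obtain ⟨h, hh, a, l, hal, rfl⟩ := quotSub_normal_form (by omega) hg
    have e1 := DFunLike.congr_fun h1 (⟨a, by omega⟩ : Fin (n + 1))
    have e2 : toPerm n (desc n a l) ⟨a, by omega⟩ = ⟨m + 1, by omega⟩ := by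
      ext
      rw [toPerm_desc_start (a := a) (l := l) (by omega) _ rfl, hal]
    rw [map_mul, Equiv.Perm.mul_apply, quotPerm_mk, e2,
      quotPerm_fix (by omega) hh _ (by simp), Equiv.Perm.one_apply, Fin.mk.injEq] at e1
    obtain rfl : l = 0 := by omega
    rw [desc, map_one, mul_one] at h1 hg ⊢
    exact ih (by omega) hh h1

theorem quotMk_mem_quotSub (g : BraidGroup n) : quotMk n g ∈ quotSub n n := by
  induction g using induction_on_sigma with
  | one => rw [map_one]; exact one_mem _
  | gen i =>
    rw [← sig_of_lt i.2]
    exact sig_mem_quotSub i.2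
  | mul g h hg hh => rw [map_mul]; exact mul_mem hg hh
  | inv g hg => rw [map_inv]; exact inv_mem hg

theorem pureSubgroup_eq_squares (n : ℕ) : pureSubgroup n = squares n := by
  refine le_antisymm (fun g hg => ?_) squares_le
  exact (QuotientGroup.eq_one_iff g).1 (eq_one_of_quotPerm le_rfl (quotMk_mem_quotSub g) hg)

end BraidGroup

/-! ### Generators of `gr_*` of the pure braid group and the infinitesimal braid relations. -/

namespace BraidGroup

variable {n : ℕ}

theorem toPerm_surjective (n : ℕ) : Function.Surjective (toPerm n) := by
  rw [← MonoidHom.mrange_eq_top, ← top_le_iff, ← Equiv.Perm.mclosure_swap_castSucc_succ,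
    Submonoid.closure_le]
  rintro _ ⟨i, rfl⟩
  exact ⟨sigma i, toPerm_sigma i⟩

/-- Multiple transitivity of the symmetric group: a relation between the first few strands can be
transported to any distinct strands. -/
theorem exists_toPerm_eq {m : ℕ} (e f : Fin m ↪ Fin (n + 1)) :
    ∃ g : BraidGroup n, ∀ i, toPerm n g (e i) = f i := by
  obtain ⟨p, hp⟩ := (MulAction.isMultiplyPretransitive_iff (G := Equiv.Perm (Fin (n + 1)))).1
    (Equiv.Perm.isMultiplyPretransitive (Fin (n + 1)) m) e f
  obtain ⟨g, rfl⟩ := toPerm_surjective n p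
  exact ⟨g, fun i => DFunLike.congr_fun hp i⟩

theorem closure_conjSq (n : ℕ) :
    Subgroup.closure (Set.range fun x : BraidGroup n × Fin n => conjSq x.1 x.2) = ⊤ := by
  rw [← top_le_iff]
  rintro p -
  have hp : (p : BraidGroup n) ∈ squares n := pureSubgroup_eq_squares n ▸ p.2
  have hs : squares n ≤ (Subgroup.closure
      (Set.range fun x : BraidGroup n × Fin n => conjSq x.1 x.2)).map (pureSubgroup n).subtype := by
    rw [squares, Subgroup.normalClosure, Subgroup.closure_le]
    intro x hx
    obtain ⟨_, ⟨k, rfl⟩, hk⟩ := Group.mem_conjugatesOfSet_iff.1 hx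
    obtain ⟨g, rfl⟩ := isConj_iff.1 hk
    exact ⟨conjSq g k, Subgroup.subset_closure ⟨(g, k), rfl⟩, rfl⟩
  obtain ⟨q, hq, e⟩ := hs hp
  rwa [Subtype.ext (a1 := q) (a2 := p) e] at hq

end BraidGroup

namespace PureBraid

variable {n : ℕ}

/-- `gr_*` of the pure braid group is generated by the classes `B_{i,j}`. -/
theorem mem_of_Bs_mem (S : LieSubalgebra ℤ (Gr (PureBraid n))) (h : ∀ i j, i ≠ j → Bs i j ∈ S)
    (a : Gr (PureBraid n)) : a ∈ S := by
  refine Gr.mem_of_closure_eq_top (closure_conjSq n) S ?_ a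
  rintro _ ⟨⟨g, k⟩, rfl⟩
  change sqClass g k ∈ S
  rw [sqClass_eq_Bs]
  exact h _ _ fun e => fin_castSucc_ne_succ k ((toPerm n g).injective e)

/-- The first infinitesimal braid relation. -/
theorem Bs_lie_disjoint {i j k l : Fin (n + 1)} (hij : i ≠ j) (hik : i ≠ k) (hil : i ≠ l)
    (hjk : j ≠ k) (hjl : j ≠ l) (hkl : k ≠ l) : ⁅Bs i j, Bs k l⁆ = 0 := by
  let f : Fin 4 ↪ Fin (n + 1) := ⟨![i, j, k, l], by
    intro a b h
    fin_cases a <;> fin_cases b <;> simp_all⟩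
  have hn : 3 ≤ n := by
    have := Fintype.card_le_of_embedding f
    simpa using this
  obtain ⟨g, hg⟩ := exists_toPerm_eq (Fin.castLEEmb (show 4 ≤ n + 1 by omega)) f
  have h0 : toPerm n g 0 = i := hg 0
  have h1 : toPerm n g ⟨1, by omega⟩ = j := hg 1
  have h2 : toPerm n g ⟨2, by omega⟩ = k := hg 2
  have h3 : toPerm n g ⟨3, by omega⟩ = l := hg 3
  have e1 : sqClass g ⟨0, by omega⟩ = Bs i j := by rw [sqClass_eq_Bs, ← h0, ← h1]; rfl
  have e2 : sqClass g ⟨2, by omega⟩ = Bs k l := by rw [sqClass_eq_Bs, ← h2, ← h3]; rfl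
  rw [← e1, ← e2, sqClass, sqClass, Gr.mk_lie_mk]
  have hc : Commute (conjSq g ⟨0, by omega⟩) (conjSq g ⟨2, by omega⟩) := by
    apply Subtype.ext
    have := (sigma_commute (i := (⟨0, by omega⟩ : Fin n)) (j := ⟨2, by omega⟩) (by simp)).pow_pow 2 2
    exact ((Commute.conj_iff g).2 this).eq
  refine Gr.mk_eq_zero _ ?_
  rw [commutatorElement_eq_one_iff_commute.2 hc]
  exact one_mem _

/-- The second infinitesimal braid relation. -/
theorem Bs_lie_triple {i j k : Fin (n + 1)} (hij : i ≠ j) (hik : i ≠ k) (hjk : j ≠ k) :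
    ⁅Bs i j, Bs i k + Bs j k⁆ = 0 := by
  let f : Fin 3 ↪ Fin (n + 1) := ⟨![i, j, k], by
    intro a b h
    fin_cases a <;> fin_cases b <;> simp_all⟩
  have hn : 2 ≤ n := by
    have := Fintype.card_le_of_embedding f
    simpa using this
  obtain ⟨g, hg⟩ := exists_toPerm_eq (Fin.castLEEmb (show 3 ≤ n + 1 by omega)) f
  have h0 : toPerm n g 0 = i := hg 0
  have h1 : toPerm n g ⟨1, by omega⟩ = j := hg 1
  have h2 : toPerm n g ⟨2, by omega⟩ = k := hg 2
  set s0 : Fin n := ⟨0, by omega⟩ with hs0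
  set s1 : Fin n := ⟨1, by omega⟩ with hs1
  have e1 : sqClass g s0 = Bs i j := by rw [sqClass_eq_Bs, ← h0, ← h1]; rfl
  have e2 : sqClass (g * sigma s1) s0 = Bs i k := by
    rw [sqClass_eq_Bs, ← h0, ← h2, map_mul, Equiv.Perm.mul_apply, Equiv.Perm.mul_apply, toPerm_sigma,
      Equiv.swap_apply_of_ne_of_ne (by simp [hs0, hs1, Fin.ext_iff])
        (by simp [hs0, hs1, Fin.ext_iff])]
    have : (s0.succ : Fin (n + 1)) = s1.castSucc := rfl
    rw [this, Equiv.swap_apply_left]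
    rfl
  have e3 : sqClass g s1 = Bs j k := by rw [sqClass_eq_Bs, ← h1, ← h2]; rfl
  rw [← e1, ← e2, ← e3, sqClass, sqClass, sqClass, ← Gr.mk_mul, Gr.mk_lie_mk]
  have hb : (sigma s0 : BraidGroup n) * sigma s1 * sigma s0 = sigma s1 * sigma s0 * sigma s1 :=
    sigma_braid rfl
  have hc : Commute (conjSq g s0) (conjSq (g * sigma s1) s0 * conjSq g s1) := by
    apply Subtype.ext
    -- The braid `σ_1 σ_0² σ_1` is the product of a conjugated square linking strands 0 and 2 with
    -- `σ_1²`, which links 1 and 2. It commutes with `σ_0` by the braid relation, and this becomes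
    -- the triple relation.
    have h3 : Commute (sigma s0) (sigma s1 * sigma s0 * sigma s0 * sigma s1) := by
      change _ * _ = _ * _
      calc sigma s0 * (sigma s1 * sigma s0 * sigma s0 * sigma s1)
          = (sigma s0 * sigma s1 * sigma s0) * (sigma s0 * sigma s1) := by group
        _ = sigma s1 * sigma s0 * (sigma s1 * sigma s0 * sigma s1) := by rw [hb]; group
        _ = _ := by rw [← hb]; group
    have h4 := ((Commute.conj_iff g).2 (h3.pow_left 2)).eq
    have h5 : (conjSq (g * sigma s1) s0 * conjSq g s1 : BraidGroup n) =
        g * (sigma s1 * sigma s0 * sigma s0 * sigma s1) * g⁻¹ := by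
      change g * sigma s1 * sigma s0 ^ 2 * (g * sigma s1)⁻¹ * (g * sigma s1 ^ 2 * g⁻¹) = _
      rw [pow_two, pow_two]
      group
    simp only [Subgroup.coe_mul]
    rw [h5]
    exact h4
  refine Gr.mk_eq_zero _ ?_
  rw [commutatorElement_eq_one_iff_commute.2 hc]
  exact one_mem _

end PureBraid

/-! ### The adjoint action on the free Lie algebra of the last strand -/

namespace PureBraid

variable {n : ℕ}

theorem lastStrand_of' (k : Fin n) :
    lastStrand n (FreeLieAlgebra.of ℤ k) = Bs k.castSucc (Fin.last n) := by
  rw [lastStrand_of, B_eq_Bs]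

theorem fin_castSucc_ne_last (k : Fin n) : k.castSucc ≠ Fin.last n := (Fin.castSucc_lt_last k).ne

/-- The triple relation for `B_{a,n+1}` against `B_{a,b} + B_{b,n+1}` exchanges `[B_{a,b},
B_{a,n+1}]` for a bracket of two last-strand classes; disjoint pairs commute. -/
theorem Bs_lie_lastStrand {i j k : Fin n} (hij : i ≠ j) :
    ⁅Bs i.castSucc j.castSucc, lastStrand n (FreeLieAlgebra.of ℤ k)⁆ =
      lastStrand n (if k = i then ⁅FreeLieAlgebra.of ℤ i, FreeLieAlgebra.of ℤ j⁆
        else if k = j then ⁅FreeLieAlgebra.of ℤ j, FreeLieAlgebra.of ℤ i⁆ else 0) := by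
  have hc : ∀ {a b : Fin n}, a ≠ b → a.castSucc ≠ b.castSucc := fun h e =>
    h (Fin.castSucc_injective n e)
  have key : ∀ {a b : Fin n}, a ≠ b → ⁅Bs a.castSucc b.castSucc, Bs a.castSucc (Fin.last n)⁆ =
      ⁅Bs a.castSucc (Fin.last n), Bs b.castSucc (Fin.last n)⁆ := by
    intro a b h
    have := Bs_lie_triple (fin_castSucc_ne_last a) (hc h) (fin_castSucc_ne_last b).symm
    rw [lie_add, Bs_comm (fin_castSucc_ne_last b).symm] at this
    rw [← lie_skew, neg_eq_iff_add_eq_zero, this]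
  rw [lastStrand_of']
  split_ifs with h1 h2
  · subst h1
    rw [LieHom.map_lie, lastStrand_of', lastStrand_of', key hij]
  · subst h2
    rw [LieHom.map_lie, lastStrand_of', lastStrand_of', ← key hij.symm, Bs_comm (hc hij)]
  · rw [map_zero]
    exact Bs_lie_disjoint (hc hij) (hc (Ne.symm h1)) (fin_castSucc_ne_last _) (hc (Ne.symm h2))
      (fin_castSucc_ne_last _) (fin_castSucc_ne_last _)

theorem mem_normalizer_lastStrand {x : Gr (PureBraid n)}
    (h : ∀ k, ⁅x, lastStrand n (FreeLieAlgebra.of ℤ k)⁆ ∈ (lastStrand n).range) :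
    x ∈ (lastStrand n).range.normalizer := by
  rw [LieSubalgebra.mem_normalizer_iff]
  rintro _ ⟨w, rfl⟩
  change ⁅x, lastStrand n w⁆ ∈ (lastStrand n).range
  induction w using FreeLieAlgebra.induction with
  | of k => exact h k
  | zero => rw [map_zero, lie_zero]; exact zero_mem _
  | add a b ha hb => rw [map_add, lie_add]; exact add_mem ha hb
  | smul c a ha =>
    have h := zsmul_mem ha c
    rw [← lie_zsmul, ← map_zsmul] at h
    exact h
  | lie a b ha hb =>
    rw [LieHom.map_lie, leibniz_lie]
    exact add_mem ((lastStrand n).range.lie_mem ha ⟨b, rfl⟩)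
      ((lastStrand n).range.lie_mem ⟨a, rfl⟩ hb)

/-- The normalizer of the image of ι is a Lie subalgebra, so it suffices that it contains the
generators `B_{i,j}`: those of the last strand lie in the image itself, the others are covered by
the infinitesimal relations. -/
theorem lie_lastStrand_mem (x : Gr (PureBraid n)) (w : FreeLieAlgebra ℤ (Fin n)) :
    ⁅x, lastStrand n w⁆ ∈ (lastStrand n).range := by
  have hx : x ∈ (lastStrand n).range.normalizer := by
    refine mem_of_Bs_mem _ (fun i j hij => ?_) x
    have hl : ∀ k : Fin n, Bs k.castSucc (Fin.last n) ∈ (lastStrand n).range.normalizer :=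
      fun k => LieSubalgebra.le_normalizer _ ⟨_, lastStrand_of' k⟩
    induction i using Fin.lastCases with
    | last =>
      induction j using Fin.lastCases with
      | last => exact absurd rfl hij
      | cast j => rw [Bs_comm hij]; exact hl j
    | cast i =>
      induction j using Fin.lastCases with
      | last => exact hl i
      | cast j =>
        refine mem_normalizer_lastStrand fun k => ?_
        rw [Bs_lie_lastStrand fun e => hij (congrArg _ e)]
        exact ⟨_, rfl⟩
  exact (LieSubalgebra.mem_normalizer_iff _ x).1 hx _ ⟨w, rfl⟩

/-- Since the image of ι is an ideal, bracketing lifts through ι. Each axiom of a derivation or of a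
Lie morphism is checked after applying the injection ι, where it is an identity in `gr_*`. -/
theorem exists_isAd (n : ℕ) : ∃ Ad, IsAd n Ad := by
  have hι := lastStrand_injective n
  choose A hA using fun (x : Gr (PureBraid n)) (w : FreeLieAlgebra ℤ (Fin n)) =>
    lie_lastStrand_mem x w
  change ∀ x w, lastStrand n (A x w) = _ at hA
  let D : Gr (PureBraid n) → LieDerivation ℤ (FreeLieAlgebra ℤ (Fin n))
      (FreeLieAlgebra ℤ (Fin n)) := fun x =>
    { toFun := A x
      map_add' := fun a b => hι (by rw [map_add, hA, hA, hA, map_add, lie_add])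
      map_smul' := fun c a => hι (by
        rw [hA, map_zsmul, lie_zsmul, RingHom.id_apply, map_zsmul, hA])
      leibniz' := fun a b => hι (by
        change lastStrand n (A x ⁅a, b⁆) = lastStrand n (⁅a, A x b⁆ - ⁅b, A x a⁆)
        rw [hA, map_sub, LieHom.map_lie, LieHom.map_lie, LieHom.map_lie, hA, hA, leibniz_lie,
          ← lie_skew (lastStrand n b), sub_neg_eq_add, add_comm]) }
  have hD : ∀ x w, D x w = A x w := fun x w => rfl
  refine ⟨{ toFun := D, map_add' := ?_, map_smul' := ?_, map_lie' := ?_ }, hA⟩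
  · intro x y
    ext w
    refine hι ?_
    rw [LieDerivation.add_apply, hD, hD, hD, map_add, hA, hA, hA, add_lie]
  · intro c x
    ext w
    refine hι ?_
    rw [RingHom.id_apply, LieDerivation.smul_apply, hD, hD, map_zsmul, hA, hA, zsmul_lie]
  · intro x y
    ext w
    refine hι ?_
    change lastStrand n (D ⁅x, y⁆ w) = lastStrand n (⁅D x, D y⁆ w)
    rw [LieDerivation.lie_apply, hD, hD, hD, hD, hD, map_sub, hA, hA, hA, hA, hA, lie_lie]

theorem existsUnique_isAd (n : ℕ) : ∃! Ad, IsAd n Ad := by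
  obtain ⟨Ad, h⟩ := exists_isAd n
  refine ⟨Ad, h, fun Ad' h' => ?_⟩
  ext x w
  exact lastStrand_injective n ((h' x w).trans (h x w).symm)

section

variable {Ad : Gr (PureBraid n) →ₗ⁅ℤ⁆
    LieDerivation ℤ (FreeLieAlgebra ℤ (Fin n)) (FreeLieAlgebra ℤ (Fin n))}

theorem IsAd.apply_last (h : IsAd n Ad) (i : Fin n) (w : FreeLieAlgebra ℤ (Fin n)) :
    Ad (Bs i.castSucc (Fin.last n)) w = ⁅FreeLieAlgebra.of ℤ i, w⁆ := by
  refine lastStrand_injective n ?_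
  rw [h, LieHom.map_lie, lastStrand_of']

theorem IsAd.apply_of (h : IsAd n Ad) {i j : Fin n} (hij : i ≠ j) (k : Fin n) :
    Ad (Bs i.castSucc j.castSucc) (FreeLieAlgebra.of ℤ k) =
      if k = i then ⁅FreeLieAlgebra.of ℤ i, FreeLieAlgebra.of ℤ j⁆
        else if k = j then ⁅FreeLieAlgebra.of ℤ j, FreeLieAlgebra.of ℤ i⁆ else 0 := by
  refine lastStrand_injective n ?_
  rw [h, Bs_lie_lastStrand hij]

end

end PureBraid

/-! ### Derivations of the free associative algebra -/

namespace FreeAlgebra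

section

variable {R : Type*} [CommRing R] {X : Type*}

/-- The algebra homomorphism `a ↦ (a, D a)` to the dual numbers, for the derivation `D` with
prescribed values on the letters. -/
noncomputable def derHom (f : X → FreeAlgebra R X) :
    FreeAlgebra R X →ₐ[R] TrivSqZeroExt (FreeAlgebra R X) (FreeAlgebra R X) :=
  lift R fun x => TrivSqZeroExt.inl (ι R x) + TrivSqZeroExt.inr (f x)

theorem fst_derHom (f : X → FreeAlgebra R X) (a : FreeAlgebra R X) : (derHom f a).fst = a := by
  have : (TrivSqZeroExt.fstHom R (FreeAlgebra R X) (FreeAlgebra R X)).comp (derHom f) =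
      AlgHom.id R _ := by
    ext x
    simp [derHom]
  exact DFunLike.congr_fun this a

/-- The derivation of the free associative algebra with prescribed values on the letters. -/
noncomputable def der (f : X → FreeAlgebra R X) : FreeAlgebra R X →ₗ[R] FreeAlgebra R X where
  toFun a := (derHom f a).snd
  map_add' a b := by rw [map_add, TrivSqZeroExt.snd_add]
  map_smul' r a := by rw [map_smul, TrivSqZeroExt.snd_smul, RingHom.id_apply]

theorem der_ι (f : X → FreeAlgebra R X) (x : X) : der f (ι R x) = f x := by
  simp [der, derHom]

theorem der_mul (f : X → FreeAlgebra R X) (a b : FreeAlgebra R X) :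
    der f (a * b) = der f a * b + a * der f b := by
  change (derHom f (a * b)).snd = _
  rw [map_mul, TrivSqZeroExt.snd_mul, fst_derHom, fst_derHom, add_comm]
  rfl

theorem der_one (f : X → FreeAlgebra R X) : der f 1 = 0 := by
  have h := der_mul f 1 1
  rw [mul_one, mul_one, one_mul] at h
  exact left_eq_add.1 h

theorem mem_span_wd_of_wcoeff {S : Set (List X)} {a : FreeAlgebra R X}
    (h : ∀ l ∉ S, wcoeff l a = 0) : a ∈ Submodule.span R (wd R '' S) := by
  have e : wd R '' S = basisFreeMonoid R X '' (FreeMonoid.ofList '' S) := by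
    rw [Set.image_image]
    exact Set.image_congr fun l _ => (basisFreeMonoid_eq_wd l).symm
  rw [e, Module.Basis.mem_span_image]
  intro l hl
  refine ⟨l.toList, ?_, rfl⟩
  by_contra hn
  exact (Finsupp.mem_support_iff.1 hl) (h _ hn)

theorem wd_mem_span {S : Set (List X)} {l : List X} (h : l ∈ S) :
    wd R l ∈ Submodule.span R (wd R '' S) := Submodule.subset_span ⟨l, h, rfl⟩

theorem span_wd_mono {S S' : Set (List X)} (h : ∀ l ∈ S, l ∈ S') {a : FreeAlgebra R X}
    (ha : a ∈ Submodule.span R (wd R '' S)) : a ∈ Submodule.span R (wd R '' S') :=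
  Submodule.span_mono (Set.image_mono h) ha

theorem mem_of_mem_span_wd {S : Set (List X)} {M : Submodule R (FreeAlgebra R X)}
    (h : ∀ l ∈ S, wd R l ∈ M) {a : FreeAlgebra R X}
    (ha : a ∈ Submodule.span R (wd R '' S)) : a ∈ M := by
  refine Submodule.span_le.2 ?_ ha
  rintro _ ⟨l, hl, rfl⟩
  exact h l hl

end

end FreeAlgebra

/-! ### The cabling operators modulo two -/

namespace Cabling

open FreeAlgebra

variable {X : Type*}

/-- The elements of degree at most `d`. -/
def fil (X : Type*) (d : ℕ) : Submodule (ZMod 2) (FreeAlgebra (ZMod 2) X) :=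
  Submodule.span (ZMod 2) (wd (ZMod 2) '' {l | l.length ≤ d})

theorem ι_mul_mem_fil (p : X) {d : ℕ} {a : FreeAlgebra (ZMod 2) X} (ha : a ∈ fil X d) :
    ι (ZMod 2) p * a ∈ fil X (d + 1) := by
  rw [← wd_singleton]
  refine mul_mem_span_wd (wd_mem_span (Set.mem_singleton [p])) ha ?_
  rintro _ rfl v hv
  exact Nat.succ_le_succ hv

theorem fil_mono {d d' : ℕ} (h : d ≤ d') : fil X d ≤ fil X d' :=
  fun _ => span_wd_mono fun _ hl => le_trans hl h

variable [LinearOrder X] [OrderTop X]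

instance (X : Type*) : CharP (FreeAlgebra (ZMod 2) X) 2 :=
  charP_of_injective_algebraMap
    (FaithfulSMul.algebraMap_injective (ZMod 2) (FreeAlgebra (ZMod 2) X)) 2

/-- The derivation that sends the letter `k` to the commutator of `⊤` with `k ⊓ p`. -/
noncomputable def shift (p : X) : FreeAlgebra (ZMod 2) X →ₗ[ZMod 2] FreeAlgebra (ZMod 2) X :=
  der fun k => ι (ZMod 2) ⊤ * ι (ZMod 2) (k ⊓ p) + ι (ZMod 2) (k ⊓ p) * ι (ZMod 2) ⊤

theorem shift_ι (p k : X) :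
    shift p (ι (ZMod 2) k) = ι (ZMod 2) ⊤ * ι (ZMod 2) (k ⊓ p) + ι (ZMod 2) (k ⊓ p) * ι (ZMod 2) ⊤ :=
  der_ι _ _

theorem shift_mul (p : X) (a b : FreeAlgebra (ZMod 2) X) :
    shift p (a * b) = shift p a * b + a * shift p b := der_mul _ _ _

/-- The action of the free associative algebra on itself in which the letter `p` acts by
`x ↦ shift p x + x * p`. -/
noncomputable def omega :
    FreeAlgebra (ZMod 2) X →ₐ[ZMod 2] Module.End (ZMod 2) (FreeAlgebra (ZMod 2) X) :=
  lift (ZMod 2) fun p => shift p + LinearMap.mulRight (ZMod 2) (ι (ZMod 2) p)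

theorem omega_ι (p : X) (a : FreeAlgebra (ZMod 2) X) :
    omega (ι (ZMod 2) p) a = shift p a + a * ι (ZMod 2) p := by
  rw [omega, lift_ι_apply]
  rfl

theorem omega_ι_mul (p : X) (a b : FreeAlgebra (ZMod 2) X) :
    omega (ι (ZMod 2) p) (a * b) = shift p a * b + a * omega (ι (ZMod 2) p) b := by
  rw [omega_ι, omega_ι, shift_mul]
  noncomm_ring

/-- For a letter `p`, the shift of `⊤` contributes `⊤p + p⊤` and right multiplication contributes
another `⊤p`; the two copies of `⊤p` cancel in characteristic 2. -/
theorem omega_mul_top (r a : FreeAlgebra (ZMod 2) X) :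
    omega r (a * ι (ZMod 2) ⊤) = omega r a * ι (ZMod 2) ⊤ := by
  induction r using FreeAlgebra.induction generalizing a with
  | grade0 c => rw [AlgHom.commutes]; simp
  | grade1 p =>
    rw [omega_ι_mul, omega_ι, omega_ι, shift_ι, top_inf_eq, add_mul, mul_assoc a,
      add_comm (ι (ZMod 2) ⊤ * ι (ZMod 2) p), add_assoc (ι (ZMod 2) p * ι (ZMod 2) ⊤),
      CharTwo.add_self_eq_zero, add_zero]
  | mul r s hr hs => rw [map_mul omega, Module.End.mul_apply, Module.End.mul_apply, hs, hr]
  | add r s hr hs => rw [map_add, LinearMap.add_apply, LinearMap.add_apply, hr, hs, add_mul]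

/-- The derivation for `p = ⊤` is the commutator with `⊤`; adding right multiplication by `⊤`
cancels one half of it in characteristic 2. -/
theorem omega_top (a : FreeAlgebra (ZMod 2) X) : omega (ι (ZMod 2) ⊤) a = ι (ZMod 2) ⊤ * a := by
  have h : shift (⊤ : X) =
      LinearMap.mulLeft (ZMod 2) (ι (ZMod 2) ⊤) + LinearMap.mulRight (ZMod 2) (ι (ZMod 2) ⊤) := by
    refine linearMap_ext_wd fun l => ?_
    rw [LinearMap.add_apply, LinearMap.mulLeft_apply, LinearMap.mulRight_apply]
    induction l with
    | nil => rw [wd_nil, mul_one, one_mul, CharTwo.add_self_eq_zero]; exact der_one _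
    | cons x l ih =>
      rw [wd_cons, shift_mul, ih, shift_ι, inf_top_eq, add_mul, mul_add, mul_assoc, mul_assoc,
        mul_assoc, add_assoc, ← add_assoc (ι (ZMod 2) x * (ι (ZMod 2) ⊤ * wd (ZMod 2) l)),
        CharTwo.add_self_eq_zero,
        zero_add]
  rw [omega_ι, h, LinearMap.add_apply, LinearMap.mulLeft_apply, LinearMap.mulRight_apply,
    add_assoc, CharTwo.add_self_eq_zero, add_zero]

/-- The orbit map of `1` for the action `omega`. -/
noncomputable def psi : FreeAlgebra (ZMod 2) X →ₗ[ZMod 2] FreeAlgebra (ZMod 2) X :=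
  LinearMap.applyₗ 1 ∘ₗ (omega (X := X)).toLinearMap

theorem psi_apply (r : FreeAlgebra (ZMod 2) X) : psi r = omega r 1 := rfl

theorem psi_mul (r s : FreeAlgebra (ZMod 2) X) : psi (r * s) = omega r (psi s) := by
  rw [psi_apply, map_mul omega, Module.End.mul_apply, psi_apply]

theorem psi_one : psi (1 : FreeAlgebra (ZMod 2) X) = 1 := by rw [psi_apply, map_one omega, Module.End.one_apply]

/-- The words of length `d` that contain the letter `⊤` at least `c` times. -/
def topWords (X : Type*) [LinearOrder X] [OrderTop X] (d c : ℕ) : Set (List X) :=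
  {l | l.length = d ∧ c ≤ l.count ⊤}

theorem append_mem_topWords {d c d' c' : ℕ} {u v : List X} (hu : u ∈ topWords X d c)
    (hv : v ∈ topWords X d' c') : u ++ v ∈ topWords X (d + d') (c + c') :=
  ⟨by rw [List.length_append, hu.1, hv.1], by
    rw [List.count_append]; exact add_le_add hu.2 hv.2⟩

theorem shift_ι_mem (p k : X) :
    shift p (ι (ZMod 2) k) ∈ Submodule.span (ZMod 2) (wd (ZMod 2) '' topWords X 2 1) := by
  rw [shift_ι, ← wd_singleton, ← wd_singleton, ← wd_append, ← wd_append]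
  refine add_mem (wd_mem_span ⟨rfl, ?_⟩) (wd_mem_span ⟨rfl, ?_⟩) <;>
  exact List.one_le_count_iff.2 (by simp)

/-- One letter is replaced by two, at least one of them `⊤`. The number of `⊤` thus never drops,
even when the replaced letter was `⊤`. -/
theorem shift_wd_mem (p : X) (l : List X) : shift p (wd (ZMod 2) l) ∈
    Submodule.span (ZMod 2) (wd (ZMod 2) '' topWords X (l.length + 1) (l.count ⊤)) := by
  induction l with
  | nil => rw [wd_nil, shift, der_one]; exact zero_mem _
  | cons x l ih =>
    rw [wd_cons, shift_mul]
    refine add_mem ?_ ?_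
    · refine mul_mem_span_wd (shift_ι_mem p x)
        (wd_mem_span (S := topWords X l.length (l.count ⊤)) ⟨rfl, le_rfl⟩) fun u hu v hv => ?_
      obtain ⟨h1, h2⟩ := append_mem_topWords hu hv
      refine ⟨by rw [h1, List.length_cons]; omega, le_trans ?_ h2⟩
      rw [List.count_cons]
      split_ifs <;> omega
    · rw [← wd_singleton]
      refine mul_mem_span_wd (wd_mem_span (S := topWords X 1 ([x].count ⊤)) ⟨rfl, le_rfl⟩) ih
        fun u hu v hv => ?_
      obtain ⟨h1, h2⟩ := append_mem_topWords hu hv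
      refine ⟨by rw [h1, List.length_cons]; omega, le_trans ?_ h2⟩
      rw [← List.count_append, List.singleton_append]

theorem shift_wd_mem_of_notMem (p : X) {l : List X} (hl : ⊤ ∉ l) : shift p (wd (ZMod 2) l) ∈
    Submodule.span (ZMod 2) (wd (ZMod 2) '' topWords X (l.length + 1) 1) := by
  induction l with
  | nil => rw [wd_nil, shift, der_one]; exact zero_mem _
  | cons x l ih =>
    rw [List.mem_cons, not_or] at hl
    rw [wd_cons, shift_mul]
    refine add_mem ?_ ?_
    · refine mul_mem_span_wd (shift_ι_mem p x)
        (wd_mem_span (S := topWords X l.length 0) ⟨rfl, Nat.zero_le _⟩) fun u hu v hv => ?_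
      obtain ⟨h1, h2⟩ := append_mem_topWords hu hv
      exact ⟨by rw [h1, List.length_cons]; omega, h2⟩
    · rw [← wd_singleton]
      refine mul_mem_span_wd (wd_mem_span (S := topWords X 1 0) ⟨rfl, Nat.zero_le _⟩) (ih hl.2)
        fun u hu v hv => ?_
      obtain ⟨h1, h2⟩ := append_mem_topWords hu hv
      exact ⟨by rw [h1, List.length_cons]; omega, by rwa [zero_add] at h2⟩

theorem omega_wd_mem (p : X) (l : List X) : omega (ι (ZMod 2) p) (wd (ZMod 2) l) ∈
    Submodule.span (ZMod 2) (wd (ZMod 2) '' topWords X (l.length + 1) (l.count ⊤)) := by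
  rw [omega_ι]
  refine add_mem (shift_wd_mem p l) ?_
  rw [← wd_singleton, ← wd_append]
  exact wd_mem_span ⟨by simp, by rw [List.count_append]; omega⟩

theorem omega_ι_mem_map (p : X) {d : ℕ} {a : FreeAlgebra (ZMod 2) X} (ha : a ∈ (fil X d).map psi) :
    omega (ι (ZMod 2) p) a ∈ (fil X (d + 1)).map psi := by
  obtain ⟨r, hr, rfl⟩ := ha
  exact ⟨ι (ZMod 2) p * r, ι_mul_mem_fil p hr, psi_mul _ _⟩

/-- Induction on the prefix before the first `⊤`. If it is empty, `ω_⊤` produces the word from a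
shorter one. Otherwise `ω_p (C⊤Y) = shift_p(C)⊤Y + C(⊤p + p⊤)Y + C⊤ω_p(Y)` is solved for `Cp⊤Y`: the
first error term has one more `⊤` (hypothesis `H1`), the others have a shorter prefix and no fewer
`⊤`. -/
theorem wd_mem_map_psi_of_block {d e : ℕ}
    (H0 : ∀ l : List X, l.length = d → wd (ZMod 2) l ∈ (fil X d).map psi)
    (H1 : ∀ l : List X, l.length = d + 1 → d + 2 ≤ e + l.count ⊤ →
      wd (ZMod 2) l ∈ (fil X (d + 1)).map psi)
    (C Y : List X) (hC : ⊤ ∉ C) (hl : (C ++ ⊤ :: Y).length = d + 1)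
    (he : d + 2 ≤ e + 1 + (C ++ ⊤ :: Y).count ⊤) :
    wd (ZMod 2) (C ++ ⊤ :: Y) ∈ (fil X (d + 1)).map psi := by
  have key : ∀ {C Y : List X}, ⊤ ∉ C → (C ++ ⊤ :: Y).count ⊤ = Y.count ⊤ + 1 := by
    intro C Y hC
    rw [List.count_append, List.count_eq_zero.2 hC, List.count_cons_self, zero_add]
  induction C using List.reverseRecOn generalizing Y with
  | nil =>
    rw [List.nil_append, wd_cons, ← omega_top]
    exact omega_ι_mem_map ⊤ (H0 Y (by simpa using hl))
  | append_singleton C p ih =>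
    rw [key hC] at he
    have hC' : ⊤ ∉ C := fun h => hC (List.mem_append_left _ h)
    have hl' : C.length + Y.length + 1 = d := by
      simp only [List.length_append, List.length_cons, List.length_nil] at hl
      omega
    have e1 : wd (ZMod 2) (C ++ [p] ++ ⊤ :: Y) = omega (ι (ZMod 2) p) (wd (ZMod 2) (C ++ ⊤ :: Y)) -
        shift p (wd (ZMod 2) C) * wd (ZMod 2) (⊤ :: Y) - wd (ZMod 2) (C ++ ⊤ :: p :: Y) -
        wd (ZMod 2) (C ++ [⊤]) * omega (ι (ZMod 2) p) (wd (ZMod 2) Y) := by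
      simp only [wd_append, wd_cons, omega_ι_mul, shift_ι, top_inf_eq, wd_nil]
      noncomm_ring
    rw [e1]
    refine sub_mem (sub_mem (sub_mem ?_ ?_) ?_) ?_
    · refine omega_ι_mem_map p (H0 _ ?_)
      rw [List.length_append, List.length_cons]
      omega
    · refine mem_of_mem_span_wd (S := topWords X (d + 1) (1 + (Y.count ⊤ + 1)))
        (fun l hl => H1 l hl.1 ?_) (mul_mem_span_wd (shift_wd_mem_of_notMem p hC')
        (wd_mem_span (S := topWords X (Y.length + 1) (Y.count ⊤ + 1)) ⟨rfl, ?_⟩) ?_)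
      · have := hl.2
        omega
      · rw [List.count_cons_self]
      · intro u hu v hv
        have := append_mem_topWords hu hv
        rwa [show C.length + 1 + (Y.length + 1) = d + 1 by omega] at this
    · refine ih _ hC' ?_ ?_
      · rw [List.length_append, List.length_cons, List.length_cons]
        omega
      · rw [key hC', List.count_cons]
        omega
    · refine mem_of_mem_span_wd (S := {l | ∃ v ∈ topWords X (Y.length + 1) (Y.count ⊤),
        l = C ++ ⊤ :: v}) ?_ (mul_mem_span_wd (wd_mem_span (Set.mem_singleton _))
        (omega_wd_mem p Y) ?_)
      · rintro _ ⟨v, ⟨hv1, hv2⟩, rfl⟩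
        refine ih _ hC' ?_ ?_
        · rw [List.length_append, List.length_cons]
          omega
        · rw [key hC']
          omega
      · rintro _ rfl v hv
        exact ⟨v, hv, by simp⟩

/-- Induction on the length, and within it downwards on the number of `⊤`: the parameter `e` admits
words with at least `d + 2 - e` of them, so `e = 0` is vacuous. A word `lp` without `⊤` is `ω_p(l)`
minus a shift, all of whose words contain `⊤`. -/
theorem wd_mem_map_psi (l : List X) : wd (ZMod 2) l ∈ (fil X l.length).map psi := by
  suffices ∀ d, ∀ l : List X, l.length = d → wd (ZMod 2) l ∈ (fil X d).map psi from this _ l rfl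
  intro d
  induction d with
  | zero =>
    intro l hl
    rw [List.length_eq_zero_iff.1 hl]
    exact ⟨1, wd_mem_span (l := []) (le_refl 0), psi_one⟩
  | succ d H0 =>
    have : ∀ e, ∀ l : List X, l.length = d + 1 → d + 2 ≤ e + l.count ⊤ →
        wd (ZMod 2) l ∈ (fil X (d + 1)).map psi := by
      intro e
      induction e with
      | zero =>
        intro l hl h
        have := List.count_le_length (a := ⊤) (l := l)
        omega
      | succ e H1 =>
        intro l hl h
        by_cases ht : ⊤ ∈ l
        · obtain ⟨C, Y, rfl, hC⟩ := List.eq_append_cons_of_mem ht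
          exact wd_mem_map_psi_of_block H0 H1 C Y hC hl h
        · rw [List.count_eq_zero.2 ht] at h
          rcases List.eq_nil_or_concat' l with rfl | ⟨l, p, rfl⟩
          · simp at hl
          rw [List.length_append, List.length_singleton] at hl
          have ht' : ⊤ ∉ l := fun h => ht (List.mem_append_left _ h)
          have e1 : wd (ZMod 2) (l ++ [p]) =
              omega (ι (ZMod 2) p) (wd (ZMod 2) l) - shift p (wd (ZMod 2) l) := by
            rw [omega_ι, add_sub_cancel_left, wd_append, wd_singleton]
          rw [e1]
          refine sub_mem (omega_ι_mem_map p (H0 l (by omega))) ?_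
          refine mem_of_mem_span_wd (fun l' hl' => H1 l' ?_ ?_) (shift_wd_mem_of_notMem p ht')
          · rw [hl'.1]; omega
          · have := hl'.2
            omega
    intro l hl
    exact this (d + 2) l hl (by omega)

theorem psi_wd_mem_fil (l : List X) : psi (wd (ZMod 2) l) ∈ fil X l.length := by
  induction l with
  | nil => rw [wd_nil, psi_one]; exact wd_mem_span (l := []) (le_refl 0)
  | cons p l ih =>
    rw [wd_cons, psi_mul]
    refine mem_of_mem_span_wd (M := (fil X (l.length + 1)).comap (omega (ι (ZMod 2) p)))
      (fun v hv => ?_) ih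
    exact span_wd_mono (fun u hu => hu.1.le.trans (Nat.succ_le_succ hv)) (omega_wd_mem p v)

theorem exists_mem_fil (a : FreeAlgebra (ZMod 2) X) : ∃ d, a ∈ fil X d := by
  have ha : a ∈ Submodule.span (ZMod 2) (Set.range (wd (ZMod 2) (X := X))) := by
    rw [span_wd]; exact Submodule.mem_top
  induction ha using Submodule.span_induction with
  | mem a h =>
    obtain ⟨l, rfl⟩ := h
    exact ⟨_, wd_mem_span (le_refl l.length)⟩
  | zero => exact ⟨0, zero_mem _⟩
  | add a b _ _ ha hb =>
    obtain ⟨d, hd⟩ := ha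
    obtain ⟨e, he⟩ := hb
    exact ⟨max d e, add_mem (fil_mono (le_max_left _ _) hd) (fil_mono (le_max_right _ _) he)⟩
  | smul c a _ ha =>
    obtain ⟨d, hd⟩ := ha
    exact ⟨d, Submodule.smul_mem _ _ hd⟩

/-- The map preserves the finite-dimensional space of elements of degree at most `d` and is
surjective on it, hence injective. -/
theorem psi_injective [Finite X] : Function.Injective (psi (X := X)) := by
  rw [injective_iff_map_eq_zero]
  intro a ha
  obtain ⟨d, hd⟩ := exists_mem_fil a
  have hmap : ∀ b ∈ fil X d, psi b ∈ fil X d := fun b hb =>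
    mem_of_mem_span_wd (M := (fil X d).comap psi) (fun l hl => fil_mono hl (psi_wd_mem_fil l)) hb
  have hfin : FiniteDimensional (ZMod 2) (fil X d) :=
    FiniteDimensional.span_of_finite (ZMod 2) ((List.finite_length_le X d).image _)
  have hsurj : Function.Surjective (psi.restrict hmap) := by
    rintro ⟨b, hb⟩
    obtain ⟨r, hr, rfl⟩ := mem_of_mem_span_wd (M := (fil X d).map psi)
      (fun l hl => Submodule.map_mono (fil_mono hl) (wd_mem_map_psi l)) hb
    exact ⟨⟨r, hr⟩, rfl⟩
  have hinj := LinearMap.injective_iff_surjective.2 hsurj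
  have := hinj (a₁ := ⟨a, hd⟩) (a₂ := 0) (Subtype.ext (by simpa using ha))
  exact congrArg Subtype.val this

/-- Comparing coefficients in `a⊤ = ⊤a` moves an initial `⊤` of a word to its end without changing
the coefficient in `a`. Once `x` comes first, the coefficient is that of a word not starting with
`⊤` in `⊤a`. -/
theorem wcoeff_eq_zero_of_commute_top {a : FreeAlgebra (ZMod 2) X}
    (h : Commute a (ι (ZMod 2) ⊤)) (j : ℕ) {x : X} (hx : x ≠ ⊤) (l : List X) : wcoeff (List.replicate j ⊤ ++ x :: l) a = 0 := by
  induction j generalizing l with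
  | zero =>
    rw [List.replicate_zero, List.nil_append, ← wcoeff_concat_mul ⊤, h.eq, List.cons_append,
      wcoeff_cons_mul_of_ne hx.symm]
  | succ j ih =>
    rw [← wcoeff_concat_mul ⊤, h.eq, List.replicate_succ, List.cons_append, List.cons_append,
      wcoeff_cons_mul, List.append_assoc, List.cons_append]
    exact ih _

theorem mem_span_of_commute_top {a : FreeAlgebra (ZMod 2) X} (h : Commute a (ι (ZMod 2) ⊤)) :
    a ∈ Submodule.span (ZMod 2) (wd (ZMod 2) '' {l | ∀ x ∈ l, x = ⊤}) := by
  refine mem_span_wd_of_wcoeff fun l hl => ?_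
  have : ∃ j x l', x ≠ ⊤ ∧ l = List.replicate j ⊤ ++ x :: l' := by
    induction l with
    | nil => exact absurd (by simp) hl
    | cons y l ih =>
      by_cases hy : y = ⊤
      · subst hy
        obtain ⟨j, x, l', hx, rfl⟩ := ih fun h => hl (by simpa using h)
        exact ⟨j + 1, x, l', hx, rfl⟩
      · exact ⟨0, y, l, hy, rfl⟩
  obtain ⟨j, x, l', hx, rfl⟩ := this
  exact wcoeff_eq_zero_of_commute_top h j hx l'

/-- If `psi r` commutes with the letter `⊤`, then `r` is a polynomial in this letter. -/
theorem mem_span_of_psi_commute_top [Finite X] {r : FreeAlgebra (ZMod 2) X}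
    (h : Commute (psi r) (ι (ZMod 2) ⊤)) :
    r ∈ Submodule.span (ZMod 2) (wd (ZMod 2) '' {l | ∀ x ∈ l, x = ⊤}) := by
  have h1 := mem_span_of_commute_top h
  -- Polynomials in `⊤` are fixed by `psi`, because `⊤` acts as left multiplication; injectivity
  -- then gives `psi r = r`.
  have h2 : psi (psi r) = psi r := by
    refine mem_of_mem_span_wd (M := LinearMap.eqLocus psi LinearMap.id) (fun l hl => ?_) h1
    rw [LinearMap.mem_eqLocus, LinearMap.id_apply]
    induction l with
    | nil => exact psi_one
    | cons x l ih =>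
      rw [wd_cons, psi_mul, ih fun y hy => hl y (List.mem_cons_of_mem _ hy),
        hl x List.mem_cons_self, omega_top]
  rwa [psi_injective h2] at h1

end Cabling

/-! ### Injectivity criterion for actions by derivations -/

/-- Induction principle for the free Lie ring. -/
theorem FreeLieAlgebra.int_induction {X : Type*} {p : FreeLieAlgebra ℤ X → Prop}
    (of : ∀ x, p (FreeLieAlgebra.of ℤ x)) (zero : p 0) (add : ∀ a b, p a → p b → p (a + b))
    (neg : ∀ a, p a → p (-a)) (lie : ∀ a b, p a → p b → p ⁅a, b⁆) (a : FreeLieAlgebra ℤ X) :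
    p a := by
  induction a using FreeLieAlgebra.induction with
  | of x => exact of x
  | zero => exact zero
  | add a b ha hb => exact add a b ha hb
  | smul c a ha =>
    have h : ∀ c : ℕ, p (c • a) := by
      intro c
      induction c with
      | zero => rw [zero_smul]; exact zero
      | succ c ih => rw [succ_nsmul]; exact add _ _ ih ha
    have h' : ∀ c : ℤ, p (c • a) := by
      intro c
      rcases Int.eq_nat_or_neg c with ⟨d, rfl | rfl⟩
      · rw [natCast_zsmul]; exact h d
      · rw [neg_zsmul, natCast_zsmul]; exact neg _ (h d)
    exact h' c
  | lie a b ha hb => exact lie a b ha hb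

section

attribute [local instance] LieRing.ofAssociativeRing

open FreeAlgebra Cabling FreeLieAlgebra

theorem two_zsmul_freeAlgebra {X : Type*} (a : FreeAlgebra (ZMod 2) X) : (2 : ℤ) • a = 0 := by
  rw [two_zsmul, CharTwo.add_self_eq_zero]

/-- The map to the free associative algebra for which the partial sums of the generators are sent
to the letters. -/
noncomputable def diffLie (m : ℕ) :
    FreeLieAlgebra ℤ (Fin (m + 1)) →ₗ⁅ℤ⁆ FreeAlgebra (ZMod 2) (Fin (m + 1)) :=
  FreeLieAlgebra.lift ℤ
    (Fin.cases (ι (ZMod 2) 0) fun j => ι (ZMod 2) j.succ - ι (ZMod 2) j.castSucc)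

variable {m : ℕ}

theorem diffLie_of_zero : diffLie m (of ℤ 0) = ι (ZMod 2) 0 := FreeLieAlgebra.lift_of_apply ..

theorem diffLie_of_succ (j : Fin m) :
    diffLie m (of ℤ j.succ) = ι (ZMod 2) j.succ - ι (ZMod 2) j.castSucc :=
  FreeLieAlgebra.lift_of_apply ..

theorem diffLie_lie (a b : FreeLieAlgebra ℤ (Fin (m + 1))) :
    diffLie m ⁅a, b⁆ = diffLie m a * diffLie m b - diffLie m b * diffLie m a :=
  LieHom.map_lie _ a b

theorem diffLie_sum : diffLie m (∑ k, of ℤ k) = ι (ZMod 2) ⊤ := by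
  rw [map_sum, Fin.sum_univ_succ, diffLie_of_zero]
  simp only [diffLie_of_succ]
  rw [Finset.sum_sub_distrib, ← add_sub_assoc, ← Fin.sum_univ_succ (fun i => ι (ZMod 2) i),
    Fin.sum_univ_castSucc, add_sub_cancel_left]
  rfl

/-- An action of the free Lie ring on itself by derivations that is, modulo two, the action
induced by the cabling operation. -/
def IsCabling (Φ : FreeLieAlgebra ℤ (Fin (m + 1)) →ₗ⁅ℤ⁆
    LieDerivation ℤ (FreeLieAlgebra ℤ (Fin (m + 1))) (FreeLieAlgebra ℤ (Fin (m + 1)))) : Prop :=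
  ∀ p k : Fin (m + 1), ∃ b, Φ (of ℤ p) (of ℤ k) = (if k ≤ p then ⁅∑ i : Fin (m + 1), of ℤ i, of ℤ k⁆ else 0) + (2 : ℤ) • b

namespace IsCabling

variable {Φ : FreeLieAlgebra ℤ (Fin (m + 1)) →ₗ⁅ℤ⁆
    LieDerivation ℤ (FreeLieAlgebra ℤ (Fin (m + 1))) (FreeLieAlgebra ℤ (Fin (m + 1)))}

/-- Both sides are derivations, so letters suffice. The action of `p` multiplies the generators up
to `p` by the total sum and kills the others; on partial sums this truncates the index at `p`,
whence the infimum in `shift`. -/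
theorem shift_diffLie (h : IsCabling Φ) (p : Fin (m + 1)) (a : FreeLieAlgebra ℤ (Fin (m + 1))) :
    shift p (diffLie m a) = diffLie m (Φ (of ℤ p) a) := by
  induction a using FreeLieAlgebra.int_induction with
  | of k =>
    obtain ⟨b, hb⟩ := h p k
    rw [hb, map_add, map_zsmul, two_zsmul_freeAlgebra, add_zero]
    have hc : ∀ x : FreeAlgebra (ZMod 2) (Fin (m + 1)), -x = x := CharTwo.neg_eq
    induction k using Fin.cases with
    | zero =>
      rw [if_pos (Fin.zero_le p), diffLie_lie, diffLie_sum, diffLie_of_zero, shift_ι,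
        inf_eq_left.2 (Fin.zero_le p), sub_eq_add_neg, hc]
    | succ j =>
      rw [diffLie_of_succ, map_sub, shift_ι, shift_ι]
      split_ifs with hj
      · rw [inf_eq_left.2 hj, inf_eq_left.2 (j.castSucc_lt_succ.le.trans hj), diffLie_lie,
          diffLie_sum, diffLie_of_succ, sub_eq_add_neg (ι (ZMod 2) ⊤ * _),
          hc ((ι (ZMod 2) j.succ - _) * _)]
        noncomm_ring
      · have hj' : p ≤ j.castSucc := by
          rw [not_le] at hj
          exact Fin.le_castSucc_iff.2 hj
        rw [inf_eq_right.2 hj', inf_eq_right.2 (not_le.1 hj).le, sub_self, map_zero]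
  | zero => rw [map_zero, map_zero, map_zero, map_zero]
  | add a b ha hb => rw [map_add, map_add, map_add, map_add, ha, hb]
  | neg a ha => rw [map_neg, map_neg, map_neg, map_neg, ha]
  | lie a b ha hb =>
    rw [diffLie_lie, map_sub, shift_mul, shift_mul, ha, hb, LieDerivation.apply_lie_eq_add, map_add,
      diffLie_lie, diffLie_lie]
    noncomm_ring

/-- The first clause says that `x ↦ ω_w(x) - x ω_w(1)` is a derivation, the second that it induces
`Φ w` on Lie elements. They are proved together because the bracket case of the second uses the
first. -/
theorem omega_toFree (h : IsCabling Φ) (w : FreeLieAlgebra ℤ (Fin (m + 1))) :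
    (∀ x y, omega (toFree (ZMod 2) _ w) (x * y) = omega (toFree (ZMod 2) _ w) x * y +
      x * omega (toFree (ZMod 2) _ w) y - x * omega (toFree (ZMod 2) _ w) 1 * y) ∧
    ∀ a, omega (toFree (ZMod 2) _ w) (diffLie m a) =
      diffLie m (Φ w a) + diffLie m a * omega (toFree (ZMod 2) _ w) 1 := by
  induction w using FreeLieAlgebra.int_induction with
  | of p =>
    have h1 : shift p 1 = 0 := der_one _
    refine ⟨fun x y => ?_, fun a => ?_⟩
    · rw [toFree_of, omega_ι_mul, omega_ι, omega_ι, omega_ι, h1]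
      noncomm_ring
    · rw [toFree_of, omega_ι, omega_ι, h1, h.shift_diffLie, zero_add, one_mul]
  | zero => simp
  | add u w hu hw =>
    refine ⟨fun x y => ?_, fun a => ?_⟩
    · simp only [map_add, LinearMap.add_apply]
      rw [hu.1, hw.1]
      noncomm_ring
    · simp only [map_add, LinearMap.add_apply, LieDerivation.add_apply]
      rw [hu.2, hw.2]
      noncomm_ring
  | neg w hw =>
    refine ⟨fun x y => ?_, fun a => ?_⟩
    · simp only [map_neg, LinearMap.neg_apply]
      rw [hw.1]
      noncomm_ring
    · simp only [map_neg, LinearMap.neg_apply, LieDerivation.neg_apply]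
      rw [hw.2]
      noncomm_ring
  | lie u w hu hw =>
    have e : ∀ x, omega (toFree (ZMod 2) _ ⁅u, w⁆) x =
        omega (toFree (ZMod 2) _ u) (omega (toFree (ZMod 2) _ w) x) -
          omega (toFree (ZMod 2) _ w) (omega (toFree (ZMod 2) _ u) x) := by
      intro x
      rw [toFree_lie, map_sub, map_mul omega, map_mul omega]
      rfl
    refine ⟨fun x y => ?_, fun a => ?_⟩
    · simp only [e]
      rw [hu.1, hw.1]
      simp only [map_add, map_sub]
      rw [hu.1, hu.1, hu.1, hu.1, hw.1, hw.1, hw.1, hw.1]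
      noncomm_ring
    · rw [e, e, LieHom.map_lie, LieDerivation.lie_apply, map_sub]
      rw [hu.2, hw.2, map_add, map_add, hu.2, hw.2, hu.1, hw.1, hu.2, hw.2]
      noncomm_ring

/-- The total sum corresponds to the letter `⊤`. If `Φ w = 0`, then `ω_w(⊤) = ⊤ψ(w)`, while
commutation with right multiplication gives `ω_w(⊤) = ψ(w)⊤`; so the image of `w` modulo 2 is a
polynomial in `⊤`. -/
theorem exists_eq_of_eq_zero (h : IsCabling Φ) {w : FreeLieAlgebra ℤ (Fin (m + 1))}
    (hw : Φ w = 0) : ∃ (c : ℤ) (b : FreeLieAlgebra ℤ (Fin (m + 1))),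
      w = c • of ℤ ⊤ + (2 : ℤ) • b := by
  have hc : Commute (psi (toFree (ZMod 2) _ w)) (ι (ZMod 2) ⊤) := by
    have h1 := (h.omega_toFree w).2 (∑ k, of ℤ k)
    rw [diffLie_sum, hw, LieDerivation.zero_apply, map_zero, zero_add,
      ← one_mul (ι (ZMod 2) ⊤), omega_mul_top, one_mul] at h1
    exact h1
  have hs := mem_span_of_psi_commute_top hc
  -- Killing all letters but `⊤` fixes the image of `w` modulo 2. In the free Lie ring the same map
  -- leaves only multiples of one generator, since that generator has zero bracket with itself.
  let F : FreeLieAlgebra ℤ (Fin (m + 1)) →ₗ⁅ℤ⁆ FreeLieAlgebra ℤ (Fin (m + 1)) :=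
    FreeLieAlgebra.lift ℤ fun k => if k = ⊤ then of ℤ ⊤ else 0
  let f : FreeAlgebra (ZMod 2) (Fin (m + 1)) →ₐ[ZMod 2] FreeAlgebra (ZMod 2) (Fin (m + 1)) :=
    FreeAlgebra.lift _ fun k => if k = ⊤ then ι _ ⊤ else 0
  have hF : ∀ k, F (of ℤ k) = if k = ⊤ then of ℤ ⊤ else 0 := fun k =>
    FreeLieAlgebra.lift_of_apply ..
  have hf : ∀ k, f (ι _ k) = if k = ⊤ then ι _ ⊤ else 0 := fun k => FreeAlgebra.lift_ι_apply ..
  have hFf : ∀ a, toFree (ZMod 2) _ (F a) = f (toFree (ZMod 2) _ a) := by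
    intro a
    induction a using FreeLieAlgebra.int_induction with
    | of k =>
      rw [hF, toFree_of, hf]
      split_ifs
      · rw [toFree_of]
      · rw [map_zero]
    | zero => simp only [map_zero]
    | add a b ha hb => simp only [map_add, ha, hb]
    | neg a ha => simp only [map_neg, ha]
    | lie a b ha hb => rw [LieHom.map_lie, toFree_lie, toFree_lie, map_sub, map_mul, map_mul, ha, hb]
  have hFc : ∀ a, ∃ c : ℤ, F a = c • of ℤ ⊤ := by
    intro a
    induction a using FreeLieAlgebra.int_induction with
    | of k =>
      rw [hF]
      split_ifs
      · exact ⟨1, (one_zsmul _).symm⟩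
      · exact ⟨0, (zero_zsmul _).symm⟩
    | zero => exact ⟨0, by rw [map_zero, zero_zsmul]⟩
    | add a b ha hb =>
      obtain ⟨c, hc⟩ := ha
      obtain ⟨d, hd⟩ := hb
      exact ⟨c + d, by rw [map_add, hc, hd, add_zsmul]⟩
    | neg a ha =>
      obtain ⟨c, hc⟩ := ha
      exact ⟨-c, by rw [map_neg, hc, neg_zsmul]⟩
    | lie a b ha hb =>
      obtain ⟨c, hc⟩ := ha
      obtain ⟨d, hd⟩ := hb
      exact ⟨0, by rw [LieHom.map_lie, hc, hd, zsmul_lie, lie_zsmul, lie_self, smul_zero,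
        smul_zero, zero_zsmul]⟩
  have hfix : f (toFree (ZMod 2) _ w) = toFree (ZMod 2) _ w := by
    refine mem_of_mem_span_wd (M := LinearMap.eqLocus f.toLinearMap LinearMap.id)
      (fun l hl => ?_) hs
    rw [LinearMap.mem_eqLocus, LinearMap.id_apply, AlgHom.toLinearMap_apply]
    induction l with
    | nil => rw [wd_nil, map_one]
    | cons x l ih =>
      rw [wd_cons, map_mul, ih fun y hy => hl y (List.mem_cons_of_mem _ hy), hf,
        hl x List.mem_cons_self, if_pos rfl]
  obtain ⟨c, hc⟩ := hFc w
  obtain ⟨b, hb⟩ := exists_eq_two_smul (a := w - c • of ℤ ⊤) (by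
    rw [map_sub, ← hc, hFf, hfix, sub_self])
  exact ⟨c, b, by rw [← hb, add_sub_cancel]⟩

theorem exists_two_smul_of_eq_zero (h : IsCabling Φ) (hm : 1 ≤ m)
    {w : FreeLieAlgebra ℤ (Fin (m + 1))} (hw : Φ w = 0) : ∃ b, w = (2 : ℤ) • b ∧ Φ b = 0 := by
  obtain ⟨c, b, rfl⟩ := h.exists_eq_of_eq_zero hw
  obtain ⟨d, hd⟩ := h ⊤ 0
  rw [if_pos le_top] at hd
  -- The word `v_1 v_0` (indices from 0) occurs in `[∑ v_i, v_0]` with coefficient 1. It needs a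
  -- second letter, which is where `1 ≤ m` enters, and it detects the parity of `c`.
  have h0 := congrArg (fun D : LieDerivation ℤ _ _ =>
    wcoeff [⟨1, by omega⟩, 0] (toFree (ZMod 2) (Fin (m + 1)) (D (of ℤ 0)))) hw
  have e1 : wcoeff [⟨1, by omega⟩, 0] (toFree (ZMod 2) (Fin (m + 1))
      ⁅∑ i : Fin (m + 1), of ℤ i, of ℤ 0⁆) = 1 := by
    have h1 : ∀ i : Fin (m + 1), wcoeff [⟨1, by omega⟩, 0] (ι (ZMod 2) i * ι (ZMod 2) 0) =
        if i = ⟨1, by omega⟩ then 1 else 0 := by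
      intro i
      rw [← wd_singleton 0, ← wd_cons, wcoeff_wd]
      simp
    have h2 : ∀ i : Fin (m + 1),
        wcoeff [⟨1, by omega⟩, 0] (ι (ZMod 2) 0 * ι (ZMod 2) i) = 0 := fun i =>
      wcoeff_cons_mul_of_ne (by simp [Fin.ext_iff]) _ _
    simp only [toFree_lie, map_sum, map_sub, Finset.sum_mul, Finset.mul_sum, toFree_of, h1, h2]
    simp
  simp only [map_add, LieDerivation.add_apply, LieDerivation.zero_apply, map_zero, map_zsmul,
    LieDerivation.smul_apply, two_zsmul_freeAlgebra, add_zero, hd, e1] at h0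
  have h2 : (2 : ℤ) ∣ c := (ZMod.intCast_zmod_eq_zero_iff_dvd c 2).1 (by simpa using h0)
  obtain ⟨c, rfl⟩ := h2
  have e : (2 * c) • of ℤ ⊤ + (2 : ℤ) • b = (2 : ℤ) • (c • of ℤ ⊤ + b) := by
    rw [smul_add, mul_zsmul]
  refine ⟨_, e, ?_⟩
  ext k
  rw [e, map_zsmul] at hw
  exact eq_zero_of_two_smul (DFunLike.congr_fun hw k)

theorem injective (h : IsCabling Φ) (hm : 1 ≤ m) : Function.Injective Φ := by
  rw [injective_iff_map_eq_zero]
  intro w hw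
  refine eq_zero_of_forall_two_pow fun k => ?_
  suffices ∃ b, w = (2 ^ k : ℤ) • b ∧ Φ b = 0 by
    obtain ⟨b, hb, -⟩ := this
    exact ⟨b, hb⟩
  induction k with
  | zero => exact ⟨w, by rw [pow_zero, one_zsmul], hw⟩
  | succ k ih =>
    obtain ⟨b, hb, hb0⟩ := ih
    obtain ⟨b', rfl, hb'⟩ := h.exists_two_smul_of_eq_zero hm hb0
    exact ⟨b', by rw [hb, pow_succ, mul_comm, mul_zsmul, zsmul_comm], hb'⟩

end IsCabling

end

/-! ### The class of a cabling braid -/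

namespace BraidGroup

variable {n : ℕ}

/-- The positive braid spelled by a word in natural numbers. -/
def natWord (n : ℕ) (w : List ℕ) : BraidGroup n := (w.map (sig n)).prod

theorem natWord_append (u w : List ℕ) : natWord n (u ++ w) = natWord n u * natWord n w := by
  rw [natWord, List.map_append, List.prod_append]
  rfl

theorem natWord_block (n r m : ℕ) : natWord n ((List.range m).reverse.map (r + ·)) = desc n r m := by
  induction m with
  | zero => rfl
  | succ m ih =>
    rw [List.range_succ, List.reverse_append, List.map_append, natWord_append, ih, desc]
    simp [natWord]

theorem toPerm_desc_mid {a l : ℕ} (h : a + l ≤ n) (i : Fin (n + 1)) (hi : a < (i : ℕ))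
    (hi' : (i : ℕ) ≤ a + l) : (toPerm n (desc n a l) i : ℕ) + 1 = i := by
  induction l with
  | zero => omega
  | succ l ih =>
    rw [desc, map_mul, Equiv.Perm.mul_apply, toPerm_sig_val (by omega)]
    rcases hi'.lt_or_eq with h1 | h1
    · have h2 := ih (by omega) (by omega)
      rw [Equiv.swap_apply_of_ne_of_ne (by omega) (by omega), h2]
    · rw [toPerm_desc_gt (by omega) i (by omega), h1, ← add_assoc, Equiv.swap_apply_right]

/-- The permutation of the braid that moves `R` strands across a cable of `m` strands. -/
theorem toPerm_blocks {m R : ℕ} (h : m + R ≤ n + 1) (i : Fin (n + 1)) (hi : R ≤ (i : ℕ)) :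
    (toPerm n (natWord n ((List.range R).flatMap fun r => (List.range m).reverse.map (r + ·))) i : ℕ)
      = if (i : ℕ) < R + m then i - R else i := by
  induction R generalizing i with
  | zero => simp [natWord]
  | succ R ih =>
    rw [List.range_succ, List.flatMap_append, natWord_append, map_mul, Equiv.Perm.mul_apply,
      List.flatMap_singleton, natWord_block]
    by_cases h1 : (i : ℕ) ≤ R + m
    · have h2 := toPerm_desc_mid (n := n) (a := R) (l := m) (by omega) i (by omega) h1
      rw [ih (by omega) _ (by omega), if_pos (by omega), if_pos (by omega)]
      omega
    · have h2 := toPerm_desc_gt (n := n) (a := R) (l := m) (by omega) i (by omega)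
      rw [ih (by omega) _ (by omega), if_neg (by omega), if_neg (by omega), h2]

/-- The class of the pure braid spelled by a word followed by its reverse. -/
noncomputable def palClass (n : ℕ) : List ℕ → Gr (PureBraid n)
  | [] => 0
  | a :: w => conjGr (sig n a) (palClass n w) + (gradedAction n).pair a (a + 1)

theorem palClass_append (u w : List ℕ) :
    palClass n (u ++ w) = conjGr (natWord n u) (palClass n w) + palClass n u := by
  induction u with
  | nil => rw [List.nil_append, palClass, add_zero, natWord, List.map_nil, List.prod_nil, conjGr_one]
  | cons a u ih =>
    rw [List.cons_append, palClass, ih, map_add, ← conjGr_mul, palClass, add_assoc]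
    rfl

/-- With `w'` the reverse of `w`, one has `σ_a (w w') σ_a = (σ_a w w' σ_a⁻¹) σ_a²`, which is the
recursion of `palClass`. -/
theorem mk_word_reverse (w : List (Fin n)) :
    Gr.mk 0 (⟨word w * word w.reverse, toPerm_word_reverse w⟩ : PureBraid n) (Gr.mem_Gam_zero _) =
      palClass n (w.map (↑)) := by
  induction w with
  | nil =>
    rw [List.map_nil, palClass]
    refine (Gr.mk_congr rfl ?_ _ _).trans (Gr.mk_one 0)
    exact Subtype.ext (by simp [word])
  | cons a w ih =>
    rw [List.map_cons, palClass, ← ih, sig_of_lt a.2, conjGr, Gr.map_mk]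
    have e : (gradedAction n).pair a (a + 1) = sqClass 1 a :=
      ((gradedAction n).pair_succ a 0).trans (PureBraid.iter_gradedAction _ _ (by simp))
    rw [e, sqClass, ← Gr.mk_mul]
    refine Gr.mk_congr rfl (Subtype.ext ?_) _ _
    rw [Subgroup.coe_mul, coe_conjHom]
    simp only [conjSq, word, List.map_cons, List.prod_cons, List.reverse_cons, List.map_append,
      List.prod_append, List.map_nil, List.prod_nil, pow_two]
    group

theorem palClass_block {n r m : ℕ} (h : r + m ≤ n) :
    palClass n ((List.range m).reverse.map (r + ·)) =
      ∑ s ∈ Finset.range m, (gradedAction n).pair (r + s) (r + m) := by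
  induction m with
  | zero => rfl
  | succ m ih =>
    rw [List.range_succ, List.reverse_append, List.reverse_singleton, List.singleton_append,
      List.map_cons, palClass, ih (by omega), Finset.sum_range_succ, map_sum]
    congr 1
    refine Finset.sum_congr rfl fun s hs => ?_
    have hs' := Finset.mem_range.1 hs
    refine ((gradedAction n).C_pair (k := r + m) (i := r + s) (j := r + m) (by omega) (by omega)
      (by omega) (by omega)).trans ?_
    rw [Equiv.swap_apply_left, Equiv.swap_apply_of_ne_of_ne (by omega) (by omega)]
    rfl

theorem palClass_blocks {n m R : ℕ} (h : m + R ≤ n + 1) :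
    palClass n ((List.range R).flatMap fun r => (List.range m).reverse.map (r + ·)) =
      ∑ r ∈ Finset.range R, ∑ s ∈ Finset.range m, (gradedAction n).pair s (m + r) := by
  induction R with
  | zero => rfl
  | succ R ih =>
    rw [List.range_succ, List.flatMap_append, palClass_append, ih (by omega), List.flatMap_singleton,
      palClass_block (by omega), Finset.sum_range_succ, add_comm, map_sum]
    congr 1
    refine Finset.sum_congr rfl fun s hs => ?_
    have hs' := Finset.mem_range.1 hs
    -- The last block links `R + s` to `R + m` in its own positions. Conjugation by the preceding
    -- blocks carries `R + s` to `s` and fixes `R + m`.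
    have h1 := PureBraid.conjGr_Bs
      (natWord n ((List.range R).flatMap fun r => (List.range m).reverse.map (r + ·)))
      (i := ⟨R + s, by omega⟩) (j := ⟨R + m, by omega⟩) (by simp [Fin.ext_iff]; omega)
    rw [PureBraid.Bs, PureBraid.Bs, toPerm_blocks (by omega) _ (by simp),
      toPerm_blocks (by omega) _ (by simp), if_pos (by simpa using hs'), if_neg (by simp),
      add_tsub_cancel_left] at h1
    refine h1.trans ?_
    change (gradedAction n).pair s (R + m) = _
    rw [add_comm]

end BraidGroup

namespace PureBraid

variable {n : ℕ}

theorem map_val_cableWord (q : Fin n) : (cableWord q).map (Fin.val) =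
    (List.range (q + 1)).flatMap fun r => (List.range (n - q)).reverse.map (r + ·) := by
  have h : ∀ m, List.range m = (List.finRange m).map Fin.val := fun m => by simp
  rw [cableWord, List.map_flatMap, h (q + 1), List.flatMap_map]
  congr 1
  funext r
  rw [h (n - q), ← List.map_reverse, List.map_map, List.map_map]
  rfl

/-- The class of the cabling braid is the sum of the classes of the pairs of strands in distinct
cables. -/
theorem mk_cable (q : Fin n) : Gr.mk 0 (cable q) (Gr.mem_Gam_zero _) =
    ∑ r ∈ Finset.range (q + 1), ∑ s ∈ Finset.range (n - q),
      (gradedAction n).pair s (n - q + r) := by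
  have h := mk_word_reverse (cableWord q)
  rw [map_val_cableWord, palClass_blocks (by omega)] at h
  exact h

end PureBraid

/-! ### The cabling operation on the level of Lie rings -/

namespace PureBraid

open FreeLieAlgebra

variable {n : ℕ}

/-- The generators of the free Lie ring, indexed by natural numbers. -/
noncomputable def natOf (n i : ℕ) : FreeLieAlgebra ℤ (Fin n) :=
  if h : i < n then of ℤ ⟨i, h⟩ else 0

theorem natOf_val (i : Fin n) : natOf n i = of ℤ i := dif_pos i.2

theorem natOf_of_lt {i : ℕ} (h : i < n) : natOf n i = of ℤ ⟨i, h⟩ := dif_pos h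

variable {Ad : Gr (PureBraid n) →ₗ⁅ℤ⁆
    LieDerivation ℤ (FreeLieAlgebra ℤ (Fin n)) (FreeLieAlgebra ℤ (Fin n))}

theorem IsAd.pair_last (h : IsAd n Ad) {s : ℕ} (hs : s < n) (w : FreeLieAlgebra ℤ (Fin n)) :
    Ad ((gradedAction n).pair s n) w = ⁅natOf n s, w⁆ := by
  rw [natOf_of_lt hs]
  exact h.apply_last ⟨s, hs⟩ w

theorem IsAd.pair_natOf (h : IsAd n Ad) {s t k : ℕ} (hs : s < n) (ht : t < n) (hk : k < n)
    (hst : s ≠ t) : Ad ((gradedAction n).pair s t) (natOf n k) =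
      if k = s then ⁅natOf n s, natOf n t⁆ else if k = t then ⁅natOf n t, natOf n s⁆ else 0 := by
  have := h.apply_of (i := ⟨s, hs⟩) (j := ⟨t, ht⟩) (by simpa using hst) ⟨k, hk⟩
  simp only [Fin.mk.injEq, ← natOf_of_lt] at this
  exact this

theorem IsAd.cable_natOf (h : IsAd n Ad) (q : Fin n) {k : ℕ} (hk : k < n) :
    Ad (Gr.mk 0 (cable q) (Gr.mem_Gam_zero _)) (natOf n k) =
      (∑ r ∈ Finset.range q, ∑ s ∈ Finset.range (n - q),
        if k = s then ⁅natOf n s, natOf n (n - q + r)⁆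
        else if k = n - q + r then ⁅natOf n (n - q + r), natOf n s⁆ else 0) +
      ∑ s ∈ Finset.range (n - q), ⁅natOf n s, natOf n k⁆ := by
  let ev : Gr (PureBraid n) →+ FreeLieAlgebra ℤ (Fin n) :=
    AddMonoidHom.mk' (fun x => Ad x (natOf n k)) fun x y => by
      rw [map_add, LieDerivation.add_apply]
  change ev _ = _
  have hq := q.2
  -- The term `r = q` is split off: `n - q + q = n` is the last strand, whose pairs act as inner
  -- derivations.
  rw [mk_cable, Finset.sum_range_succ, map_add, map_sum, map_sum]
  congr 1
  · refine Finset.sum_congr rfl fun r hr => ?_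
    have hr' := Finset.mem_range.1 hr
    rw [map_sum]
    refine Finset.sum_congr rfl fun s hs => ?_
    have hs' := Finset.mem_range.1 hs
    exact h.pair_natOf (by omega) (by omega) hk (by omega)
  · refine Finset.sum_congr rfl fun s hs => ?_
    have hs' := Finset.mem_range.1 hs
    rw [Nat.sub_add_cancel hq.le]
    exact h.pair_last (by omega) _

/-- For `k` in the first cable the result is `[v_k, second cable] + [first cable, v_k]`, the last
strand being left out of the second cable; modulo 2 the sign is immaterial and the total sum
appears. For `k` in the second cable the two contributions cancel exactly. -/
theorem IsAd.exists_cable_of (h : IsAd n Ad) (q k : Fin n) :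
    ∃ b, Ad (Gr.mk 0 (cable q) (Gr.mem_Gam_zero _)) (of ℤ k) =
      (if k ≤ q.rev then ⁅∑ i : Fin n, of ℤ i, of ℤ k⁆ else 0) + (2 : ℤ) • b := by
  have hq := q.2
  rw [← natOf_val, h.cable_natOf q k.2]
  split_ifs with hkq
  · have hkq' : (k : ℕ) < n - q := by
      have := Fin.le_def.1 hkq
      rw [Fin.val_rev] at this
      omega
    have hsum : ∑ i : Fin n, of ℤ i = ∑ s ∈ Finset.range (n - q), natOf n s +
        ∑ r ∈ Finset.range q, natOf n (n - q + r) := by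
      rw [← Finset.sum_range_add, Nat.sub_add_cancel hq.le, ← Fin.sum_univ_eq_sum_range]
      exact Finset.sum_congr rfl fun i _ => (natOf_val i).symm
    have h1 : ∀ r ∈ Finset.range (q : ℕ), (∑ s ∈ Finset.range (n - q),
        if (k : ℕ) = s then ⁅natOf n s, natOf n (n - q + r)⁆
        else if (k : ℕ) = n - q + r then ⁅natOf n (n - q + r), natOf n s⁆ else 0) =
        ⁅natOf n k, natOf n (n - q + r)⁆ := by
      intro r _
      rw [Finset.sum_congr rfl fun s _ => by rw [if_neg (show (k : ℕ) ≠ n - q + r by omega)],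
        Finset.sum_ite_eq, if_pos (Finset.mem_range.2 hkq')]
    refine ⟨⁅natOf n k, ∑ r ∈ Finset.range q, natOf n (n - q + r)⁆, ?_⟩
    rw [Finset.sum_congr rfl h1, ← lie_sum, ← sum_lie, hsum, add_lie, two_zsmul,
      ← lie_skew (∑ r ∈ Finset.range (q : ℕ), natOf n (n - q + r))]
    abel
  · have hkq' : n - q ≤ (k : ℕ) := by
      rw [Fin.le_def, Fin.val_rev] at hkq
      omega
    obtain ⟨r₀, hr₀⟩ : ∃ r₀, (k : ℕ) = n - q + r₀ := ⟨k - (n - q), by omega⟩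
    have hk := k.2
    refine ⟨0, ?_⟩
    have h1 : ∀ r ∈ Finset.range (q : ℕ), (∑ s ∈ Finset.range (n - q),
        if (k : ℕ) = s then ⁅natOf n s, natOf n (n - q + r)⁆
        else if (k : ℕ) = n - q + r then ⁅natOf n (n - q + r), natOf n s⁆ else 0) =
        if r₀ = r then ∑ s ∈ Finset.range (n - q), ⁅natOf n k, natOf n s⁆ else 0 := by
      intro r _
      rcases eq_or_ne r₀ r with rfl | hr
      · rw [if_pos rfl]
        refine Finset.sum_congr rfl fun s hs => ?_
        have := Finset.mem_range.1 hs
        rw [if_neg (by omega), if_pos hr₀, hr₀]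
      · rw [if_neg hr]
        refine Finset.sum_eq_zero fun s hs => ?_
        have := Finset.mem_range.1 hs
        rw [if_neg (by omega), if_neg (by omega)]
    rw [Finset.sum_congr rfl h1, Finset.sum_ite_eq, if_pos (Finset.mem_range.2 (by omega)),
      ← lie_sum, ← sum_lie, ← lie_skew, neg_add_cancel, smul_zero, add_zero]

theorem IsAd.comp_map_Theta_injective (h : IsAd n Ad) (hn : 2 ≤ n) :
    Function.Injective (Ad.comp (Gr.map (Theta n))) := by
  obtain ⟨m, rfl⟩ : ∃ m, n = m + 1 := ⟨n - 1, by omega⟩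
  -- Reversing the indices makes the first cable of the `p`-th generator consist of the strands `0,
  -- …, p`, as required by `IsCabling`.
  let ρ : FreeLieAlgebra ℤ (Fin (m + 1)) →ₗ⁅ℤ⁆ FreeLieAlgebra ℤ (Fin (m + 1)) :=
    FreeLieAlgebra.lift ℤ fun p => of ℤ p.rev
  have hρ : ∀ p, ρ (of ℤ p) = of ℤ p.rev := fun p => FreeLieAlgebra.lift_of_apply ..
  have hρρ : ρ.comp ρ = LieHom.id := FreeLieAlgebra.int_hom_ext fun p => by
    rw [LieHom.comp_apply, hρ, hρ, Fin.rev_rev]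
    rfl
  have hρs : Function.Surjective ρ := fun a => ⟨ρ a, LieHom.congr_fun hρρ a⟩
  have hΦ : IsCabling (((Ad.comp (Gr.map (Theta (m + 1)))).comp (freeLieToGr _)).comp ρ) := by
    intro p k
    obtain ⟨b, hb⟩ := h.exists_cable_of p.rev k
    rw [Fin.rev_rev] at hb
    refine ⟨b, hb ▸ ?_⟩
    rw [LieHom.comp_apply, hρ, LieHom.comp_apply, freeLieToGr_of, LieHom.comp_apply, Gr.map_mk]
    congr 2
    exact Gr.mk_congr rfl (FreeGroup.lift_apply_of ..) _ _
  refine Function.Injective.of_comp_right ?_ (freeLieToGr_surjective (Fin (m + 1)))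
  exact Function.Injective.of_comp_right (hΦ.injective (by omega)) hρs

end PureBraid
theorem mainTheorem6 (n : ℕ) (hn : 2 ≤ n) :
    Function.Injective (PureBraid.lastStrand n) ∧
    (∃! Ad, PureBraid.IsAd n Ad) ∧
    ∀ Ad, PureBraid.IsAd n Ad →
      (∀ i k : Fin n,
        Ad (PureBraid.B i.castSucc (Fin.last n) (Fin.castSucc_lt_last i)) (FreeLieAlgebra.of ℤ k) =
          ⁅FreeLieAlgebra.of ℤ i, FreeLieAlgebra.of ℤ k⁆) ∧
      (∀ (i j : Fin n) (hij : i < j) (k : Fin n),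
        Ad (PureBraid.B i.castSucc j.castSucc (Fin.castSucc_lt_castSucc_iff.2 hij))
            (FreeLieAlgebra.of ℤ k) =
          if k = i then ⁅FreeLieAlgebra.of ℤ i, FreeLieAlgebra.of ℤ j⁆
          else if k = j then ⁅FreeLieAlgebra.of ℤ j, FreeLieAlgebra.of ℤ i⁆
          else 0) ∧
      Function.Injective (Ad.comp (Gr.map (PureBraid.Theta n))) := by
  refine ⟨PureBraid.lastStrand_injective n, PureBraid.existsUnique_isAd n, fun Ad h =>
    ⟨fun i k => ?_, fun i j hij k => ?_, h.comp_map_Theta_injective hn⟩⟩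
  · rw [PureBraid.B_eq_Bs, h.apply_last]
  · rw [PureBraid.B_eq_Bs, h.apply_of hij.ne]
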